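/- Let $p$ be a prime, $k>2$ an even integer, $n=k-2$, $\Gamma=\mathrm{SL}_2(\mathbb Z[1/p])$, $K\subset\mathbb C_p$ the unramified quadratic extension of $\mathbb Q_p$, and $\mathcal H_F=\mathbb P^1(\mathbb C_p)\setminus\mathbb P^1(F)$ for $F=\mathbb Q_p,K$. For $l\ge 0$ let $\mathcal H_F^{\le l}$ be the affinoid of those $z$ with $\mathrm{ord}_p(x_0z_1-x_1z_0)\le l$ for all $x\in\mathbb P^1(F)$ (primitive coordinates), i.e. the preimage under reduction $\mathrm{red}_F$ of the part of level $\le l$ of the Bruhat–Tits tree $\mathcal T_F$. Let $\mathscr L\in\mathbb C_p$ and let $\log_{\mathscr L}$ be the branch of the $p$-adic logarithm with $\log_{\mathscr L}(p)=\mathscr L$. Fix embeddings of $\overline{\mathbb Q}$ into $\mathbb C$ and $\mathbb C_p$. An inert RM-point is a $\tau\in\overline{\mathbb Q}$ such that $\mathbb Q(\tau)$ is a real quadratic field in which $p$ is inert; then $\tau\in K\setminus\mathbb Q_p$. Let $\bar w$ denote the conjugate of a quadratic irrationality $w$, and $(w,\bar w)\cdot(r,s)\in\{-1,0,1\}$ the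 signed intersection number of the oriented geodesics of the complex upper half-plane from $w$ to $\bar w$ and from the cusp $r$ to the cusp $s$. For $r,s\in\mathbb P^1(\mathbb Q)$ put $\Sigma_\tau\{r,s\}=\{w\in\Gamma\tau:(w,\bar w)\cdot(r,s)\ne0\}$ and let $\Sigma^{\le l}_\tau\{r,s\}$ be its finite subset of the $w$ whose reduction to $\mathcal T_{\mathbb Q_p}$ has level at most $l$. Put $P_w(T)=\frac{(T-w)^{n/2}(T-\bar w)^{n/2}}{(w-\bar w)^{n/2}}$. Let $\mathcal D=\sum_i m_i[\tau_i]$ be a finite integral combination of $\Gamma$-orbits of inert RM-points, of degree $0$ in the sense that for all $r,s\in\mathbb P^1(\mathbb Q)$ and every vertex $v$ of $\mathcal T_{\mathbb Q_p}$ $$\sum_i\sum_{w\in\Gamma\tau_i,\ \mathrm{red}_{\mathbb Q_p}(w)=v}m_i[(w,\bar w)\cdot(r,s)]\,P_w(T)=0 .$$ For an oriented edge $e$ of $\mathcal T_K$ let $U_e\subset\mathbb P^1(K)$ be the set of ends of the paths beginning with $e$. Let $\Phi_{k,\mathcal D}\{r,s\}$ be the function on oriented edges given by $\Phi(e)=\sum_i\sum_{w\in\Sigma_{\tau_i}\{r,s\}\cap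 U_e}m_i[(w,\bar w)\cdot(r,s)]P_w$ if $U_e\cap\mathbb P^1(\mathbb Q_p)=\emptyset$, by $\Phi(\bar e)=-\Phi(e)$, and by $\Phi(e)=0$ for the edges of $\mathcal T_{\mathbb Q_p}$. Let $\mu$ be the measure on $\mathbb P^1(K)$ with $\mu(U_e)=\Phi(e)$; locally polynomial functions of degree $\le n$ are integrated through the pairing $\langle T^i,T^j\rangle=(-1)^i\binom ni^{-1}\delta_{i+j,n}$. Let $$J_{k,\mathcal D}\{r,s\}(z)=\int_{\mathbb P^1(K)}\frac{1}{z-t}\,d\mu(t)\qquad(z\in\mathcal H_K)$$ be its Schneider–Teitelbaum lift, the integral being the limit over discs of $\mathbb P^1(K)$ modulo $p^l$, as $l\to\infty$, of the integrals of the Taylor polynomials of degree $\le n$ of the integrand. Let $\langle f,g\rangle_M$ be the Morita pairing of a rigid analytic function $f$ of weight $k$ on $\mathcal H_K$ with a locally analytic function $g$ on $K$ having a pole of order at most $n$ at $\infty$, modulo polynomials of degree $\le n$: it is $-\sum_{\sigma\in\mathbb P^1(K)}\mathrm{res}_\sigma(f(z)g(z)\,dz)$, so that $\langle f,\frac1{t-\tau}\rangle_M=f(\tau)$.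 Put $$J^{\mathscr L}_{k,\mathcal D}\{r,s\}(z)=\langle J_{k,\mathcal D}\{r,s\},l_z\rangle_M,\qquad l_z(t)=\begin{cases}-\frac1{n!}(t-z)^n\log_{\mathscr L}(t-z)&|t|\le1,\\-\frac1{n!}(t-z)^n\log_{\mathscr L}(1-\frac zt)&|t|>1.\end{cases}$$ Let $t_w(z)=z-w$ if $|w|\le1$ and $t_w(z)=\frac zw-1$ if $|w|>1$. Let $$q_w(z)=-\sum_{a=1}^{n/2}\left(\sum_{i=0}^{a-1}\frac{(-1)^{n-i}\binom ni}{a-i}\right)\frac{(-1)^a\binom{n-a}{n/2-a}(w-\bar w)^{a-n/2}}{\binom n{n/2}}(z-w)^{n-a},$$ and put $p_w=q_w$ if $|w|\le1$, and, if $|w|>1$, $$p_w(z)=q_w(z)+\sum_{i=n/2+1}^n(-1)^i\binom ni\left(\sum_{j=1}^{i-n/2}\frac{(-1)^j(-1)^{n-i+j}\binom{i-j}{i-j-n/2}(w-\bar w)^{n/2-i+j}}{\binom n{n/2}\,j\,w^j}\right)(z-w)^i .$$ Then the integral defining $J_{k,\mathcal D}\{r,s\}$ converges on $\mathcal H_K$,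 the pairings defining $J^{\mathscr L}_{k,\mathcal D}\{r,s\}(z)$ exist, and for all $r,s\in\mathbb P^1(\mathbb Q)$ and all $z\in\mathcal H_K$ $$J^{\mathscr L}_{k,\mathcal D}\{r,s\}(z)=\lim_{l\to\infty}\frac1{n!}\sum_i\sum_{w\in\Sigma^{\le l}_{\tau_i}\{r,s\}}m_i[(w,\bar w)\cdot(r,s)]\left(\frac{(z-w)^{n/2}(z-\bar w)^{n/2}}{(w-\bar w)^{n/2}}\log_{\mathscr L}(t_w(z))+p_w(z)\right),$$ and the convergence is uniform on every affinoid $\mathcal H_K^{\le m}$. -/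

import Mathlib

open Filter Topology Polynomial

noncomputable section

namespace HigherGreen

/-! ### The projective line, the upper half-plane and the tree

`P^1(ℂ_p)` is `OnePoint ℂ_[p]`. The base field `F ⊆ ℂ_p` is `ℚ_p` (the bottom intermediate field) or
the unramified quadratic extension `K`; in both cases `p` is a uniformizer. -/

section Tree

variable {p : ℕ} [Fact p.Prime]

/-- The unramified quadratic extension of `ℚ_p` inside `ℂ_p`, generated by the roots of
`X ^ (p ^ 2) - X`. -/
def unramifiedQuadratic (p : ℕ) [Fact p.Prime] : IntermediateField ℚ_[p] ℂ_[p] :=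
  IntermediateField.adjoin ℚ_[p] {x : ℂ_[p] | x ^ (p ^ 2) = x}

/-- `P^1(F)` inside `P^1(ℂ_p)`. -/
def projLine (F : IntermediateField ℚ_[p] ℂ_[p]) : Set (OnePoint ℂ_[p]) :=
  {x | x = OnePoint.infty ∨ ∃ a ∈ F, x = (a : OnePoint ℂ_[p])}

/-- `|x₀ y₁ - x₁ y₀|` for primitive homogeneous coordinates of two points of `P^1(ℂ_p)`, that is
`p ^ (-ord_p (x₀ y₁ - x₁ y₀))`. -/
def projDist : OnePoint ℂ_[p] → OnePoint ℂ_[p] → ℝ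
  | none, none => 0
  | none, some y => 1 / max 1 ‖y‖
  | some x, none => 1 / max 1 ‖x‖
  | some x, some y => ‖x - y‖ / (max 1 ‖x‖ * max 1 ‖y‖)

/-- The closed disc `{ord_p ≥ l}` of `P^1(F)` around `x`. -/
def closedDisc (F : IntermediateField ℚ_[p] ℂ_[p]) (x : OnePoint ℂ_[p]) (l : ℕ) :
    Set (OnePoint ℂ_[p]) :=
  {y | y ∈ projLine F ∧ projDist x y ≤ (p : ℝ) ^ (-(l : ℤ))}

/-- The vertices of the Bruhat--Tits tree of `F`. A vertex `v` is recorded by the disc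
`U_v ⊆ P^1(F)` of all ends of non-backtracking paths which start at the standard vertex and pass
through `v`; this is a bijection between vertices of level `l` and discs `{ord_p ≥ l}`, and
the standard vertex corresponds to `P^1(F)`.

In the same way an oriented edge `e` is recorded by the set `U_e` of ends of the paths that
begin with `e`: the edges of level `l ≥ 1` pointing away from the standard vertex are the discs
`closedDisc F x l`, and reversing the orientation replaces `U_e` by `P^1(F) \ U_e`. -/
def vertices (F : IntermediateField ℚ_[p] ℂ_[p]) : Set (Set (OnePoint ℂ_[p])) :=
  {U | ∃ x ∈ projLine F, ∃ l : ℕ, U = closedDisc F x l}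

/-- `red_F z = v`: the smallest closed disc around `z` which meets `P^1(F)` has an integral
radius exponent `l` and cuts out `U_v`. -/
def ReducesTo (F : IntermediateField ℚ_[p] ℂ_[p]) (z : ℂ_[p]) (v : Set (OnePoint ℂ_[p])) : Prop :=
  v.Nonempty ∧ ∃ l : ℕ, v = closedDisc F (z : OnePoint ℂ_[p]) l ∧
    ∀ x ∈ projLine F, (p : ℝ) ^ (-(l : ℤ)) ≤ projDist x (z : OnePoint ℂ_[p])

/-- The `ℂ_p`-points of the upper half-plane `H_F = P^1(ℂ_p) \ P^1(F)`. -/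
def upperHalf (F : IntermediateField ℚ_[p] ℂ_[p]) : Set ℂ_[p] := {z | z ∉ F}

/-- The affinoid `H_F^{≤ l}`, the preimage under reduction of the subtree of level at most `l`:
the complement of the open discs `{ord_p > l}` around the points of `P^1(F)`. -/
def affinoid (F : IntermediateField ℚ_[p] ℂ_[p]) (l : ℕ) : Set ℂ_[p] :=
  {z | ∀ x ∈ projLine F, (p : ℝ) ^ (-(l : ℤ)) ≤ projDist x (z : OnePoint ℂ_[p])}

/-- `R` together with `∞` is a set of representatives of `P^1(F)` modulo `p ^ l`. -/
def IsReps (F : IntermediateField ℚ_[p] ℂ_[p]) (l : ℕ) (R : Finset ℂ_[p]) : Prop :=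
  (∀ a ∈ R, a ∈ F) ∧
  ∀ x ∈ projLine F, ∃! y : OnePoint ℂ_[p],
    (y = OnePoint.infty ∨ ∃ a ∈ R, y = (a : OnePoint ℂ_[p])) ∧
      projDist y x ≤ (p : ℝ) ^ (-(l : ℤ))

end Tree

/-! ### The `p`-adic logarithm -/

section Logarithm

variable {p : ℕ} [Fact p.Prime]

/-- The series `log (1 + x) = ∑_{j ≥ 1} (-1) ^ (j - 1) x ^ j / j`. -/
def logOneAdd (x : ℂ_[p]) : ℂ_[p] :=
  ∑' j : ℕ, (-1) ^ j * x ^ (j + 1) / ((j : ℂ_[p]) + 1)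

open Classical in
/-- The branch of the `p`-adic logarithm with `log p = L`. Every `x ≠ 0` satisfies
`x ^ N = p ^ m * u` with `N ≥ 1` and `|u - 1| < 1`, and then
`log x = (m * L + log u) / N`, which does not depend on the choice of `(N, m)`. -/
def padicLog (L x : ℂ_[p]) : ℂ_[p] :=
  if h : ∃ q : ℕ × ℤ, 0 < q.1 ∧ ‖x ^ q.1 * (p : ℂ_[p]) ^ (-q.2) - 1‖ < 1 then
    ((h.choose.2 : ℂ_[p]) * L
      + logOneAdd (x ^ h.choose.1 * (p : ℂ_[p]) ^ (-h.choose.2) - 1)) / (h.choose.1 : ℂ_[p])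
  else 0

end Logarithm

/-! ### RM-points -/

section RealMultiplication

/-- The conjugate of a quadratic irrationality: the trace minus the number. -/
def conj (w : AlgebraicClosure ℚ) : AlgebraicClosure ℚ :=
  algebraMap ℚ (AlgebraicClosure ℚ) (-(minpoly ℚ w).coeff 1) - w

/-- Inert RM-points: `ℚ(τ)` is a real quadratic field, `τ` lies in the `p`-adic upper half-plane,
and `p` is inert in `ℚ(τ)`, that is, `ℚ_p(τ)` is the unramified quadratic extension of `ℚ_p`. -/
structure IsInertRM {p : ℕ} [Fact p.Prime] (ιInf : AlgebraicClosure ℚ →+* ℂ)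
    (ιp : AlgebraicClosure ℚ →+* ℂ_[p]) (τ : AlgebraicClosure ℚ) : Prop where
  quadratic : (minpoly ℚ τ).natDegree = 2
  real : (ιInf τ).im = 0
  mem_upperHalf : ιp τ ∈ upperHalf (⊥ : IntermediateField ℚ_[p] ℂ_[p])
  inert : ιp τ ∈ unramifiedQuadratic p

/-- The ring `ℤ[1/p]`. -/
abbrev ZInv (p : ℕ) : Subalgebra ℤ ℚ := Algebra.adjoin ℤ {(p : ℚ)⁻¹}

/-- The orbit of `τ` under Möbius transformations in `Γ = SL_2(ℤ[1/p])`. -/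
def orbit (p : ℕ) (τ : AlgebraicClosure ℚ) : Set (AlgebraicClosure ℚ) :=
  {w | ∃ γ : Matrix.SpecialLinearGroup (Fin 2) (ZInv p),
    w = (algebraMap ℚ (AlgebraicClosure ℚ) (γ 0 0) * τ + algebraMap ℚ (AlgebraicClosure ℚ) (γ 0 1))
      / (algebraMap ℚ (AlgebraicClosure ℚ) (γ 1 0) * τ
          + algebraMap ℚ (AlgebraicClosure ℚ) (γ 1 1))}

open Classical in
/-- `1` if the cusp `x` lies in the open real interval with endpoints `a`, `b`, and `0` otherwise
(in particular for `x = ∞`). -/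
def cuspInside (a b : ℝ) : OnePoint ℚ → ℤ
  | none => 0
  | some x => if min a b < (x : ℝ) ∧ (x : ℝ) < max a b then 1 else 0

/-- The signed topological intersection number `(a, b) · (r, s)` of the oriented geodesic of the
complex upper half-plane from `a` to `b` (real, irrational, distinct) with the one from the cusp `r`
to the cusp `s`, where `(-1, 1) · (0, ∞) = 1`. -/
def geodesicIntersection (a b : ℝ) (r s : OnePoint ℚ) : ℤ :=
  (SignType.sign (b - a) : ℤ) * (cuspInside a b r - cuspInside a b s)

/-- The intersection number `(w, w̄) · (r, s)` of an RM-point. -/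
def rmIntersection (ιInf : AlgebraicClosure ℚ →+* ℂ) (w : AlgebraicClosure ℚ)
    (r s : OnePoint ℚ) : ℤ :=
  geodesicIntersection (ιInf w).re (ιInf (conj w)).re r s

/-- `Σ_τ{r, s}`. -/
def sigmaSet (p : ℕ) (ιInf : AlgebraicClosure ℚ →+* ℂ) (τ : AlgebraicClosure ℚ)
    (r s : OnePoint ℚ) : Set (AlgebraicClosure ℚ) :=
  {w | w ∈ orbit p τ ∧ rmIntersection ιInf w r s ≠ 0}

variable {p : ℕ} [Fact p.Prime]

/-- `Σ_τ^{≤ l}{r, s}`: the points whose reduction to the tree of `ℚ_p` has level at most `l`. -/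
def sigmaSetLE (ιInf : AlgebraicClosure ℚ →+* ℂ) (ιp : AlgebraicClosure ℚ →+* ℂ_[p])
    (τ : AlgebraicClosure ℚ) (r s : OnePoint ℚ) (l : ℕ) : Set (AlgebraicClosure ℚ) :=
  {w | w ∈ sigmaSet p ιInf τ r s ∧ ιp w ∈ affinoid (⊥ : IntermediateField ℚ_[p] ℂ_[p]) l}

/-- The polynomial `(T - w)^{n/2} (T - w̄)^{n/2} / (w - w̄)^{n/2}`. -/
def rmPoly (ιp : AlgebraicClosure ℚ →+* ℂ_[p]) (n : ℕ) (w : AlgebraicClosure ℚ) : ℂ_[p][X] :=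
  C (((ιp w - ιp (conj w)) ^ (n / 2))⁻¹) *
    ((X - C (ιp w)) ^ (n / 2) * (X - C (ιp (conj w))) ^ (n / 2))

/-- The degree `Deg_{k, D}{r, s}(v)`, with `n = k - 2`. An RM-divisor `∑ m_i [τ_i]` is represented by
the finitely supported function `τ_i ↦ m_i`. -/
def degSymbol (ιInf : AlgebraicClosure ℚ →+* ℂ) (ιp : AlgebraicClosure ℚ →+* ℂ_[p]) (n : ℕ)
    (D : AlgebraicClosure ℚ →₀ ℤ) (r s : OnePoint ℚ) (v : Set (OnePoint ℂ_[p])) : ℂ_[p][X] :=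
  D.sum fun τ m =>
    ∑ᶠ w ∈ {w | w ∈ sigmaSet p ιInf τ r s ∧
        ReducesTo (⊥ : IntermediateField ℚ_[p] ℂ_[p]) (ιp w) v},
      (m * rmIntersection ιInf w r s) • rmPoly ιp n w

/-- `D` is of (strong) degree zero in weight `n + 2`: the symbol `Deg_{k, D}` vanishes. -/
def IsDegreeZero (ιInf : AlgebraicClosure ℚ →+* ℂ) (ιp : AlgebraicClosure ℚ →+* ℂ_[p]) (n : ℕ)
    (D : AlgebraicClosure ℚ →₀ ℤ) : Prop :=
  ∀ r s : OnePoint ℚ, ∀ v ∈ vertices (⊥ : IntermediateField ℚ_[p] ℂ_[p]),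
    degSymbol ιInf ιp n D r s v = 0

/-- The sum over the `w ∈ Σ_{τ_i}{r, s}` that lie in a set `U` of points of `P^1(K)`. -/
def sumOver (ιInf : AlgebraicClosure ℚ →+* ℂ) (ιp : AlgebraicClosure ℚ →+* ℂ_[p]) (n : ℕ)
    (D : AlgebraicClosure ℚ →₀ ℤ) (r s : OnePoint ℚ) (U : Set (OnePoint ℂ_[p])) : ℂ_[p][X] :=
  D.sum fun τ m =>
    ∑ᶠ w ∈ {w | w ∈ sigmaSet p ιInf τ r s ∧ ((ιp w : ℂ_[p]) : OnePoint ℂ_[p]) ∈ U},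
      (m * rmIntersection ιInf w r s) • rmPoly ιp n w

open Classical in
/-- The edge function `Φ_{k, D}{r, s}` on the tree of `K`, as a function of the set `U = U_e` of an
oriented edge `e`. If `U_e` does not meet `P^1(ℚ_p)`, it is the sum over the points in `U_e`; if
this holds for the reversed edge, it is minus the value there. The remaining edges, those for which
both sides meet `P^1(ℚ_p)`, are the edges of the tree of `ℚ_p`, where the value is `0`. -/
def edgeFunction (ιInf : AlgebraicClosure ℚ →+* ℂ) (ιp : AlgebraicClosure ℚ →+* ℂ_[p]) (n : ℕ)
    (D : AlgebraicClosure ℚ →₀ ℤ) (r s : OnePoint ℚ) (U : Set (OnePoint ℂ_[p])) : ℂ_[p][X] :=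
  if Disjoint U (projLine (⊥ : IntermediateField ℚ_[p] ℂ_[p])) then
    sumOver ιInf ιp n D r s U
  else if Disjoint (projLine (unramifiedQuadratic p) \ U)
      (projLine (⊥ : IntermediateField ℚ_[p] ℂ_[p])) then
    -sumOver ιInf ιp n D r s (projLine (unramifiedQuadratic p) \ U)
  else 0

end RealMultiplication

/-! ### The Schneider--Teitelbaum lift -/

section Lift

variable {p : ℕ} [Fact p.Prime]

/-- The pairing on polynomials of degree at most `n` with
`⟨T ^ i, T ^ j⟩ = (-1) ^ i (n choose i)⁻¹ δ_{n, i + j}`. -/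
def polyPairing (n : ℕ) (P Q : ℂ_[p][X]) : ℂ_[p] :=
  ∑ i ∈ Finset.range (n + 1), (-1) ^ i * ((n.choose i : ℕ) : ℂ_[p])⁻¹ * P.coeff i * Q.coeff (n - i)

/-- The Taylor polynomial of degree at most `n` at `a` of the function `t ↦ 1 / (z - t)`. -/
def kernelJet (n : ℕ) (z a : ℂ_[p]) : ℂ_[p][X] :=
  ∑ j ∈ Finset.range (n + 1), C (((z - a) ^ (j + 1))⁻¹) * (X - C a) ^ j

/-- The integral over `P^1(F)` of a locally polynomial approximation of `t ↦ 1 / (z - t)`, against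
the measure `μ(U_e) = φ(e)` with values in the polynomials of degree at most `n`. On the disc of
level `l` around `a ∈ R` the approximation is the Taylor polynomial at `a`; on the disc around `∞`,
where `1 / (z - t) = -∑_{i ≥ 0} z ^ i t ^ (-i - 1)` has no terms of degree `0, …, n`, it is zero. -/
def liftSum (F : IntermediateField ℚ_[p] ℂ_[p]) (n : ℕ) (φ : Set (OnePoint ℂ_[p]) → ℂ_[p][X])
    (R : Finset ℂ_[p]) (l : ℕ) (z : ℂ_[p]) : ℂ_[p] :=
  ∑ a ∈ R, polyPairing n (φ (closedDisc F (a : OnePoint ℂ_[p]) l)) (kernelJet n z a)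

/-- The Schneider--Teitelbaum lift `z ↦ ∫ 1 / (z - t) dμ(t)` of an edge function `φ`, where
`R l` is a set of representatives of `P^1(F)` modulo `p ^ l`. -/
def schneiderTeitelbaum (F : IntermediateField ℚ_[p] ℂ_[p]) (n : ℕ)
    (φ : Set (OnePoint ℂ_[p]) → ℂ_[p][X]) (R : ℕ → Finset ℂ_[p]) (z : ℂ_[p]) : ℂ_[p] :=
  limUnder atTop fun l : ℕ => liftSum F n φ (R l) l z

end Lift

/-! ### Rigid analytic functions and the Morita pairing -/

section Morita

variable {p : ℕ} [Fact p.Prime]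

/-- `f = ∑_i bInf_i z ^ i + ∑_{a ∈ R} ∑_i b_{a, i} / (z - a) ^ (i + 1)` on the affinoid `H_F^{≤ l}`,
with coefficients such that the series converge away from the removed open discs. -/
structure MittagLeffler (F : IntermediateField ℚ_[p] ℂ_[p]) (l : ℕ) (R : Finset ℂ_[p])
    (f : ℂ_[p] → ℂ_[p]) (bInf : ℕ → ℂ_[p]) (b : ℂ_[p] → ℕ → ℂ_[p]) : Prop where
  decay_infty : Tendsto (fun i => ‖bInf i‖ * ((p : ℝ) ^ l) ^ i) atTop (𝓝 0)
  decay : ∀ a ∈ R, Tendsto (fun i => ‖b a i‖ * ((p : ℝ) ^ l / max 1 ‖a‖ ^ 2) ^ i) atTop (𝓝 0)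
  eq_sum : ∀ z ∈ affinoid F l,
    f z = ∑' i, bInf i * z ^ i + ∑ a ∈ R, ∑' i, b a i / (z - a) ^ (i + 1)

/-- Rigid analytic functions on `H_F`. -/
def IsRigidAnalytic (F : IntermediateField ℚ_[p] ℂ_[p]) (f : ℂ_[p] → ℂ_[p]) : Prop :=
  ∀ l : ℕ, ∃ (R : Finset ℂ_[p]) (bInf : ℕ → ℂ_[p]) (b : ℂ_[p] → ℕ → ℂ_[p]),
    IsReps F (l + 1) R ∧ MittagLeffler F l R f bInf b

/-- Local expansions of a locally analytic function `g` on `F` with a pole of order at most `n` at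
`∞`, on the discs around `R` and `∞` modulo `p ^ (l + 1)`. The polynomial part `G` of the
expansion at `∞` is subtracted, which does not change the class of `g` modulo polynomials of degree
at most `n`. -/
structure LocalExpansion (F : IntermediateField ℚ_[p] ℂ_[p]) (n l : ℕ) (R : Finset ℂ_[p])
    (g : ℂ_[p] → ℂ_[p]) (G : ℂ_[p][X]) (cInf : ℕ → ℂ_[p]) (c : ℂ_[p] → ℕ → ℂ_[p]) : Prop where
  natDegree_le : G.natDegree ≤ n
  hasSum : ∀ a ∈ R, ∀ t ∈ F,
    projDist (a : OnePoint ℂ_[p]) (t : OnePoint ℂ_[p]) ≤ (p : ℝ) ^ (-((l : ℤ) + 1)) →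
      HasSum (fun j => c a j * (t - a) ^ j) (g t - G.eval t)
  hasSum_infty : ∀ t ∈ F,
    projDist OnePoint.infty (t : OnePoint ℂ_[p]) ≤ (p : ℝ) ^ (-((l : ℤ) + 1)) →
      HasSum (fun j => cInf j / t ^ (j + 1)) (g t - G.eval t)

/-- `⟨f, g⟩_M = x` for the Morita pairing of a rigid analytic function `f` of weight `n + 2` on `H_F`
with a locally analytic function `g` modulo polynomials of degree at most `n`: minus the sum of the
residues of `f(z) g(z) dz` at the points of `P^1(F)`, computed from the local expansions. The sign is
such that `⟨f, 1 / (t - τ)⟩_M = f(τ)`. -/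
def IsMoritaPairing (F : IntermediateField ℚ_[p] ℂ_[p]) (n : ℕ) (f g : ℂ_[p] → ℂ_[p])
    (x : ℂ_[p]) : Prop :=
  IsRigidAnalytic F f ∧
  ∃ (l : ℕ) (R : Finset ℂ_[p]) (bInf : ℕ → ℂ_[p]) (b : ℂ_[p] → ℕ → ℂ_[p]) (G : ℂ_[p][X])
    (cInf : ℕ → ℂ_[p]) (c : ℂ_[p] → ℕ → ℂ_[p]) (yInf : ℂ_[p]) (y : ℂ_[p] → ℂ_[p]),
    IsReps F (l + 1) R ∧ MittagLeffler F l R f bInf b ∧ LocalExpansion F n l R g G cInf c ∧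
    HasSum (fun i => bInf i * cInf i) yInf ∧
    (∀ a ∈ R, HasSum (fun i => b a i * c a i) (y a)) ∧
    x = yInf - ∑ a ∈ R, y a

open Classical in
/-- The function `l_z(t)` on the boundary. -/
def boundaryKernel (n : ℕ) (L z t : ℂ_[p]) : ℂ_[p] :=
  if ‖t‖ ≤ 1 then -((n.factorial : ℂ_[p])⁻¹) * (t - z) ^ n * padicLog L (t - z)
  else -((n.factorial : ℂ_[p])⁻¹) * (t - z) ^ n * padicLog L (1 - z / t)

end Morita

/-! ### The explicit sum -/

section Explicit

variable {p : ℕ} [Fact p.Prime]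

open Classical in
/-- `t_w(z) = z - w` if `|w| ≤ 1`, and `z / w - 1` otherwise. -/
def tFun (w z : ℂ_[p]) : ℂ_[p] := if ‖w‖ ≤ 1 then z - w else z / w - 1

open Classical in
/-- The correcting polynomial `p_w(z)`, where `w'` is the conjugate of `w`. -/
def correction (n : ℕ) (w w' z : ℂ_[p]) : ℂ_[p] :=
  -(∑ q ∈ Finset.Icc 1 (n / 2),
      (∑ i ∈ Finset.range q, (-1) ^ (n - i) * (n.choose i : ℂ_[p]) / ((q : ℂ_[p]) - (i : ℂ_[p]))) *
        ((-1) ^ q * ((n - q).choose (n / 2 - q) : ℂ_[p]) * (w - w') ^ ((q : ℤ) - ((n / 2 : ℕ) : ℤ)) /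
          (n.choose (n / 2) : ℂ_[p])) * (z - w) ^ (n - q)) +
  if ‖w‖ ≤ 1 then 0
  else ∑ i ∈ Finset.Icc (n / 2 + 1) n,
    (-1) ^ i * (n.choose i : ℂ_[p]) *
      (∑ j ∈ Finset.Icc 1 (i - n / 2),
        (-1) ^ j * (-1) ^ (n - i + j) * ((i - j).choose (i - j - n / 2) : ℂ_[p]) *
          (w - w') ^ (((n / 2 : ℕ) : ℤ) - (i : ℤ) + (j : ℤ)) /
          ((n.choose (n / 2) : ℂ_[p]) * (j : ℂ_[p]) * w ^ j)) * (z - w) ^ i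

/-- The sum over the points of `Σ_{τ_i}^{≤ l}{r, s}`. -/
def explicitSum (ιInf : AlgebraicClosure ℚ →+* ℂ) (ιp : AlgebraicClosure ℚ →+* ℂ_[p]) (n : ℕ)
    (L : ℂ_[p]) (D : AlgebraicClosure ℚ →₀ ℤ) (r s : OnePoint ℚ) (l : ℕ) (z : ℂ_[p]) : ℂ_[p] :=
  (n.factorial : ℂ_[p])⁻¹ * D.sum fun τ m =>
    ∑ᶠ w ∈ sigmaSetLE ιInf ιp τ r s l,
      ((m * rmIntersection ιInf w r s : ℤ) : ℂ_[p]) *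
        ((z - ιp w) ^ (n / 2) * (z - ιp (conj w)) ^ (n / 2) / (ιp w - ιp (conj w)) ^ (n / 2) *
            padicLog L (tFun (ιp w) z)
          + correction n (ιp w) (ιp (conj w)) z)

/-- The function `J_{k, D}{r, s} = ST(Φ_{k, D}{r, s})` on `H_K`, with `n = k - 2`. -/
def weightKSymbol (ιInf : AlgebraicClosure ℚ →+* ℂ) (ιp : AlgebraicClosure ℚ →+* ℂ_[p]) (n : ℕ)
    (D : AlgebraicClosure ℚ →₀ ℤ) (R : ℕ → Finset ℂ_[p]) (r s : OnePoint ℚ) : ℂ_[p] → ℂ_[p] :=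
  schneiderTeitelbaum (unramifiedQuadratic p) n (edgeFunction ιInf ιp n D r s) R

end Explicit

end HigherGreen

end

namespace HigherGreen

/-! ### Power series on closed discs over a nonarchimedean field. -/

section Expansions

variable {𝕜 : Type*} [NontriviallyNormedField 𝕜]

/-! Put h = n/2. Expanding P_w in powers of T - w shows that the pairing of P_w with a polynomial Q
of degree at most 2h sees only the Taylor coefficients of Q at w of order at most h
(`polyPairing_rmPoly`). The resulting functional `jetFun` makes sense on every function analytic
near w. So the part of the divisor of level at most N becomes a finite functional Λ_N on functions
analytic near its points, and both sides of the theorem are values of Λ_N.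

On the one hand, the discrete integral of level N + 1 that approximates J(z) equals Λ_N(1/(z - t))
up to an error tending to 0 (`edgeFunction_closedDisc`, `norm_liftSum_sub_le`). On the other hand,
the explicit sum is exactly -Λ_N(l_z), summand by summand (`explicit_summand_eq`): the functional of
w sends (t - z)^n to P_w(z), which produces the logarithmic term (`sum_jetWeight`), and p_w collects
the contribution of the higher Taylor coefficients of the logarithm (`correction_eq`).

Convergence comes from degree zero. Points of level N with the same reduction lie in one disc of
P^1(K) of radius p^(-N), and their weighted functionals together kill polynomials of degree at most
2h, so only Taylor remainders of order 2h + 1 matter. Away from ∞, if g converges on a disc of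
radius ρ, the remainder on a subdisc of radius δ is O((δ/ρ)^(2h+1)). The functional of a point w in
that subdisc costs only O(δ^(-h)), because δ is |w - w'|. The product is O(δ^(h+1)), in particular
O(p^(-N)) (`norm_jetFun_sub_taylor_le`, `IsDegreeZeroSystem.norm_sum_powJet_le`, and
`IsDegreeZeroSystem.norm_sum_invPowJet_le` around ∞). Hence the moments of Λ_N on the discs modulo
p^(l+1) converge, and they compute lim Λ_N(g) from the local expansions of g
(`IsDegreeZeroSystem.exists_approximation`).

Applied to the Cauchy kernel, this identifies the limit moments, with a sign at ∞, as the
Mittag-Leffler coefficients of J on the affinoid of level l (`IsApproximation.mittagLeffler`).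
Applied to l_z minus its polynomial part G at ∞, it gives minus the Morita pairing; since Λ_N(G) = 0
(`IsDegreeZeroSystem.sum_polynomial_eq_zero`), that pairing is the limit of the explicit sums.
Uniformity in z holds because Taylor coefficients of l_z of index above 2h contain no value of the
logarithm (`exists_boundedExpansion_boundaryKernel`).

The arithmetic input is the functional equation of the logarithm (`padicLog_mul`), the norm on the
quadratic field (`IsQuadGen.norm_add_mul`, `unramifiedQuadratic_le_quadField`), the formula for the
level of a point (`IsConjPair.mem_affinoid_iff`), and reduction theory of indefinite binary
quadratic forms (`IsInertRM.finite_sigmaSetLE`). -/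

theorem hasSum_of_eq {f g : ℕ → 𝕜} {x y : 𝕜} (h : HasSum f x) (hf : ∀ j, g j = f j) (hx : y = x) :
    HasSum g y := by
  rw [hx, funext hf]
  exact h

/-- `g` is given by the power series with coefficients `c` on the closed disc of radius `r` around
`a`. -/
def ExpandsAt (g : 𝕜 → 𝕜) (a : 𝕜) (r : ℝ) (c : ℕ → 𝕜) : Prop :=
  ∀ t, ‖t - a‖ ≤ r → HasSum (fun j => c j * (t - a) ^ j) (g t)

theorem ExpandsAt.mono {g : 𝕜 → 𝕜} {a : 𝕜} {r r' : ℝ} {c : ℕ → 𝕜} (h : ExpandsAt g a r c)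
    (hr : r' ≤ r) : ExpandsAt g a r' c := fun t ht => h t (ht.trans hr)

theorem ExpandsAt.apply_self {g : 𝕜 → 𝕜} {a : 𝕜} {r : ℝ} {c : ℕ → 𝕜} (h : ExpandsAt g a r c)
    (hr : 0 ≤ r) : c 0 = g a := by
  have h1 := h a (by simpa using hr)
  have h2 : HasSum (fun j => c j * (a - a) ^ j) (c 0) := by
    convert hasSum_single (f := fun j => c j * (a - a) ^ j) 0 ?_ using 1
    · simp
    · intro j hj
      simp [hj]
  exact h2.unique h1

theorem ExpandsAt.unique {g : 𝕜 → 𝕜} {a : 𝕜} {r : ℝ} {c d : ℕ → 𝕜} (hr : 0 < r)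
    (hc : ExpandsAt g a r c) (hd : ExpandsAt g a r d) : c = d := by
  have key : ∀ e : ℕ → 𝕜, ExpandsAt g a r e →
      HasFPowerSeriesAt g (FormalMultilinearSeries.ofScalars 𝕜 e) a := by
    intro e he
    rw [hasFPowerSeriesAt_iff]
    filter_upwards [Metric.closedBall_mem_nhds (0 : 𝕜) hr] with z hz
    have := he (a + z) (by simpa using hz)
    simpa [FormalMultilinearSeries.coeff_ofScalars, mul_comm] using this
  have h := (key c hc).eq_formalMultilinearSeries (key d hd)
  funext j
  have := congrArg (fun q => q.coeff j) h
  simpa [FormalMultilinearSeries.coeff_ofScalars] using this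

theorem ExpandsAt.sub {g g' : 𝕜 → 𝕜} {a : 𝕜} {r : ℝ} {c c' : ℕ → 𝕜} (h : ExpandsAt g a r c)
    (h' : ExpandsAt g' a r c') : ExpandsAt (fun t => g t - g' t) a r (fun j => c j - c' j) := by
  intro t ht
  exact hasSum_of_eq ((h t ht).sub (h' t ht)) (fun j => by ring) rfl

theorem ExpandsAt.const_mul {g : 𝕜 → 𝕜} {a : 𝕜} {r : ℝ} {c : ℕ → 𝕜} (h : ExpandsAt g a r c)
    (x : 𝕜) : ExpandsAt (fun t => x * g t) a r (fun j => x * c j) := by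
  intro t ht
  exact hasSum_of_eq ((h t ht).mul_left x) (fun j => by ring) rfl

theorem ExpandsAt.congr {g g' : 𝕜 → 𝕜} {a : 𝕜} {r : ℝ} {c : ℕ → 𝕜} (h : ExpandsAt g a r c)
    (h' : ∀ t, ‖t - a‖ ≤ r → g t = g' t) : ExpandsAt g' a r c := by
  intro t ht
  rw [← h' t ht]
  exact h t ht

theorem expandsAt_polynomial (Q : 𝕜[X]) (a : 𝕜) (r : ℝ) :
    ExpandsAt (fun t => Q.eval t) a r (fun j => (taylor a Q).coeff j) := by
  intro t _
  have h : Q.eval t = ∑ j ∈ Finset.range ((taylor a Q).natDegree + 1),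
      (taylor a Q).coeff j * (t - a) ^ j := by
    rw [← eval_eq_sum_range, taylor_eval, sub_add_cancel]
  dsimp only
  rw [h]
  apply hasSum_sum_of_ne_finset_zero
  intro j hj
  rw [coeff_eq_zero_of_natDegree_lt, zero_mul]
  simpa [Nat.lt_succ_iff] using hj

theorem taylor_coeff_X_sub_C_pow (w a : 𝕜) (i j : ℕ) :
    (taylor w ((X - C a) ^ i)).coeff j = (w - a) ^ (i - j) * (i.choose j : 𝕜) := by
  rw [← coeff_X_add_C_pow]
  congr 1
  simp only [taylor_pow, map_sub, taylor_X, taylor_C]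
  ring

theorem expandsAt_pow (a w : 𝕜) (i : ℕ) (r : ℝ) :
    ExpandsAt (fun t => (t - a) ^ i) w r (fun j => (w - a) ^ (i - j) * (i.choose j : 𝕜)) := by
  have h := expandsAt_polynomial ((X - C a) ^ i) w r
  simp only [taylor_coeff_X_sub_C_pow, eval_pow, eval_sub, eval_X, eval_C] at h
  exact h

theorem expandsAt_inv_pow_sub (z a : 𝕜) (k : ℕ) {r : ℝ} (hr : r < ‖z - a‖) :
    ExpandsAt (fun t => ((z - t) ^ (k + 1))⁻¹) a r
      (fun j => ((j + k).choose k : 𝕜) * ((z - a) ^ (j + k + 1))⁻¹) := by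
  intro t ht
  have hza : z - a ≠ 0 := by
    intro h
    rw [h, norm_zero] at hr
    exact absurd ((norm_nonneg (t - a)).trans ht) (not_le.mpr hr)
  have hx : ‖(t - a) / (z - a)‖ < 1 := by
    rw [norm_div, div_lt_one (norm_pos_iff.mpr hza)]
    exact ht.trans_lt hr
  have h := (hasSum_choose_mul_geometric_of_norm_lt_one k hx).mul_left ((z - a) ^ (k + 1))⁻¹
  refine hasSum_of_eq h (fun j => ?_) ?_
  · dsimp only
    rw [div_pow, pow_add (z - a) (j + k) 1, pow_add, pow_add]
    field_simp
  · have h1 : 1 - (t - a) / (z - a) = (z - t) / (z - a) := by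
      field_simp
      ring
    dsimp only
    rw [h1, div_pow, one_div, inv_div]
    field_simp

theorem expandsAt_inv_sub (z a : 𝕜) {r : ℝ} (hr : r < ‖z - a‖) :
    ExpandsAt (fun t => (z - t)⁻¹) a r (fun j => ((z - a) ^ (j + 1))⁻¹) := by
  simpa using expandsAt_inv_pow_sub z a 0 hr

theorem expandsAt_inv_pow (w : 𝕜) (i : ℕ) {r : ℝ} (hr : r < ‖w‖) :
    ExpandsAt (fun t => (t ^ (i + 1))⁻¹) w r
      (fun j => (-1) ^ j * ((j + i).choose i : 𝕜) * (w ^ (j + i + 1))⁻¹) := by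
  have h := (expandsAt_inv_pow_sub 0 w i (r := r) (by simpa using hr)).const_mul ((-1) ^ (i + 1))
  have e : ∀ (x : 𝕜) (q : ℕ), ((0 - x) ^ q)⁻¹ = (-1) ^ q * (x ^ q)⁻¹ := by
    intro x q
    rw [zero_sub, neg_pow, mul_inv, ← inv_pow, inv_neg_one]
  intro t ht
  refine hasSum_of_eq (h t ht) (fun j => ?_) ?_
  · dsimp only
    rw [e]
    have : ((-1 : 𝕜) ^ (i + 1)) * (-1) ^ (j + i + 1) = (-1) ^ j := by
      rw [← pow_add, show i + 1 + (j + i + 1) = 2 * (i + 1) + j by ring, pow_add, pow_mul]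
      simp
    rw [← this]
    ring
  · dsimp only
    rw [e, ← mul_assoc, ← pow_add, ← two_mul, pow_mul]
    simp

/-- Coefficients of the product of `(α + β s) ^ n` with the power series with coefficients `c`. -/
def mulPowCoeff (n : ℕ) (α β : 𝕜) (c : ℕ → 𝕜) (j : ℕ) : 𝕜 :=
  ∑ k ∈ Finset.range (n + 1),
    if k ≤ j then (n.choose k : 𝕜) * α ^ (n - k) * β ^ k * c (j - k) else 0

/-- The factor is a polynomial in s, so the product is a finite sum of shifted series. The general α
and β serve both (t - z)^n at a finite centre (α = a - z, β = 1) and (1 - z s)^n with s = 1/t at ∞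
(α = 1, β = -z). -/
theorem hasSum_mulPowCoeff (n : ℕ) (α β s x : 𝕜) (c : ℕ → 𝕜)
    (h : HasSum (fun j => c j * s ^ j) x) :
    HasSum (fun j => mulPowCoeff n α β c j * s ^ j) ((α + β * s) ^ n * x) := by
  have hexp : (α + β * s) ^ n * x = ∑ k ∈ Finset.range (n + 1),
      (n.choose k : 𝕜) * α ^ (n - k) * β ^ k * (s ^ k * x) := by
    rw [add_comm, add_pow, Finset.sum_mul]
    refine Finset.sum_congr rfl fun k _ => ?_
    rw [mul_pow]
    ring
  rw [hexp]
  simp only [mulPowCoeff, Finset.sum_mul]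
  refine hasSum_sum fun k _ => ?_
  rw [← hasSum_nat_add_iff' k]
  have hz : ∑ i ∈ Finset.range k,
      (if k ≤ i then (n.choose k : 𝕜) * α ^ (n - k) * β ^ k * c (i - k) else 0) * s ^ i = 0 := by
    refine Finset.sum_eq_zero fun i hi => ?_
    rw [if_neg (by simpa using hi), zero_mul]
  rw [hz, sub_zero]
  refine hasSum_of_eq (h.mul_left ((n.choose k : 𝕜) * α ^ (n - k) * β ^ k * s ^ k))
    (fun j => ?_) ?_
  · rw [if_pos (Nat.le_add_left k j), Nat.add_sub_cancel, pow_add]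
    ring
  · ring

theorem ExpandsAt.mul_pow_sub {g : 𝕜 → 𝕜} {a : 𝕜} {r : ℝ} {c : ℕ → 𝕜} (h : ExpandsAt g a r c)
    (n : ℕ) (z : 𝕜) :
    ExpandsAt (fun t => (t - z) ^ n * g t) a r (mulPowCoeff n (a - z) 1 c) := by
  intro t ht
  refine hasSum_of_eq (hasSum_mulPowCoeff n (a - z) 1 (t - a) (g t) c (h t ht)) (fun j => rfl) ?_
  dsimp only
  ring

variable [IsUltrametricDist 𝕜]

theorem norm_natCast_le_one' (m : ℕ) : ‖(m : 𝕜)‖ ≤ 1 := IsUltrametricDist.norm_natCast_le_one 𝕜 m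

/-- Binomial coefficients have norm at most 1, and they vanish where truncated subtraction would
spoil the exponent. The split form of the bound is what `summable_double` asks for. -/
theorem norm_pow_sub_mul_choose_le {a w : 𝕜} {ρ : ℝ} (hw : ‖w - a‖ ≤ ρ) (i j : ℕ) (hρ : 0 < ρ) :
    ‖(w - a) ^ (i - j) * (i.choose j : 𝕜)‖ ≤ ρ ^ i / ρ ^ j := by
  rcases le_or_gt j i with hji | hji
  · rw [norm_mul, norm_pow, div_eq_mul_inv, ← pow_sub₀ ρ hρ.ne' hji]
    calc ‖w - a‖ ^ (i - j) * ‖((i.choose j : ℕ) : 𝕜)‖ ≤ ρ ^ (i - j) * 1 := by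
          gcongr
          exact norm_natCast_le_one' _
      _ = _ := mul_one _
  · rw [Nat.choose_eq_zero_of_lt hji]
    simp only [Nat.cast_zero, mul_zero, norm_zero]
    positivity

theorem norm_sub_le_max' (x y : 𝕜) : ‖x - y‖ ≤ max ‖x‖ ‖y‖ := by
  simpa [sub_eq_add_neg] using IsUltrametricDist.norm_add_le_max x (-y)

variable [CompleteSpace 𝕜]

/-- In a complete nonarchimedean group a family is summable as soon as it tends to 0 along the
cofinite filter; a product of two null sequences does so on pairs. -/
theorem summable_double {u v : ℕ → ℝ} (hu : Tendsto u atTop (𝓝 0)) (hv : Tendsto v atTop (𝓝 0))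
    {F : ℕ × ℕ → 𝕜} (hF : ∀ i j, ‖F (i, j)‖ ≤ u i * v j) : Summable F := by
  apply NonarchimedeanAddGroup.summable_of_tendsto_cofinite_zero
  rw [tendsto_zero_iff_norm_tendsto_zero]
  rw [← Nat.cofinite_eq_atTop] at hu hv
  exact squeeze_zero (fun _ => norm_nonneg _) (fun x => hF x.1 x.2)
    (tendsto_mul_cofinite_nhds_zero hu hv)

theorem hasSum_double_comm {F : ℕ × ℕ → 𝕜} (hF : Summable F) {f g : ℕ → 𝕜} {x : 𝕜}
    (hf : ∀ i, HasSum (fun j => F (i, j)) (f i)) (hx : HasSum f x)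
    (hg : ∀ j, HasSum (fun i => F (i, j)) (g j)) : HasSum g x := by
  have h1 : HasSum F x := by
    rw [hx.unique (hF.hasSum.prod_fiberwise hf)]
    exact hF.hasSum
  have h2 : HasSum (F ∘ Equiv.prodComm ℕ ℕ) x := (Equiv.prodComm ℕ ℕ).hasSum_iff.mpr h1
  exact h2.prod_fiberwise hg

theorem summable_of_norm_tendsto {f : ℕ → 𝕜} {u : ℕ → ℝ} (hu : Tendsto u atTop (𝓝 0))
    (h : ∀ i, ‖f i‖ ≤ u i) : Summable f := by
  apply NonarchimedeanAddGroup.summable_of_tendsto_cofinite_zero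
  rw [tendsto_zero_iff_norm_tendsto_zero, Nat.cofinite_eq_atTop]
  exact squeeze_zero (fun _ => norm_nonneg _) h hu

/-- A convergent superposition of power series is a power series. -/
theorem expandsAt_superposition {g : 𝕜 → 𝕜} {w : 𝕜} {r : ℝ} (hr : 0 < r) {c : ℕ → 𝕜}
    {e : ℕ → ℕ → 𝕜} {G : ℕ → 𝕜 → 𝕜} (hG : ∀ i, ExpandsAt (G i) w r (e i))
    (hg : ∀ t, ‖t - w‖ ≤ r → HasSum (fun i => c i * G i t) (g t))
    {u v : ℕ → ℝ} (hu : Tendsto u atTop (𝓝 0)) (hv : Tendsto v atTop (𝓝 0))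
    (huv : ∀ i j, ‖c i * e i j‖ * r ^ j ≤ u i * v j) :
    (∀ j, Summable fun i => c i * e i j) ∧ ExpandsAt g w r (fun j => ∑' i, c i * e i j) := by
  have hS : ∀ j, Summable fun i => c i * e i j := by
    intro j
    refine summable_of_norm_tendsto (u := fun i => u i * (v j / r ^ j)) ?_ fun i => ?_
    · simpa using hu.mul_const (v j / r ^ j)
    · rw [← mul_div_assoc, le_div_iff₀ (pow_pos hr j)]
      exact huv i j
  refine ⟨hS, fun t ht => ?_⟩
  have hsum : Summable fun x : ℕ × ℕ => c x.1 * e x.1 x.2 * (t - w) ^ x.2 := by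
    refine summable_double hu hv fun i j => ?_
    refine le_trans ?_ (huv i j)
    rw [norm_mul, norm_pow]
    gcongr
  exact hasSum_double_comm (F := fun x : ℕ × ℕ => c x.1 * e x.1 x.2 * (t - w) ^ x.2) hsum
    (fun i => hasSum_of_eq ((hG i t ht).mul_left (c i)) (fun j => mul_assoc _ _ _) rfl)
    (hg t ht) (fun j => (hS j).hasSum.mul_right _)

/-- The Taylor coefficients of a superposition are the superpositions of the Taylor
coefficients. -/
theorem ExpandsAt.hasSum_coeff {g : 𝕜 → 𝕜} {w : 𝕜} {r : ℝ} (hr : 0 < r) {d : ℕ → 𝕜}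
    (hd : ExpandsAt g w r d) {c : ℕ → 𝕜}
    {e : ℕ → ℕ → 𝕜} {G : ℕ → 𝕜 → 𝕜} (hG : ∀ i, ExpandsAt (G i) w r (e i))
    (hg : ∀ t, ‖t - w‖ ≤ r → HasSum (fun i => c i * G i t) (g t))
    {u v : ℕ → ℝ} (hu : Tendsto u atTop (𝓝 0)) (hv : Tendsto v atTop (𝓝 0))
    (huv : ∀ i j, ‖c i * e i j‖ * r ^ j ≤ u i * v j) (j : ℕ) :
    HasSum (fun i => c i * e i j) (d j) := by
  obtain ⟨hS, h⟩ := expandsAt_superposition hr hG hg hu hv huv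
  rw [hd.unique hr h]
  exact (hS j).hasSum

/-- Re-expansion of a power series at another centre of the disc of convergence. -/
theorem ExpandsAt.recenter_aux {a w : 𝕜} {ρ r : ℝ} (hr : 0 < r) (hrρ : r < ρ) (hw : ‖w - a‖ ≤ ρ)
    (c : ℕ → 𝕜) :
    Tendsto (fun j : ℕ => (r / ρ) ^ j) atTop (𝓝 0) ∧
    ∀ i j, ‖c i * ((w - a) ^ (i - j) * (i.choose j : 𝕜))‖ * r ^ j ≤
      (‖c i‖ * ρ ^ i) * (r / ρ) ^ j := by
  have hρ : 0 < ρ := hr.trans hrρ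
  refine ⟨tendsto_pow_atTop_nhds_zero_of_lt_one (by positivity) ((div_lt_one hρ).mpr hrρ), ?_⟩
  intro i j
  rw [norm_mul, div_pow]
  calc ‖c i‖ * ‖(w - a) ^ (i - j) * (i.choose j : 𝕜)‖ * r ^ j
      ≤ ‖c i‖ * (ρ ^ i / ρ ^ j) * r ^ j := by
        gcongr
        exact norm_pow_sub_mul_choose_le hw i j hρ
    _ = _ := by ring

/-- The expansion at w may be known on any small disc and by any means; uniqueness of coefficients
identifies it with the re-expansion. Decay of ‖c i‖ ρ^i up to the boundary lets w lie at distance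
exactly ρ from a. -/
theorem ExpandsAt.hasSum_recenter {g : 𝕜 → 𝕜} {a w : 𝕜} {ρ r : ℝ} (hr : 0 < r) (hρ : 0 < ρ)
    (hw : ‖w - a‖ ≤ ρ) {c d : ℕ → 𝕜} (hc : Tendsto (fun i => ‖c i‖ * ρ ^ i) atTop (𝓝 0))
    (hg : ExpandsAt g a ρ c) (hd : ExpandsAt g w r d) (j : ℕ) :
    HasSum (fun i => c i * ((w - a) ^ (i - j) * (i.choose j : 𝕜))) (d j) := by
  -- Shrinking the radius below ρ does not change Taylor coefficients and makes (r'/ρ)^j a null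
  -- sequence.
  set r' := min r (ρ / 2) with hr'
  have hr0 : 0 < r' := lt_min hr (by positivity)
  have hrρ : r' < ρ := (min_le_right _ _).trans_lt (by linarith)
  obtain ⟨h1, h2⟩ := ExpandsAt.recenter_aux hr0 hrρ hw c
  refine (hd.mono (min_le_left _ _)).hasSum_coeff hr0 (fun i => expandsAt_pow a w i r')
    (fun t ht => ?_) hc h1 h2 j
  refine hg t ?_
  have : t - a = (t - w) + (w - a) := by ring
  rw [this]
  exact (IsUltrametricDist.norm_add_le_max _ _).trans (max_le (ht.trans hrρ.le) hw)

theorem expandsAt_recenter {g : 𝕜 → 𝕜} {a w : 𝕜} {ρ r : ℝ} (hr : 0 < r) (hrρ : r < ρ)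
    (hw : ‖w - a‖ ≤ ρ) {c : ℕ → 𝕜} (hc : Tendsto (fun i => ‖c i‖ * ρ ^ i) atTop (𝓝 0))
    (hg : ExpandsAt g a ρ c) :
    ExpandsAt g w r (fun j => ∑' i, c i * ((w - a) ^ (i - j) * (i.choose j : 𝕜))) := by
  obtain ⟨h1, h2⟩ := ExpandsAt.recenter_aux hr hrρ hw c
  refine (expandsAt_superposition hr (fun i => expandsAt_pow a w i r) (fun t ht => ?_) hc h1 h2).2
  refine hg t ?_
  have : t - a = (t - w) + (w - a) := by ring
  rw [this]
  exact (IsUltrametricDist.norm_add_le_max _ _).trans (max_le (ht.trans hrρ.le) hw)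

/-- The coefficients of a superposition of negative powers, on a disc that avoids the origin. -/
theorem ExpandsAt.hasSum_inv_pow {g : 𝕜 → 𝕜} {w : 𝕜} {B r : ℝ} (hB : 0 < B) (hr : 0 < r)
    (hw : B ≤ ‖w‖) {c d : ℕ → 𝕜} (hc : Tendsto (fun i => ‖c i‖ * (B⁻¹) ^ i) atTop (𝓝 0))
    (hg : ∀ t, B ≤ ‖t‖ → HasSum (fun i => c i * (t ^ (i + 1))⁻¹) (g t))
    (hd : ExpandsAt g w r d) (j : ℕ) :
    HasSum (fun i => c i * ((-1) ^ j * ((j + i).choose i : 𝕜) * (w ^ (j + i + 1))⁻¹)) (d j) := by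
  -- A radius below ‖w‖ keeps the whole disc in the region B ≤ ‖t‖, since the norm is constant
  -- there.
  set r' := min r (‖w‖ / 2) with hr'
  have hw0 : 0 < ‖w‖ := hB.trans_le hw
  have hr0 : 0 < r' := lt_min hr (by positivity)
  have hrw : r' < ‖w‖ := (min_le_right _ _).trans_lt (by linarith)
  have hu : Tendsto (fun i => (‖c i‖ * (B⁻¹) ^ i) * B⁻¹) atTop (𝓝 0) := by
    simpa using hc.mul_const (B⁻¹)
  have hv : Tendsto (fun j : ℕ => (r' / ‖w‖) ^ j) atTop (𝓝 0) :=
    tendsto_pow_atTop_nhds_zero_of_lt_one (by positivity) ((div_lt_one hw0).mpr hrw)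
  refine (hd.mono (min_le_left _ _)).hasSum_coeff hr0 (fun i => expandsAt_inv_pow w i hrw)
    (fun t ht => ?_) hu hv (fun i j => ?_) j
  · refine hg t (hw.trans ?_)
    have : ‖w‖ ≤ max ‖t‖ ‖t - w‖ := by
      have := norm_sub_le_max' t (t - w)
      simpa using this
    rcases le_max_iff.mp this with h | h
    · exact h
    · exact absurd (h.trans ht) (not_le.mpr hrw)
  · have h1 : ‖(-1 : 𝕜) ^ j * ((j + i).choose i : 𝕜) * (w ^ (j + i + 1))⁻¹‖ ≤
        (B⁻¹) ^ (i + 1) * (‖w‖⁻¹) ^ j := by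
      rw [norm_mul, norm_mul, norm_pow, norm_neg, norm_one, one_pow, one_mul, norm_inv, norm_pow,
        ← inv_pow, show j + i + 1 = (i + 1) + j by ring, pow_add]
      calc ‖(((j + i).choose i : ℕ) : 𝕜)‖ * ((‖w‖⁻¹) ^ (i + 1) * (‖w‖⁻¹) ^ j)
          ≤ 1 * ((B⁻¹) ^ (i + 1) * (‖w‖⁻¹) ^ j) := by
            gcongr
            exact norm_natCast_le_one' _
        _ = _ := one_mul _
    rw [norm_mul]
    calc _ ≤ ‖c i‖ * ((B⁻¹) ^ (i + 1) * (‖w‖⁻¹) ^ j) * r' ^ j := by gcongr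
      _ = _ := by rw [div_pow, pow_succ, inv_pow ‖w‖]; ring

end Expansions


/-! ### The p-adic logarithm: independence of choices, functional equation, Taylor series. -/

section LogSeries

variable {p : ℕ} [Fact p.Prime]

theorem one_lt_prime : (1 : ℝ) < p := by exact_mod_cast (Fact.out : p.Prime).one_lt

theorem prime_pos : (0 : ℝ) < p := zero_lt_one.trans one_lt_prime

theorem norm_p_complex : ‖(p : ℂ_[p])‖ = (p : ℝ)⁻¹ := by
  rw [← map_natCast (algebraMap ℚ_[p] ℂ_[p]), norm_algebraMap', Padic.norm_p]

theorem prime_cast_ne_zero : (p : ℂ_[p]) ≠ 0 := by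
  exact_mod_cast (Fact.out : p.Prime).ne_zero

/-- The norm of 1/j is the exact power of p dividing j. -/
theorem norm_inv_natCast_le (j : ℕ) : ‖((j : ℂ_[p]))⁻¹‖ ≤ j := by
  rcases Nat.eq_zero_or_pos j with rfl | hj
  · simp
  have hj' : (j : ℚ_[p]) ≠ 0 := by exact_mod_cast hj.ne'
  rw [norm_inv, ← map_natCast (algebraMap ℚ_[p] ℂ_[p]), norm_algebraMap',
    Padic.norm_eq_zpow_neg_valuation hj', Padic.valuation_natCast, zpow_neg, inv_inv, zpow_natCast]
  exact_mod_cast Nat.le_of_dvd hj pow_padicValNat_dvd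

/-- Taylor coefficients at `w` of a branch of the logarithm with value `x` at `w`. -/
noncomputable def logCoeff (x w : ℂ_[p]) (j : ℕ) : ℂ_[p] :=
  if j = 0 then x else (-1) ^ (j + 1) / ((j : ℂ_[p]) * w ^ j)

theorem norm_logCoeff_le (x w : ℂ_[p]) {j : ℕ} (hj : j ≠ 0) :
    ‖logCoeff x w j‖ ≤ j * (‖w‖⁻¹) ^ j := by
  rw [logCoeff, if_neg hj, div_eq_mul_inv, mul_inv, norm_mul, norm_mul, norm_pow, norm_neg,
    norm_one, one_pow, one_mul, norm_inv (w ^ j), norm_pow, inv_pow]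
  gcongr
  exact norm_inv_natCast_le j

theorem tendsto_logCoeff_one {ρ : ℝ} (h0 : 0 ≤ ρ) (h1 : ρ < 1) :
    Tendsto (fun j => ‖logCoeff (p := p) 0 1 j‖ * ρ ^ j) atTop (𝓝 0) := by
  refine squeeze_zero (fun _ => by positivity) (fun j => ?_)
    (tendsto_self_mul_const_pow_of_lt_one h0 h1)
  rcases eq_or_ne j 0 with rfl | hj
  · simp [logCoeff]
  · have := norm_logCoeff_le (p := p) 0 1 hj
    rw [norm_one, inv_one, one_pow, mul_one] at this
    gcongr

theorem expandsAt_logOneAdd {ρ : ℝ} (h1 : ρ < 1) :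
    ExpandsAt (logOneAdd (p := p)) 0 ρ (logCoeff 0 1) := by
  intro t ht
  have h0 : 0 ≤ ρ := (norm_nonneg _).trans ht
  rw [sub_zero] at ht ⊢
  have hs : Summable fun j => logCoeff (p := p) 0 1 j * t ^ j := by
    refine summable_of_norm_tendsto (tendsto_logCoeff_one (p := p) h0 h1) fun j => ?_
    rw [norm_mul, norm_pow]
    gcongr
  have h2 := (hasSum_nat_add_iff' 1).mpr hs.hasSum
  have h3 : logOneAdd t = ∑' j, logCoeff (p := p) 0 1 j * t ^ j := by
    rw [logOneAdd]
    refine HasSum.tsum_eq (hasSum_of_eq h2 (fun j => ?_) ?_)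
    · rw [logCoeff, if_neg (Nat.succ_ne_zero j), one_pow, mul_one, pow_succ _ (j + 1), pow_succ _ j]
      push_cast
      ring
    · simp [logCoeff]
  rw [h3]
  exact hs.hasSum

theorem logOneAdd_zero : logOneAdd (0 : ℂ_[p]) = 0 := by
  have := (expandsAt_logOneAdd (p := p) (ρ := 0) zero_lt_one).apply_self le_rfl
  simpa [logCoeff] using this.symm

theorem one_add_ne_zero {x : ℂ_[p]} (hx : ‖x‖ < 1) : 1 + x ≠ 0 := by
  intro h
  have : x = -1 := by linear_combination h
  rw [this, norm_neg, norm_one] at hx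
  exact lt_irrefl _ hx

theorem norm_one_add {x : ℂ_[p]} (hx : ‖x‖ < 1) : ‖1 + x‖ = 1 := by
  have h := IsUltrametricDist.norm_add_eq_max_of_norm_ne_norm (x := (1 : ℂ_[p])) (y := x)
    (by rw [norm_one]; exact hx.ne')
  rw [h, norm_one, max_eq_left hx.le]

/-- Re-expand the logarithm series at x: its coefficient at s^j, for j ≥ 1, is that of log(1 + s/(1
+ x)). This is the functional equation before it is written multiplicatively. -/
theorem logOneAdd_add {x s : ℂ_[p]} (hx : ‖x‖ < 1) (hs : ‖s‖ < 1) :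
    logOneAdd (x + s) = logOneAdd x + logOneAdd (s / (1 + x)) := by
  obtain ⟨r, hr, hr1⟩ := exists_between (max_lt (max_lt hx hs) zero_lt_one)
  obtain ⟨ρ, hrρ, hρ1⟩ := exists_between hr1
  have hr0 : 0 < r := (le_max_right _ _).trans_lt hr
  have hxr : ‖x‖ < r := ((le_max_left _ _).trans (le_max_left _ _)).trans_lt hr
  have hsr : ‖s‖ < r := ((le_max_right _ _).trans (le_max_left _ _)).trans_lt hr
  have hexp := expandsAt_recenter hr0 hrρ (w := x) (a := 0) (by simpa using (hxr.trans hrρ).le)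
    (tendsto_logCoeff_one (p := p) (hr0.trans hrρ).le hρ1) (expandsAt_logOneAdd hρ1)
  set d : ℕ → ℂ_[p] := fun j => ∑' i, logCoeff (p := p) 0 1 i *
    ((x - 0) ^ (i - j) * (i.choose j : ℂ_[p])) with hd
  have h1x := one_add_ne_zero hx
  have hdj : ∀ j, d j = logCoeff (logOneAdd x) (1 + x) j := by
    intro j
    rcases eq_or_ne j 0 with rfl | hj
    · rw [hexp.apply_self hr0.le]
      simp [logCoeff]
    · obtain ⟨m, rfl⟩ := Nat.exists_eq_succ_of_ne_zero hj
      rw [hd]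
      refine HasSum.tsum_eq ?_
      rw [← hasSum_nat_add_iff' (m + 1)]
      have hz : ∑ i ∈ Finset.range (m + 1), logCoeff (p := p) 0 1 i *
          ((x - 0) ^ (i - m.succ) * (i.choose m.succ : ℂ_[p])) = 0 := by
        refine Finset.sum_eq_zero fun i hi => ?_
        rw [Nat.choose_eq_zero_of_lt (by simpa using hi)]
        simp
      rw [hz, sub_zero]
      -- The coefficient of index m + 1 is a negative binomial series for (1 + x)^(-m-1), once
      -- choose(k + m + 1, m + 1)/(k + m + 1) is rewritten as choose(k + m, m)/(m + 1).
      have hg := (hasSum_choose_mul_geometric_of_norm_lt_one m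
        (r := -x) (by rwa [norm_neg])).mul_left ((-1) ^ m / ((m : ℂ_[p]) + 1))
      have hm : ((m : ℂ_[p]) + 1) ≠ 0 := by exact_mod_cast Nat.succ_ne_zero m
      refine hasSum_of_eq hg (fun k => ?_) ?_
      · have hk : ((k : ℂ_[p]) + m + 1) ≠ 0 := by exact_mod_cast Nat.succ_ne_zero (k + m)
        have hc : ((k + (m + 1)).choose (m + 1) : ℂ_[p]) * ((m : ℂ_[p]) + 1) =
            ((k : ℂ_[p]) + m + 1) * ((k + m).choose m : ℂ_[p]) := by
          have := Nat.add_one_mul_choose_eq (k + m) m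
          have h' := congrArg (Nat.cast (R := ℂ_[p])) this
          push_cast at h'
          rw [← add_assoc]
          linear_combination -h'
        rw [logCoeff, if_neg (by omega), one_pow, mul_one, Nat.succ_eq_add_one, Nat.add_sub_cancel,
          neg_pow x]
        have hc' : ((k + (m + 1)).choose (m + 1) : ℂ_[p]) =
            ((k : ℂ_[p]) + m + 1) * ((k + m).choose m : ℂ_[p]) / ((m : ℂ_[p]) + 1) := by
          rw [eq_div_iff hm, hc]
        rw [hc', show k + (m + 1) + 1 = k + m + 2 by ring, pow_add, pow_add]
        push_cast
        have hk' : ((k : ℂ_[p]) + (m + 1)) ≠ 0 := by rwa [← add_assoc]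
        field_simp
        ring
      · rw [logCoeff, if_neg (Nat.succ_ne_zero m), Nat.succ_eq_add_one, sub_neg_eq_add, pow_add _ m,
          pow_succ _ (m+1), pow_succ _ m]
        push_cast
        field_simp
        ring
  have hA := hexp (x + s) (by simpa using hsr.le)
  have hxs : ‖s / (1 + x)‖ < 1 := by rwa [norm_div, norm_one_add hx, div_one]
  have hB := expandsAt_logOneAdd hxs (s / (1 + x)) (by simp)
  have hC : HasSum (fun j => logCoeff (p := p) (logOneAdd x) (1 + x) j * s ^ j)
      (logOneAdd x + logOneAdd (s / (1 + x))) := by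
    rw [← hasSum_nat_add_iff' 1]
    rw [← hasSum_nat_add_iff' 1] at hB
    refine hasSum_of_eq hB (fun j => ?_) ?_
    · simp only [logCoeff, if_neg (Nat.succ_ne_zero j), one_pow, mul_one, sub_zero, div_pow]
      field_simp
    · simp [logCoeff]
  refine hA.unique (hasSum_of_eq hC (fun j => ?_) rfl)
  rw [hdj j]
  simp

theorem logOneAdd_mul {u v : ℂ_[p]} (hu : ‖u - 1‖ < 1) (hv : ‖v - 1‖ < 1) :
    logOneAdd (u * v - 1) = logOneAdd (u - 1) + logOneAdd (v - 1) := by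
  have hu0 : u ≠ 0 := by simpa using one_add_ne_zero hu
  have hu1 : ‖u‖ = 1 := by simpa using norm_one_add hu
  have h := logOneAdd_add hu (s := u * (v - 1)) (by rwa [norm_mul, hu1, one_mul])
  rw [show u * v - 1 = (u - 1) + u * (v - 1) by ring, h, add_sub_cancel, mul_div_cancel_left₀ _ hu0]

theorem norm_mul_sub_one_lt {u v : ℂ_[p]} (hu : ‖u - 1‖ < 1) (hv : ‖v - 1‖ < 1) :
    ‖u * v - 1‖ < 1 := by
  have hu1 : ‖u‖ = 1 := by simpa using norm_one_add hu
  rw [show u * v - 1 = (u - 1) + u * (v - 1) by ring]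
  refine (IsUltrametricDist.norm_add_le_max _ _).trans_lt (max_lt hu ?_)
  rwa [norm_mul, hu1, one_mul]

theorem norm_pow_sub_one_lt {u : ℂ_[p]} (hu : ‖u - 1‖ < 1) (k : ℕ) : ‖u ^ k - 1‖ < 1 := by
  induction k with
  | zero => simp
  | succ k ih => rw [pow_succ]; exact norm_mul_sub_one_lt ih hu

theorem logOneAdd_pow {u : ℂ_[p]} (hu : ‖u - 1‖ < 1) (k : ℕ) :
    logOneAdd (u ^ k - 1) = (k : ℂ_[p]) * logOneAdd (u - 1) := by
  induction k with
  | zero => simp [logOneAdd_zero]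
  | succ k ih =>
    rw [pow_succ, logOneAdd_mul (norm_pow_sub_one_lt hu k) hu, ih]
    push_cast
    ring

/-- The minimal polynomial of v has integral coefficients because the spectral norm is at most 1.
Its reduction f̄ is monic, so 𝔽_p[X]/(f̄) is finite and two powers of X coincide in it. Lifting this
congruence and evaluating at v gives |v^i - v^j| < 1. -/
theorem exists_pow_norm_sub_one_lt_algebraic (v : PadicAlgCl p) (hv : ‖v‖ = 1) :
    ∃ N : ℕ, 0 < N ∧ ‖v ^ N - 1‖ < 1 := by
  have hint : IsIntegral ℚ_[p] v := Algebra.IsIntegral.isIntegral v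
  have hcoef : ∀ n, ‖(minpoly ℚ_[p] v).coeff n‖ ≤ 1 := by
    rw [← spectralValue_le_one_iff (minpoly.monic hint)]
    exact hv.le
  have hl : minpoly ℚ_[p] v ∈ lifts (algebraMap ℤ_[p] ℚ_[p]) := by
    rw [lifts_iff_coeff_lifts]
    exact fun n => ⟨⟨_, hcoef n⟩, rfl⟩
  obtain ⟨f, hf, -, hfm⟩ := lifts_and_natDegree_eq_and_monic hl (minpoly.monic hint)
  set φ : ℤ_[p] →+* PadicAlgCl p :=
    (algebraMap ℚ_[p] (PadicAlgCl p)).comp (algebraMap ℤ_[p] ℚ_[p]) with hφ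
  have hfv : f.eval₂ φ v = 0 := by
    rw [hφ, ← eval₂_map, hf]
    exact minpoly.aeval _ v
  set fb := f.map (PadicInt.toZMod (p := p)) with hfb
  have hfbm : fb.Monic := hfm.map _
  have : Module.Finite (ZMod p) (AdjoinRoot fb) := hfbm.finite_adjoinRoot
  have : Finite (AdjoinRoot fb) := Module.finite_of_finite (ZMod p)
  obtain ⟨i, j, hij, he⟩ :=
    Finite.exists_ne_map_eq_of_infinite (fun i : ℕ => AdjoinRoot.mk fb (X ^ i))
  have key : ∀ i j : ℕ, i < j → AdjoinRoot.mk fb (X ^ i) = AdjoinRoot.mk fb (X ^ j) →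
      ∃ N : ℕ, 0 < N ∧ ‖v ^ N - 1‖ < 1 := by
    intro i j hij he
    rw [AdjoinRoot.mk_eq_mk] at he
    obtain ⟨gb, hgb⟩ := he
    obtain ⟨g, rfl⟩ := map_surjective (PadicInt.toZMod (p := p)) (ZMod.ringHom_surjective _) gb
    set q : ℤ_[p][X] := X ^ i - X ^ j - f * g with hq
    have hq0 : q.map (PadicInt.toZMod (p := p)) = 0 := by
      rw [hq, Polynomial.map_sub, Polynomial.map_mul, ← hfb, ← hgb]
      simp
    have hqn : ∀ n, ‖q.coeff n‖ < 1 := by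
      intro n
      have h1 : PadicInt.toZMod (q.coeff n) = 0 := by
        rw [← coeff_map, hq0, coeff_zero]
      have h2 : q.coeff n ∈ RingHom.ker (PadicInt.toZMod (p := p)) := h1
      rw [PadicInt.ker_toZMod, PadicInt.maximalIdeal_eq_span_p, Ideal.mem_span_singleton,
        ← PadicInt.norm_lt_one_iff_dvd] at h2
      exact h2
    have hφn : ∀ x : ℤ_[p], ‖φ x‖ = ‖x‖ := by
      intro x
      rw [hφ, RingHom.comp_apply, norm_algebraMap']
      rfl
    have hev : v ^ i - v ^ j = q.eval₂ φ v := by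
      simp [hq, eval₂_sub, eval₂_mul, hfv]
    have hlt : ‖v ^ i - v ^ j‖ < 1 := by
      rw [hev, eval₂_eq_sum_range]
      obtain ⟨m, _, hm⟩ := IsUltrametricDist.exists_norm_finsetSum_le
        (Finset.range (q.natDegree + 1)) (fun m => φ (q.coeff m) * v ^ m)
      refine hm.trans_lt ?_
      rw [norm_mul, norm_pow, hv, one_pow, mul_one, hφn]
      exact hqn m
    refine ⟨j - i, Nat.sub_pos_of_lt hij, ?_⟩
    have h3 : v ^ i - v ^ j = -(v ^ i * (v ^ (j - i) - 1)) := by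
      rw [mul_sub, ← pow_add, Nat.add_sub_cancel' hij.le]
      ring
    rwa [h3, norm_neg, norm_mul, norm_pow, hv, one_pow, one_mul] at hlt
  rcases lt_or_gt_of_ne hij with h | h
  · exact key i j h he
  · exact key j i h he.symm

/-- If d is the degree of y, then |y|^d is the norm of the constant coefficient of the minimal
polynomial, an integral power of p. So y^d divided by a power of p is a unit, and the previous lemma
applies. -/
theorem exists_pow_mul_zpow_algebraic (y : PadicAlgCl p) (hy : y ≠ 0) :
    ∃ N : ℕ, ∃ m : ℤ, 0 < N ∧ ‖y ^ N * (p : PadicAlgCl p) ^ (-m) - 1‖ < 1 := by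
  have hint : IsIntegral ℚ_[p] y := Algebra.IsIntegral.isIntegral y
  have hd := minpoly.natDegree_pos hint
  have hc : (minpoly ℚ_[p] y).coeff 0 ≠ 0 := minpoly.coeff_zero_ne_zero hint hy
  have hn : ‖y‖ ^ (minpoly ℚ_[p] y).natDegree = ‖(minpoly ℚ_[p] y).coeff 0‖ := by
    have h := spectralNorm.spectralNorm_eq_norm_coeff_zero_rpow (K := ℚ_[p]) (PadicAlgCl p) y
    rw [PadicAlgCl.spectralNorm_eq] at h
    rw [h, one_div, Real.rpow_inv_natCast_pow (norm_nonneg _) hd.ne']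
  have hpn : ‖(p : PadicAlgCl p)‖ = (p : ℝ)⁻¹ := by
    rw [← map_natCast (algebraMap ℚ_[p] (PadicAlgCl p)), norm_algebraMap', Padic.norm_p]
  obtain ⟨N, hN, h⟩ := exists_pow_norm_sub_one_lt_algebraic
    (y ^ (minpoly ℚ_[p] y).natDegree *
      (p : PadicAlgCl p) ^ (-((minpoly ℚ_[p] y).coeff 0).valuation)) (by
      rw [norm_mul, norm_pow, hn, norm_zpow, hpn, Padic.norm_eq_zpow_neg_valuation hc, inv_zpow',
        neg_neg, ← zpow_add₀ prime_pos.ne', neg_add_cancel, zpow_zero])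
  refine ⟨(minpoly ℚ_[p] y).natDegree * N, ((minpoly ℚ_[p] y).coeff 0).valuation * N,
    Nat.mul_pos hd hN, ?_⟩
  rw [mul_pow, ← pow_mul, ← zpow_natCast ((p : PadicAlgCl p) ^ _) N, ← zpow_mul] at h
  rwa [← neg_mul]

/-- By density there is an algebraic y with |x - y| < |x|; then x/y and all its powers stay within
distance less than 1 of 1. -/
theorem exists_pow_mul_zpow {x : ℂ_[p]} (hx : x ≠ 0) :
    ∃ q : ℕ × ℤ, 0 < q.1 ∧ ‖x ^ q.1 * (p : ℂ_[p]) ^ (-q.2) - 1‖ < 1 := by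
  obtain ⟨y, hy⟩ : ∃ y : PadicAlgCl p, ‖x - (y : ℂ_[p])‖ < ‖x‖ := by
    have := (UniformSpace.Completion.denseRange_coe (α := PadicAlgCl p)).exists_dist_lt x
      (norm_pos_iff.mpr hx)
    simpa [dist_eq_norm] using this
  have hyx : ‖(y : ℂ_[p])‖ = ‖x‖ := by
    rw [← norm_neg, neg_sub] at hy
    have h := IsUltrametricDist.norm_add_eq_max_of_norm_ne_norm (x := x) (y := (y : ℂ_[p]) - x)
      hy.ne'
    rwa [add_sub_cancel, max_eq_left hy.le] at h
  have hy0 : (y : ℂ_[p]) ≠ 0 := by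
    rw [← norm_pos_iff, hyx]
    exact norm_pos_iff.mpr hx
  have hy0' : y ≠ 0 := by
    rintro rfl
    simp at hy0
  obtain ⟨N, m, hN, h⟩ := exists_pow_mul_zpow_algebraic y hy0'
  refine ⟨(N, m), hN, ?_⟩
  have h1 : ‖(y : ℂ_[p]) ^ N * (p : ℂ_[p]) ^ (-m) - 1‖ < 1 := by
    rw [← PadicComplex.norm_extends] at h
    simp only [PadicComplex.coe_eq, map_sub, map_mul, map_pow, map_zpow₀, map_natCast, map_one] at h
    exact h
  have h2 : ‖x / y - 1‖ < 1 := by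
    rw [div_sub_one hy0, norm_div, hyx, div_lt_one (norm_pos_iff.mpr hx)]
    exact hy
  have h3 := norm_mul_sub_one_lt (norm_pow_sub_one_lt h2 N) h1
  rwa [div_pow, ← mul_assoc, div_mul_cancel₀ _ (pow_ne_zero N hy0)] at h3

/-- The value does not depend on the chosen exponents: taking norms determines m/N, so for two
admissible pairs the crosswise powers are the same element near 1, and `logOneAdd_pow` compares the
two values. -/
theorem padicLog_eq (L : ℂ_[p]) {x : ℂ_[p]} (hx : x ≠ 0) {N : ℕ} {m : ℤ} (hN : 0 < N)
    (h : ‖x ^ N * (p : ℂ_[p]) ^ (-m) - 1‖ < 1) :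
    padicLog L x =
      ((m : ℂ_[p]) * L + logOneAdd (x ^ N * (p : ℂ_[p]) ^ (-m) - 1)) / (N : ℂ_[p]) := by
  have hex := exists_pow_mul_zpow hx
  unfold padicLog
  rw [dif_pos hex]
  obtain ⟨hN', h'⟩ := hex.choose_spec
  set N' := hex.choose.1
  set m' := hex.choose.2
  have hnorm : ∀ (N : ℕ) (m : ℤ), ‖x ^ N * (p : ℂ_[p]) ^ (-m) - 1‖ < 1 →
      ‖x‖ ^ N = (p : ℝ) ^ (-m) := by
    intro N m h
    have h1 : ‖x ^ N * (p : ℂ_[p]) ^ (-m)‖ = 1 := by simpa using norm_one_add h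
    rw [norm_mul, norm_pow, norm_zpow, norm_p_complex, inv_zpow', neg_neg] at h1
    rw [zpow_neg]
    exact eq_inv_of_mul_eq_one_left h1
  have e1 : m * N' = m' * N := by
    have a1 : (‖x‖ ^ N) ^ N' = (‖x‖ ^ N') ^ N := by rw [← pow_mul, ← pow_mul, mul_comm]
    rw [hnorm N m h, hnorm N' m' h', ← zpow_natCast, ← zpow_natCast, ← zpow_mul, ← zpow_mul] at a1
    have := zpow_right_injective₀ prime_pos one_lt_prime.ne' a1
    linarith
  have e2 : (x ^ N * (p : ℂ_[p]) ^ (-m)) ^ N' = (x ^ N' * (p : ℂ_[p]) ^ (-m')) ^ N := by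
    rw [mul_pow, mul_pow, ← pow_mul, ← pow_mul, mul_comm N N',
      ← zpow_natCast ((p : ℂ_[p]) ^ _) N', ← zpow_natCast ((p : ℂ_[p]) ^ _) N,
      ← zpow_mul, ← zpow_mul, neg_mul, neg_mul, e1]
  have e3 := logOneAdd_pow h N'
  rw [e2, logOneAdd_pow h' N] at e3
  have e1' : (m : ℂ_[p]) * N' = m' * N := by exact_mod_cast congrArg (Int.cast (R := ℂ_[p])) e1
  have hNc : (N : ℂ_[p]) ≠ 0 := by exact_mod_cast hN.ne'
  have hNc' : (N' : ℂ_[p]) ≠ 0 := by exact_mod_cast hN'.ne'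
  rw [div_eq_div_iff hNc' hNc]
  linear_combination e3 - L * e1'

theorem padicLog_mul (L : ℂ_[p]) {x y : ℂ_[p]} (hx : x ≠ 0) (hy : y ≠ 0) :
    padicLog L (x * y) = padicLog L x + padicLog L y := by
  obtain ⟨⟨N, m⟩, hN, h⟩ := exists_pow_mul_zpow hx
  obtain ⟨⟨N', m'⟩, hN', h'⟩ := exists_pow_mul_zpow hy
  dsimp only at hN h hN' h'
  have e : (x * y) ^ (N * N') * (p : ℂ_[p]) ^ (-(m * N' + m' * N)) =
      (x ^ N * (p : ℂ_[p]) ^ (-m)) ^ N' * (y ^ N' * (p : ℂ_[p]) ^ (-m')) ^ N := by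
    rw [mul_pow, mul_pow, mul_pow, ← zpow_natCast ((p : ℂ_[p]) ^ _) N',
      ← zpow_natCast ((p : ℂ_[p]) ^ _) N, ← zpow_mul, ← zpow_mul, neg_add,
      zpow_add₀ prime_cast_ne_zero, ← pow_mul, ← pow_mul, neg_mul, neg_mul, mul_comm N' N]
    ring
  have hu := norm_pow_sub_one_lt h N'
  have hv := norm_pow_sub_one_lt h' N
  have hlt : ‖(x * y) ^ (N * N') * (p : ℂ_[p]) ^ (-(m * N' + m' * N)) - 1‖ < 1 := by
    rw [e]
    exact norm_mul_sub_one_lt hu hv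
  rw [padicLog_eq L (mul_ne_zero hx hy) (Nat.mul_pos hN hN') hlt, padicLog_eq L hx hN h,
    padicLog_eq L hy hN' h', e, logOneAdd_mul hu hv, logOneAdd_pow h, logOneAdd_pow h']
  have hNc : (N : ℂ_[p]) ≠ 0 := by exact_mod_cast hN.ne'
  have hNc' : (N' : ℂ_[p]) ≠ 0 := by exact_mod_cast hN'.ne'
  push_cast
  field_simp
  ring

theorem padicLog_of_norm_sub_one_lt (L : ℂ_[p]) {u : ℂ_[p]} (hu : ‖u - 1‖ < 1) :
    padicLog L u = logOneAdd (u - 1) := by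
  have hu0 : u ≠ 0 := by simpa using one_add_ne_zero hu
  rw [padicLog_eq L hu0 one_pos (m := 0) (by simpa using hu)]
  simp

theorem padicLog_neg (L : ℂ_[p]) (x : ℂ_[p]) : padicLog L (-x) = padicLog L x := by
  rcases eq_or_ne x 0 with rfl | hx
  · simp
  have h : padicLog L (-1 : ℂ_[p]) = 0 := by
    rw [padicLog_eq L (neg_ne_zero.mpr one_ne_zero) two_pos (m := 0) (by simp)]
    simp [logOneAdd_zero]
  rw [neg_eq_neg_one_mul, padicLog_mul L (neg_ne_zero.mpr one_ne_zero) hx, h, zero_add]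

theorem padicLog_div (L : ℂ_[p]) {x y : ℂ_[p]} (hx : x ≠ 0) (hy : y ≠ 0) :
    padicLog L (x / y) = padicLog L x - padicLog L y := by
  have h := padicLog_mul L (div_ne_zero hx hy) hy
  rw [div_mul_cancel₀ _ hy] at h
  rw [h]
  ring

theorem expandsAt_padicLog (L : ℂ_[p]) (w : ℂ_[p]) {r : ℝ} (hr : r < ‖w‖) :
    ExpandsAt (padicLog L) w r (logCoeff (padicLog L w) w) := by
  intro t ht
  have hw : w ≠ 0 := by
    rintro rfl
    rw [norm_zero] at hr
    exact absurd ((norm_nonneg _).trans ht) (not_le.mpr hr)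
  have hlt : ‖(t - w) / w‖ < 1 := by
    rw [norm_div, div_lt_one (norm_pos_iff.mpr hw)]
    exact ht.trans_lt hr
  have h1 : t / w - 1 = (t - w) / w := by field_simp
  have ht0 : t ≠ 0 := by
    intro h
    rw [h, zero_sub, norm_neg] at ht
    exact absurd ht (not_le.mpr hr)
  have hL : padicLog L t = padicLog L w + logOneAdd ((t - w) / w) := by
    rw [← h1, ← padicLog_of_norm_sub_one_lt L (u := t / w) (by rwa [h1]), padicLog_div L ht0 hw]
    ring
  have hB := expandsAt_logOneAdd hlt ((t - w) / w) (by simp)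
  rw [hL, ← hasSum_nat_add_iff' 1]
  rw [← hasSum_nat_add_iff' 1] at hB
  refine hasSum_of_eq hB (fun j => ?_) ?_
  · simp only [logCoeff, if_neg (Nat.succ_ne_zero j), one_pow, mul_one, sub_zero, div_pow]
    field_simp
  · simp [logCoeff]

end LogSeries


/-! ### The ultrametric distance on the projective line. -/

section ProjectiveDistance

variable {p : ℕ} [Fact p.Prime]

theorem projDist_coe_coe (x y : ℂ_[p]) : projDist (x : OnePoint ℂ_[p]) (y : OnePoint ℂ_[p]) =
    ‖x - y‖ / (max 1 ‖x‖ * max 1 ‖y‖) := rfl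

theorem projDist_infty_coe (x : ℂ_[p]) :
    projDist OnePoint.infty (x : OnePoint ℂ_[p]) = 1 / max 1 ‖x‖ := rfl

theorem projDist_coe_infty (x : ℂ_[p]) :
    projDist (x : OnePoint ℂ_[p]) OnePoint.infty = 1 / max 1 ‖x‖ := rfl

theorem projDist_infty_infty : projDist (p := p) OnePoint.infty OnePoint.infty = 0 := rfl

/-- First homogeneous coordinate. -/
noncomputable def coordX : OnePoint ℂ_[p] → ℂ_[p]
  | none => 1
  | some x => x

/-- Second homogeneous coordinate. -/
noncomputable def coordY : OnePoint ℂ_[p] → ℂ_[p]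
  | none => 0
  | some _ => 1

theorem one_le_max_one (x : ℂ_[p]) : 1 ≤ max 1 ‖x‖ := le_max_left _ _

theorem max_one_pos (x : ℂ_[p]) : 0 < max 1 ‖x‖ := zero_lt_one.trans_le (one_le_max_one x)

/-- Norm of the vector of homogeneous coordinates. -/
noncomputable def coordNorm (x : OnePoint ℂ_[p]) : ℝ := max ‖coordX x‖ ‖coordY x‖

theorem coordNorm_infty : coordNorm (p := p) OnePoint.infty = 1 := by
  change max ‖(1 : ℂ_[p])‖ ‖(0 : ℂ_[p])‖ = 1
  simp

theorem coordNorm_coe (x : ℂ_[p]) : coordNorm (x : OnePoint ℂ_[p]) = max 1 ‖x‖ := by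
  change max ‖x‖ ‖(1 : ℂ_[p])‖ = _
  rw [norm_one, max_comm]

theorem coordNorm_pos (x : OnePoint ℂ_[p]) : 0 < coordNorm x := by
  induction x using OnePoint.rec with
  | infty => rw [coordNorm_infty]; exact one_pos
  | coe x => rw [coordNorm_coe]; exact max_one_pos x

theorem projDist_eq (x y : OnePoint ℂ_[p]) : projDist x y =
    ‖coordX x * coordY y - coordY x * coordX y‖ / (coordNorm x * coordNorm y) := by
  induction x using OnePoint.rec with
  | infty =>
    induction y using OnePoint.rec with
    | infty =>
      rw [projDist_infty_infty]
      change 0 = ‖(1 : ℂ_[p]) * 0 - 0 * 1‖ / _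
      simp
    | coe y =>
      rw [projDist_infty_coe, coordNorm_infty, coordNorm_coe]
      change _ = ‖(1 : ℂ_[p]) * 1 - 0 * y‖ / _
      simp
  | coe x =>
    induction y using OnePoint.rec with
    | infty =>
      rw [projDist_coe_infty, coordNorm_infty, coordNorm_coe]
      change _ = ‖x * 0 - 1 * (1 : ℂ_[p])‖ / _
      simp
    | coe y =>
      rw [projDist_coe_coe, coordNorm_coe, coordNorm_coe]
      change _ = ‖x * 1 - 1 * y‖ / _
      simp

theorem projDist_comm (x y : OnePoint ℂ_[p]) : projDist x y = projDist y x := by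
  rw [projDist_eq, projDist_eq, ← norm_neg, mul_comm (coordNorm x)]
  congr 2
  ring

theorem projDist_self (x : OnePoint ℂ_[p]) : projDist x x = 0 := by
  rw [projDist_eq, mul_comm, sub_self, norm_zero, zero_div]

/-- With [x, y] the determinant of coordinates, each coordinate satisfies the Plücker relation [x,
y] z = [x, z] y + [z, y] x. Bounding both sides by the coordinate norms gives the ultrametric
inequality. -/
theorem projDist_le_max (x y z : OnePoint ℂ_[p]) :
    projDist x y ≤ max (projDist x z) (projDist z y) := by
  rw [projDist_eq, projDist_eq x z, projDist_eq z y]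
  have hx := coordNorm_pos x
  have hy := coordNorm_pos y
  have hz := coordNorm_pos z
  set A := ‖coordX x * coordY y - coordY x * coordX y‖
  set B := ‖coordX x * coordY z - coordY x * coordX z‖
  set D := ‖coordX z * coordY y - coordY z * coordX y‖
  have hX : ∀ u : OnePoint ℂ_[p], ‖coordX u‖ ≤ coordNorm u := fun u => le_max_left _ _
  have hY : ∀ u : OnePoint ℂ_[p], ‖coordY u‖ ≤ coordNorm u := fun u => le_max_right _ _
  have key : A * coordNorm z ≤ max (B * coordNorm y) (D * coordNorm x) := by
    rw [coordNorm, mul_max_of_nonneg _ _ (norm_nonneg _)]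
    apply max_le
    · rw [← norm_mul, show (coordX x * coordY y - coordY x * coordX y) * coordX z =
        (coordX x * coordY z - coordY x * coordX z) * coordX y +
        (coordX z * coordY y - coordY z * coordX y) * coordX x by ring]
      refine (IsUltrametricDist.norm_add_le_max _ _).trans ?_
      rw [norm_mul, norm_mul]
      exact max_le_max (mul_le_mul_of_nonneg_left (hX y) (norm_nonneg _))
        (mul_le_mul_of_nonneg_left (hX x) (norm_nonneg _))
    · rw [← norm_mul, show (coordX x * coordY y - coordY x * coordX y) * coordY z =
        (coordX x * coordY z - coordY x * coordX z) * coordY y +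
        (coordX z * coordY y - coordY z * coordX y) * coordY x by ring]
      refine (IsUltrametricDist.norm_add_le_max _ _).trans ?_
      rw [norm_mul, norm_mul]
      exact max_le_max (mul_le_mul_of_nonneg_left (hY y) (norm_nonneg _))
        (mul_le_mul_of_nonneg_left (hY x) (norm_nonneg _))
  rcases le_max_iff.mp key with h | h
  · refine le_max_of_le_left ?_
    rw [div_le_div_iff₀ (by positivity) (by positivity)]
    nlinarith
  · refine le_max_of_le_right ?_
    rw [div_le_div_iff₀ (by positivity) (by positivity)]
    nlinarith

theorem projDist_le_one (x y : OnePoint ℂ_[p]) : projDist x y ≤ 1 := by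
  rw [projDist_eq, div_le_one (mul_pos (coordNorm_pos x) (coordNorm_pos y))]
  refine (norm_sub_le_max' _ _).trans (max_le ?_ ?_) <;> rw [norm_mul]
  · exact mul_le_mul (le_max_left _ _) (le_max_right _ _) (norm_nonneg _) (coordNorm_pos x).le
  · exact mul_le_mul (le_max_right _ _) (le_max_left _ _) (norm_nonneg _) (coordNorm_pos x).le

theorem projDist_eq_of_lt {x y z : OnePoint ℂ_[p]} (h : projDist x y < projDist z x) :
    projDist z y = projDist z x := by
  apply le_antisymm
  · exact (projDist_le_max z y x).trans (max_le le_rfl h.le)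
  · have h1 := projDist_le_max z x y
    rw [projDist_comm y x] at h1
    rcases le_max_iff.mp h1 with h2 | h2
    · exact h2
    · exact absurd h (not_lt.mpr h2)

theorem infty_mem_projLine (F : IntermediateField ℚ_[p] ℂ_[p]) : OnePoint.infty ∈ projLine F :=
  Or.inl rfl

theorem coe_mem_projLine {F : IntermediateField ℚ_[p] ℂ_[p]} {x : ℂ_[p]} :
    (x : OnePoint ℂ_[p]) ∈ projLine F ↔ x ∈ F := by
  constructor
  · rintro (h | ⟨a, ha, h⟩)
    · exact absurd h (OnePoint.coe_ne_infty x)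
    · rwa [OnePoint.coe_eq_coe.mp h]
  · exact fun h => Or.inr ⟨x, h, rfl⟩

theorem projLine_mono {F F' : IntermediateField ℚ_[p] ℂ_[p]} (h : F ≤ F') :
    projLine F ⊆ projLine F' := by
  rintro x (rfl | ⟨a, ha, rfl⟩)
  · exact Or.inl rfl
  · exact Or.inr ⟨a, h ha, rfl⟩

theorem closedDisc_eq_of_projDist_le (F : IntermediateField ℚ_[p] ℂ_[p]) {x y : OnePoint ℂ_[p]}
    {l : ℕ} (h : projDist x y ≤ (p : ℝ) ^ (-(l : ℤ))) : closedDisc F x l = closedDisc F y l := by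
  ext t
  constructor
  · rintro ⟨ht, h1⟩
    refine ⟨ht, (projDist_le_max y t x).trans (max_le ?_ h1)⟩
    rwa [projDist_comm]
  · rintro ⟨ht, h1⟩
    exact ⟨ht, (projDist_le_max x t y).trans (max_le h h1)⟩

end ProjectiveDistance

/-! ### An explicit model of the unramified quadratic field. -/

section QuadraticField

variable {p : ℕ} [Fact p.Prime]

/-- The map x ↦ x² - x takes the value 0 at both 0 and 1, hence is not surjective on the finite
field. Unlike a quadratic nonresidue, this works for p = 2 as well. -/
theorem exists_artinSchreier_like : ∃ c : ℕ, ∀ x : ZMod p, x ^ 2 - x ≠ c := by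
  by_contra! h
  have hs : Function.Surjective (fun x : ZMod p => x ^ 2 - x) := by
    intro y
    obtain ⟨x, hx⟩ := h y.val
    exact ⟨x, by simpa using hx⟩
  have hi := Finite.injective_iff_surjective.mpr hs
  have : (0 : ZMod p) = 1 := hi (by simp)
  exact zero_ne_one this

/-- `ξ` generates the unramified quadratic extension: `ξ² = ξ + c` and `X² - X - c` has no root
modulo `p`. -/
structure IsQuadGen (c : ℕ) (ξ : ℂ_[p]) : Prop where
  no_root : ∀ x : ZMod p, x ^ 2 - x ≠ c
  sq_eq : ξ ^ 2 = ξ + c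

theorem exists_isQuadGen : ∃ (c : ℕ) (ξ : ℂ_[p]), IsQuadGen c ξ := by
  obtain ⟨c, hc⟩ := exists_artinSchreier_like (p := p)
  obtain ⟨d, hd⟩ := IsAlgClosed.exists_pow_nat_eq (1 + 4 * (c : ℂ_[p])) two_pos
  refine ⟨c, (1 + d) / 2, hc, ?_⟩
  field_simp
  linear_combination hd

variable {c : ℕ} {ξ : ℂ_[p]}

theorem IsQuadGen.norm_le_one (h : IsQuadGen c ξ) : ‖ξ‖ ≤ 1 := by
  by_contra! h1
  have h2 : ‖ξ‖ ^ 2 ≤ max ‖ξ‖ 1 := by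
    rw [← norm_pow, h.sq_eq]
    exact (IsUltrametricDist.norm_add_le_max _ _).trans
      (max_le_max le_rfl (norm_natCast_le_one' c))
  rw [max_eq_left h1.le] at h2
  nlinarith

/-- If cancellation occurred, u = a/b would be integral with |u + ξ| < 1. Then u² + u - c = (u +
ξ)(u + 1 - ξ) has norm less than 1, and -u reduces to a root of X² - X - c modulo p. All metric
facts about the quadratic field follow from this formula. -/
theorem IsQuadGen.norm_add_mul (h : IsQuadGen c ξ) (a b : ℚ_[p]) :
    ‖algebraMap ℚ_[p] ℂ_[p] a + algebraMap ℚ_[p] ℂ_[p] b * ξ‖ = max ‖a‖ ‖b‖ := by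
  have hb : ‖algebraMap ℚ_[p] ℂ_[p] b * ξ‖ ≤ ‖b‖ := by
    rw [norm_mul, norm_algebraMap']
    exact mul_le_of_le_one_right (norm_nonneg _) h.norm_le_one
  rcases lt_or_ge ‖b‖ ‖a‖ with hab | hab
  · rw [IsUltrametricDist.norm_add_eq_max_of_norm_ne_norm, norm_algebraMap', max_eq_left hab.le,
      max_eq_left (hb.trans hab.le)]
    rw [norm_algebraMap']
    exact (hb.trans_lt hab).ne'
  rw [max_eq_right hab]
  apply le_antisymm
  · refine (IsUltrametricDist.norm_add_le_max _ _).trans (max_le ?_ hb)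
    rwa [norm_algebraMap']
  rcases eq_or_ne b 0 with rfl | hb0
  · simp
  by_contra! hlt
  set u : ℚ_[p] := a / b with hu
  have hu1 : ‖u‖ ≤ 1 := by
    rw [hu, norm_div]
    exact div_le_one_of_le₀ hab (norm_nonneg _)
  have hb0' : algebraMap ℚ_[p] ℂ_[p] b ≠ 0 := by simpa using hb0
  have hlt' : ‖algebraMap ℚ_[p] ℂ_[p] u + ξ‖ < 1 := by
    have e : algebraMap ℚ_[p] ℂ_[p] u + ξ =
        (algebraMap ℚ_[p] ℂ_[p] a + algebraMap ℚ_[p] ℂ_[p] b * ξ) / algebraMap ℚ_[p] ℂ_[p] b := by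
      rw [hu, map_div₀]
      field_simp
    rw [e, norm_div, norm_algebraMap', div_lt_one (norm_pos_iff.mpr hb0)]
    exact hlt
  have hle : ‖algebraMap ℚ_[p] ℂ_[p] u + 1 - ξ‖ ≤ 1 := by
    refine (norm_sub_le_max' _ _).trans (max_le ?_ h.norm_le_one)
    refine (IsUltrametricDist.norm_add_le_max _ _).trans (max_le ?_ norm_one.le)
    rwa [norm_algebraMap']
  have hN : ‖u ^ 2 + u - c‖ < 1 := by
    rw [← norm_algebraMap' ℂ_[p]]
    have e : algebraMap ℚ_[p] ℂ_[p] (u ^ 2 + u - c) =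
        (algebraMap ℚ_[p] ℂ_[p] u + ξ) * (algebraMap ℚ_[p] ℂ_[p] u + 1 - ξ) := by
      simp only [map_sub, map_add, map_pow, map_natCast]
      linear_combination h.sq_eq
    rw [e, norm_mul]
    calc _ ≤ ‖algebraMap ℚ_[p] ℂ_[p] u + ξ‖ * 1 := by gcongr
      _ < 1 := by rwa [mul_one]
  set v : ℤ_[p] := ⟨u, hu1⟩ with hv
  have hv1 : ‖v ^ 2 + v - c‖ < 1 := hN
  have h2 : v ^ 2 + v - c ∈ RingHom.ker (PadicInt.toZMod (p := p)) := by
    rw [PadicInt.ker_toZMod, PadicInt.maximalIdeal_eq_span_p, Ideal.mem_span_singleton,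
      ← PadicInt.norm_lt_one_iff_dvd]
    exact hv1
  rw [RingHom.mem_ker, map_sub, map_add, map_pow, map_natCast] at h2
  refine h.no_root (-(PadicInt.toZMod v)) ?_
  linear_combination h2

/-- The quadratic field `ℚ_p(ξ) = {a + b ξ}`. -/
def quadField (h : IsQuadGen c ξ) : IntermediateField ℚ_[p] ℂ_[p] where
  carrier := {z | ∃ a b : ℚ_[p], z = algebraMap ℚ_[p] ℂ_[p] a + algebraMap ℚ_[p] ℂ_[p] b * ξ}
  mul_mem' := by
    rintro _ _ ⟨a, b, rfl⟩ ⟨a', b', rfl⟩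
    refine ⟨a * a' + b * b' * c, a * b' + a' * b + b * b', ?_⟩
    simp only [map_add, map_mul, map_natCast]
    linear_combination (algebraMap ℚ_[p] ℂ_[p] b * algebraMap ℚ_[p] ℂ_[p] b') * h.sq_eq
  add_mem' := by
    rintro _ _ ⟨a, b, rfl⟩ ⟨a', b', rfl⟩
    refine ⟨a + a', b + b', ?_⟩
    simp only [map_add]
    ring
  algebraMap_mem' := fun a => ⟨a, 0, by simp⟩
  inv_mem' := by
    rintro _ ⟨a, b, rfl⟩
    by_cases h0 : algebraMap ℚ_[p] ℂ_[p] a + algebraMap ℚ_[p] ℂ_[p] b * ξ = 0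
    · exact ⟨0, 0, by simp [h0]⟩
    -- The norm of a + bξ; the conjugate of ξ is 1 - ξ.
    set N : ℚ_[p] := a ^ 2 + a * b - b ^ 2 * c with hN
    have e : algebraMap ℚ_[p] ℂ_[p] N =
        (algebraMap ℚ_[p] ℂ_[p] a + algebraMap ℚ_[p] ℂ_[p] b * ξ) *
        (algebraMap ℚ_[p] ℂ_[p] (a + b) + algebraMap ℚ_[p] ℂ_[p] (-b) * ξ) := by
      simp only [hN, map_sub, map_add, map_mul, map_pow, map_natCast, map_neg]
      linear_combination (algebraMap ℚ_[p] ℂ_[p] b) ^ 2 * h.sq_eq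
    have hN0 : algebraMap ℚ_[p] ℂ_[p] N ≠ 0 := by
      rw [e]
      refine mul_ne_zero h0 fun h1 => h0 ?_
      have n1 := h.norm_add_mul (a + b) (-b)
      rw [h1, norm_zero] at n1
      have hb : b = 0 := by
        have : ‖(-b)‖ ≤ 0 := n1 ▸ le_max_right _ _
        simpa using this
      have ha : a = 0 := by
        have : ‖a + b‖ ≤ 0 := n1 ▸ le_max_left _ _
        simpa [hb] using this
      simp [ha, hb]
    refine ⟨(a + b) / N, -b / N, ?_⟩
    rw [inv_eq_iff_eq_inv, map_div₀, map_div₀, div_mul_eq_mul_div, ← add_div, inv_div, eq_div_iff, e]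
    intro h1
    rw [h1, mul_zero] at e
    exact hN0 e

theorem mem_quadField (h : IsQuadGen c ξ) {z : ℂ_[p]} : z ∈ quadField h ↔
    ∃ a b : ℚ_[p], z = algebraMap ℚ_[p] ℂ_[p] a + algebraMap ℚ_[p] ℂ_[p] b * ξ := Iff.rfl

theorem finiteDimensional_quadField (h : IsQuadGen c ξ) :
    FiniteDimensional ℚ_[p] (quadField h) := by
  have hle : (quadField h).toSubalgebra.toSubmodule ≤ Submodule.span ℚ_[p] {1, ξ} := by
    rintro _ ⟨a, b, rfl⟩
    refine Submodule.mem_span_pair.mpr ⟨a, b, ?_⟩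
    rw [Algebra.smul_def, Algebra.smul_def, mul_one]
  have : FiniteDimensional ℚ_[p] (Submodule.span ℚ_[p] ({1, ξ} : Set ℂ_[p])) :=
    FiniteDimensional.span_of_finite ℚ_[p] (Set.toFinite _)
  exact Submodule.finiteDimensional_of_le hle

theorem isClosed_of_le_quadField (h : IsQuadGen c ξ) {F : IntermediateField ℚ_[p] ℂ_[p]}
    (hF : F ≤ quadField h) : IsClosed (F : Set ℂ_[p]) := by
  have := finiteDimensional_quadField h
  have hle : F.toSubalgebra.toSubmodule ≤ (quadField h).toSubalgebra.toSubmodule := hF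
  have h1 : FiniteDimensional ℚ_[p] (quadField h).toSubalgebra.toSubmodule := this
  have h2 : FiniteDimensional ℚ_[p] F.toSubalgebra.toSubmodule :=
    Submodule.finiteDimensional_of_le hle
  exact Submodule.closed_of_finiteDimensional F.toSubalgebra.toSubmodule

end QuadraticField


/-! ### Roots of unity of order prime to p in the quadratic field. -/

section Teichmuller

variable {p : ℕ} [Fact p.Prime]

/-- The ring of integers of `ℂ_p`. -/
noncomputable abbrev integerRing (p : ℕ) [Fact p.Prime] : ValuationSubring ℂ_[p] :=
  (NormedField.valuation (K := ℂ_[p])).valuationSubring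

theorem mem_integerRing {x : ℂ_[p]} : x ∈ integerRing p ↔ ‖x‖ ≤ 1 := by
  rw [Valuation.mem_valuationSubring_iff, NormedField.valuation_apply]
  exact Iff.rfl

/-- The residue field of `ℂ_p`. -/
abbrev residueField (p : ℕ) [Fact p.Prime] : Type := IsLocalRing.ResidueField (integerRing p)

theorem residue_eq_zero_iff (x : integerRing p) :
    IsLocalRing.residue (integerRing p) x = 0 ↔ ‖(x : ℂ_[p])‖ < 1 := by
  rw [IsLocalRing.residue_eq_zero_iff, IsLocalRing.mem_maximalIdeal, mem_nonunits_iff]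
  have hx : ‖(x : ℂ_[p])‖ ≤ 1 := mem_integerRing.mp x.2
  rw [← not_iff_not, not_not, not_lt]
  constructor
  · intro h
    obtain ⟨y, hy⟩ := h.exists_right_inv
    have h1 : ‖(x : ℂ_[p])‖ * ‖(y : ℂ_[p])‖ = 1 := by
      rw [← norm_mul, ← norm_one (α := ℂ_[p])]
      exact congrArg (fun z : integerRing p => ‖(z : ℂ_[p])‖) hy
    have hy1 : ‖(y : ℂ_[p])‖ ≤ 1 := mem_integerRing.mp y.2
    nlinarith [norm_nonneg (x : ℂ_[p])]
  · intro h
    have h1 : ‖(x : ℂ_[p])‖ = 1 := le_antisymm hx h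
    have hx0 : (x : ℂ_[p]) ≠ 0 := by
      intro h0
      rw [h0, norm_zero] at h1
      exact zero_ne_one h1
    refine IsUnit.of_mul_eq_one ⟨(x : ℂ_[p])⁻¹, mem_integerRing.mpr ?_⟩ (Subtype.ext ?_)
    · rw [norm_inv, h1, inv_one]
    · exact mul_inv_cancel₀ hx0

theorem charP_residueField : CharP (residueField p) p := by
  rw [CharP.charP_iff_prime_eq_zero (Fact.out : p.Prime),
    ← map_natCast (IsLocalRing.residue (integerRing p)), residue_eq_zero_iff]
  have h : ‖(p : ℂ_[p])‖ < 1 := by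
    rw [norm_p_complex]
    exact inv_lt_one_of_one_lt₀ one_lt_prime
  simpa using h

variable {c : ℕ} {ξ : ℂ_[p]}

theorem norm_le_one_of_pow_eq_self {x : ℂ_[p]} (hx : x ^ (p ^ 2) = x) : ‖x‖ ≤ 1 := by
  by_contra! h1
  have h2 := congrArg norm hx
  rw [norm_pow] at h2
  have h3 : ‖x‖ ^ 1 < ‖x‖ ^ (p ^ 2) :=
    pow_lt_pow_right₀ h1 (Nat.one_lt_pow two_ne_zero (Fact.out : p.Prime).one_lt)
  rw [h2, pow_one] at h3
  exact lt_irrefl _ h3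

/-- In the residue field the p² elements a + bη, with a and b in the prime field and η the class of
ξ, are distinct by `norm_add_mul`. They are all roots of X^(p²) - X, hence exhaust its roots, so the
class of x is one of them. -/
theorem IsQuadGen.exists_norm_sub_lt_one (h : IsQuadGen c ξ) {x : ℂ_[p]} (hx : x ^ (p ^ 2) = x) :
    ∃ y ∈ quadField h, ‖x - y‖ < 1 := by
  have hch : CharP (residueField p) p := charP_residueField
  have hex : ExpChar (residueField p) p := ExpChar.prime (Fact.out : p.Prime)
  have hp1 : 1 < p ^ 2 := Nat.one_lt_pow two_ne_zero (Fact.out : p.Prime).one_lt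
  have hx1 : ‖x‖ ≤ 1 := norm_le_one_of_pow_eq_self hx
  set res := IsLocalRing.residue (integerRing p) with hres
  set g : integerRing p := ⟨ξ, mem_integerRing.mpr h.norm_le_one⟩ with hg
  set η := res g with hη
  have hηsq : η ^ 2 = η + c := by
    rw [hη, ← map_pow, ← map_natCast res, ← map_add]
    congr 1
    exact Subtype.ext (by simpa [hg] using h.sq_eq)
  have hnat : ∀ m : ℕ, (m : residueField p) ^ p = m := fun m => by
    have := map_natCast (frobenius (residueField p) p) m
    rwa [frobenius_def] at this
  have hnat2 : ∀ m : ℕ, (m : residueField p) ^ (p ^ 2) = m := fun m => by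
    rw [pow_two, pow_mul, hnat, hnat]
  have hηp : (η ^ p) ^ 2 = η ^ p + c := by
    rw [← pow_mul, mul_comm, pow_mul, hηsq, add_pow_char, hnat]
  -- Frobenius permutes the roots η and 1 - η of the quadratic equation, so its square fixes η in
  -- either case.
  have hη2 : η ^ (p ^ 2) = η := by
    have hz : (η ^ p - η) * (η ^ p + η - 1) = 0 := by linear_combination hηp - hηsq
    rw [pow_two, pow_mul]
    rcases mul_eq_zero.mp hz with h1 | h1
    · rw [sub_eq_zero.mp h1, sub_eq_zero.mp h1]
    · have h2 : η ^ p = 1 - η := by linear_combination h1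
      rw [h2, sub_pow_char, one_pow, h2]
      ring
  set f : ZMod p × ZMod p → residueField p :=
    fun q => (q.1.val : residueField p) + (q.2.val : residueField p) * η with hf
  have hfroot : ∀ q, f q ^ (p ^ 2) = f q := by
    intro q
    rw [hf]
    dsimp only
    rw [add_pow_char_pow, mul_pow, hnat2, hnat2, hη2]
  have hval : ∀ a b : ZMod p, ‖((a.val : ℚ_[p]) - (b.val : ℚ_[p]))‖ < 1 → a = b := by
    intro a b hab
    have h1 : ‖(((a.val : ℤ) - (b.val : ℤ) : ℤ) : ℚ_[p])‖ < 1 := by simpa using hab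
    rw [Padic.norm_intCast_lt_one_iff, ← ZMod.intCast_zmod_eq_zero_iff_dvd] at h1
    simpa [sub_eq_zero] using h1
  have hinj : Function.Injective f := by
    rintro ⟨a, b⟩ ⟨a', b'⟩ hab
    have h0 : res (((a.val : integerRing p) + (b.val : integerRing p) * g) -
        ((a'.val : integerRing p) + (b'.val : integerRing p) * g)) = 0 := by
      simp only [map_sub, map_add, map_mul, map_natCast]
      exact sub_eq_zero.mpr hab
    rw [hres, residue_eq_zero_iff] at h0
    have e : ((((a.val : integerRing p) + (b.val : integerRing p) * g) -
        ((a'.val : integerRing p) + (b'.val : integerRing p) * g) : integerRing p) : ℂ_[p]) =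
        algebraMap ℚ_[p] ℂ_[p] ((a.val : ℚ_[p]) - a'.val) +
        algebraMap ℚ_[p] ℂ_[p] ((b.val : ℚ_[p]) - b'.val) * ξ := by
      simp only [hg, map_sub, map_natCast]
      push_cast
      ring
    rw [e, h.norm_add_mul, max_lt_iff] at h0
    rw [hval a a' h0.1, hval b b' h0.2]
  classical
  have hpoly : (X ^ (p ^ 2) - X : (residueField p)[X]) ≠ 0 :=
    FiniteField.X_pow_card_sub_X_ne_zero _ hp1
  have himg : Finset.univ.image f = (X ^ (p ^ 2) - X : (residueField p)[X]).roots.toFinset := by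
    refine Finset.eq_of_subset_of_card_le ?_ ?_
    · intro y hy
      obtain ⟨q, -, rfl⟩ := Finset.mem_image.mp hy
      simp [hpoly, hfroot q]
    · rw [Finset.card_image_of_injective _ hinj, Finset.card_univ, Fintype.card_prod, ZMod.card]
      refine (Multiset.toFinset_card_le _).trans ((card_roots' _).trans ?_)
      rw [FiniteField.X_pow_card_sub_X_natDegree_eq _ hp1, pow_two]
  set xi : integerRing p := ⟨x, mem_integerRing.mpr hx1⟩ with hxi
  have hxr : res xi ∈ (X ^ (p ^ 2) - X : (residueField p)[X]).roots.toFinset := by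
    have h1 : res xi ^ (p ^ 2) = res xi := by
      rw [← map_pow]
      congr 1
      exact Subtype.ext (by simpa [hxi] using hx)
    simp [hpoly, h1]
  rw [← himg] at hxr
  obtain ⟨q, -, hq⟩ := Finset.mem_image.mp hxr
  have h0 : res (xi - ((q.1.val : integerRing p) + (q.2.val : integerRing p) * g)) = 0 := by
    simp only [map_sub, map_add, map_mul, map_natCast]
    exact sub_eq_zero.mpr hq.symm
  rw [hres, residue_eq_zero_iff] at h0
  refine ⟨_, ⟨(q.1.val : ℚ_[p]), (q.2.val : ℚ_[p]), rfl⟩, ?_⟩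
  rw [map_natCast, map_natCast]
  exact h0

/-- With d = u - v, the difference of p-th powers is d^p plus p d times an integral element; the
first term gains a factor ε and the second a factor 1/p. -/
theorem norm_pow_prime_sub_le {u v : ℂ_[p]} {ε : ℝ} (hv : ‖v‖ ≤ 1) (hε : ε ≤ 1)
    (h : ‖u - v‖ ≤ ε) : ‖u ^ p - v ^ p‖ ≤ max ε (p : ℝ)⁻¹ * ‖u - v‖ := by
  have hd1 : ‖u - v‖ ≤ 1 := h.trans hε
  obtain ⟨r, hr⟩ := exists_add_pow_prime_eq (Fact.out : p.Prime)
    (⟨u - v, mem_integerRing.mpr hd1⟩ : integerRing p) ⟨v, mem_integerRing.mpr hv⟩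
  have hr' := congrArg (fun z : integerRing p => (z : ℂ_[p])) hr
  simp only [AddMemClass.mk_add_mk, SubmonoidClass.mk_pow] at hr'
  push_cast at hr'
  rw [sub_add_cancel] at hr'
  rw [hr', show (u - v) ^ p + v ^ p + p * (u - v) * v * r - v ^ p =
    (u - v) ^ p + p * (u - v) * v * r by ring]
  refine (IsUltrametricDist.norm_add_le_max _ _).trans (max_le ?_ ?_)
  · rw [norm_pow]
    refine (pow_le_pow_of_le_one (norm_nonneg _) hd1 (Fact.out : p.Prime).two_le).trans ?_
    rw [pow_two]
    exact mul_le_mul_of_nonneg_right (le_max_of_le_left h) (norm_nonneg _)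
  · rw [norm_mul, norm_mul, norm_mul, norm_p_complex]
    have hr1 : ‖(r : ℂ_[p])‖ ≤ 1 := mem_integerRing.mp r.2
    calc (p : ℝ)⁻¹ * ‖u - v‖ * ‖v‖ * ‖(r : ℂ_[p])‖ ≤ (p : ℝ)⁻¹ * ‖u - v‖ * 1 * 1 := by gcongr
      _ ≤ _ := by
        rw [mul_one, mul_one]
        exact mul_le_mul_of_nonneg_right (le_max_right _ _) (norm_nonneg _)

/-- Teichmüller's argument: if x^(p²) = x and y in the quadratic field is congruent to x, then
y^(p^(2k)) tends to x. The quadratic field is finite-dimensional, hence closed, so it contains x.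
Only this inclusion is needed, to give coordinates to points of K and to see that K is closed. -/
theorem unramifiedQuadratic_le_quadField (h : IsQuadGen c ξ) :
    unramifiedQuadratic p ≤ quadField h := by
  rw [unramifiedQuadratic, IntermediateField.adjoin_le_iff]
  intro x hx
  obtain ⟨y, hyL, hxy⟩ := h.exists_norm_sub_lt_one hx
  rcases eq_or_ne x 0 with rfl | hx0
  · exact zero_mem _
  have hx' : x ^ (p ^ 2) = x := hx
  have hx1 : ‖x‖ ≤ 1 := norm_le_one_of_pow_eq_self hx'
  set ε := ‖x - y‖ with hε
  set θ := max ε (p : ℝ)⁻¹ with hθ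
  have hθ1 : θ < 1 := max_lt hxy (inv_lt_one_of_one_lt₀ one_lt_prime)
  have hθ0 : 0 ≤ θ := (norm_nonneg _).trans (le_max_left _ _)
  have step : ∀ k : ℕ, ‖y ^ (p ^ k) - x ^ (p ^ k)‖ ≤ θ ^ k * ε := by
    intro k
    induction k with
    | zero => simp [hε, norm_sub_rev]
    | succ k ih =>
      have hk : ‖y ^ (p ^ k) - x ^ (p ^ k)‖ ≤ ε :=
        ih.trans (mul_le_of_le_one_left (norm_nonneg _) (pow_le_one₀ hθ0 hθ1.le))
      have hxk : ‖x ^ (p ^ k)‖ ≤ 1 := by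
        rw [norm_pow]
        exact pow_le_one₀ (norm_nonneg _) hx1
      rw [pow_succ p k, pow_mul, pow_mul, pow_succ' θ, mul_assoc]
      exact (norm_pow_prime_sub_le hxk hxy.le hk).trans (mul_le_mul_of_nonneg_left ih hθ0)
  have hxk : ∀ k : ℕ, x ^ (p ^ (2 * k)) = x := by
    intro k
    induction k with
    | zero => simp
    | succ k ih => rw [mul_add, mul_one, pow_add, pow_mul, ih, hx']
  have hlim : Tendsto (fun k : ℕ => y ^ (p ^ (2 * k))) atTop (𝓝 x) := by
    rw [tendsto_iff_norm_sub_tendsto_zero]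
    have h2 : Tendsto (fun k : ℕ => θ ^ (2 * k) * ε) atTop (𝓝 0) := by
      have := (tendsto_pow_atTop_nhds_zero_of_lt_one hθ0 hθ1).comp
        (tendsto_id.const_mul_atTop' (two_pos : (0 : ℕ) < 2))
      simpa using this.mul_const ε
    refine squeeze_zero (fun _ => norm_nonneg _) (fun k => ?_) h2
    have := step (2 * k)
    rwa [hxk k] at this
  exact (isClosed_of_le_quadField h le_rfl).mem_of_tendsto hlim
    (Eventually.of_forall fun k => pow_mem hyL _)

theorem isClosed_unramifiedQuadratic : IsClosed (unramifiedQuadratic p : Set ℂ_[p]) := by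
  obtain ⟨c, ξ, h⟩ := exists_isQuadGen (p := p)
  exact isClosed_of_le_quadField h (unramifiedQuadratic_le_quadField h)

end Teichmuller


/-! ### Reduction of quadratic points to the tree of ℚ_p. -/

section TreeRadius

variable {p : ℕ} [Fact p.Prime]

/-- `w` generates the unramified quadratic extension and `w'` is its conjugate. -/
structure IsConjPair (w w' : ℂ_[p]) : Prop where
  mem : w ∈ unramifiedQuadratic p
  not_mem : w ∉ (⊥ : IntermediateField ℚ_[p] ℂ_[p])
  add_mem : w + w' ∈ (⊥ : IntermediateField ℚ_[p] ℂ_[p])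
  mul_mem : w * w' ∈ (⊥ : IntermediateField ℚ_[p] ℂ_[p])

/-- `p ^ (-N)`, where `N` is the level of the reduction of `w` to the tree of `ℚ_p`. -/
noncomputable def treeRadius (w w' : ℂ_[p]) : ℝ := ‖w - w'‖ / max 1 ‖w‖ ^ 2

theorem zpow_neg_pos (N : ℤ) : (0 : ℝ) < (p : ℝ) ^ (-N) := zpow_pos prime_pos _

theorem exists_norm_eq_zpow {b : ℚ_[p]} (hb : b ≠ 0) : ∃ i : ℤ, ‖b‖ = (p : ℝ) ^ (-i) :=
  ⟨_, Padic.norm_eq_zpow_neg_valuation hb⟩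

/-- Write w = a + bξ. Rationality of the sum and the product forces w' = a + b - bξ, so w - w' =
b(2ξ - 1), whose norm is |b| because |2| ≤ 1, also for p = 2. -/
theorem IsConjPair.exists_coords {w w' : ℂ_[p]} (hw : IsConjPair w w') :
    ∃ (a b : ℚ_[p]), b ≠ 0 ∧ ‖w‖ = max ‖a‖ ‖b‖ ∧ ‖w - w'‖ = ‖b‖ ∧
      ∀ x : ℚ_[p], ‖algebraMap ℚ_[p] ℂ_[p] x - w‖ = max ‖x - a‖ ‖b‖ := by
  obtain ⟨c, ξ, h⟩ := exists_isQuadGen (p := p)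
  obtain ⟨a, b, hab⟩ := (mem_quadField h).mp (unramifiedQuadratic_le_quadField h hw.mem)
  have hb : b ≠ 0 := by
    rintro rfl
    refine hw.not_mem (IntermediateField.mem_bot.mpr ⟨a, ?_⟩)
    simpa using hab.symm
  obtain ⟨s, hs⟩ := IntermediateField.mem_bot.mp hw.add_mem
  obtain ⟨m, hm⟩ := IntermediateField.mem_bot.mp hw.mul_mem
  refine ⟨a, b, hb, by rw [hab, h.norm_add_mul], ?_, fun x => ?_⟩
  · have hw' : w' = algebraMap ℚ_[p] ℂ_[p] (s - a) + algebraMap ℚ_[p] ℂ_[p] (-b) * ξ := by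
      rw [map_sub, hs, map_neg, hab]
      ring
    -- Here s and m are the trace and the norm of w. The norm formula splits this equation into
    -- coordinates; the ξ-coordinate determines s.
    have hz : algebraMap ℚ_[p] ℂ_[p] (a * (s - a) - b ^ 2 * c - m) +
        algebraMap ℚ_[p] ℂ_[p] (b * (s - a) - a * b - b ^ 2) * ξ = 0 := by
      simp only [map_sub, map_mul, map_pow, map_natCast]
      rw [hm, hw', hab]
      simp only [map_sub, map_neg]
      linear_combination (algebraMap ℚ_[p] ℂ_[p] b) ^ 2 * h.sq_eq
    have hz' := h.norm_add_mul (a * (s - a) - b ^ 2 * c - m) (b * (s - a) - a * b - b ^ 2)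
    rw [hz, norm_zero] at hz'
    have h0 : b * (s - a) - a * b - b ^ 2 = 0 := by
      have : ‖b * (s - a) - a * b - b ^ 2‖ ≤ 0 := hz' ▸ le_max_right _ _
      exact norm_le_zero_iff.mp this
    have hs' : s = 2 * a + b := by
      have : b * (s - (2 * a + b)) = 0 := by linear_combination h0
      exact sub_eq_zero.mp ((mul_eq_zero.mp this).resolve_left hb)
    have e : w - w' = algebraMap ℚ_[p] ℂ_[p] (-b) + algebraMap ℚ_[p] ℂ_[p] (2 * b) * ξ := by
      rw [hw', hab, hs']
      simp only [map_sub, map_add, map_mul, map_neg, map_ofNat]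
      ring
    rw [e, h.norm_add_mul, norm_neg, norm_mul]
    refine max_eq_left (mul_le_of_le_one_left (norm_nonneg _) ?_)
    exact_mod_cast norm_natCast_le_one' (𝕜 := ℚ_[p]) 2
  · have e : algebraMap ℚ_[p] ℂ_[p] x - w =
        algebraMap ℚ_[p] ℂ_[p] (x - a) + algebraMap ℚ_[p] ℂ_[p] (-b) * ξ := by
      rw [hab, map_sub, map_neg]
      ring
    rw [e, h.norm_add_mul, norm_neg]

theorem IsConjPair.norm_sub_le {w w' : ℂ_[p]} (hw : IsConjPair w w') : ‖w - w'‖ ≤ ‖w‖ := by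
  obtain ⟨a, b, hb, h1, h2, h3⟩ := hw.exists_coords
  rw [h1, h2]
  exact le_max_right _ _

theorem IsConjPair.norm_sub_pos {w w' : ℂ_[p]} (hw : IsConjPair w w') : 0 < ‖w - w'‖ := by
  obtain ⟨a, b, hb, h1, h2, h3⟩ := hw.exists_coords
  rw [h2]
  exact norm_pos_iff.mpr hb

theorem IsConjPair.norm_sub_eq {w w' : ℂ_[p]} (_hw : IsConjPair w w') :
    ‖w - w'‖ = treeRadius w w' * max 1 ‖w‖ ^ 2 := by
  rw [treeRadius, div_mul_cancel₀ _ (pow_pos (max_one_pos w) 2).ne']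

theorem IsConjPair.treeRadius_le {w w' : ℂ_[p]} (hw : IsConjPair w w') {x : OnePoint ℂ_[p]}
    (hx : x ∈ projLine (⊥ : IntermediateField ℚ_[p] ℂ_[p])) :
    treeRadius w w' ≤ projDist x (w : OnePoint ℂ_[p]) := by
  obtain ⟨a, b, hb, h1, h2, h3⟩ := hw.exists_coords
  have hbw : ‖b‖ ≤ ‖w‖ := h1 ▸ le_max_right _ _
  have hM := max_one_pos w
  set M := max 1 ‖w‖ with hMdef
  have hbM : ‖b‖ ≤ M := hbw.trans (le_max_right _ _)
  rw [treeRadius, h2, ← hMdef]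
  rcases hx with rfl | ⟨y, hy, rfl⟩
  · rw [projDist_infty_coe, ← hMdef, div_le_div_iff₀ (pow_pos hM 2) hM]
    nlinarith
  · obtain ⟨x, rfl⟩ := IntermediateField.mem_bot.mp hy
    rw [projDist_coe_coe, ← hMdef, div_le_div_iff₀ (pow_pos hM 2) (mul_pos (max_one_pos _) hM)]
    have hd : ‖b‖ ≤ ‖algebraMap ℚ_[p] ℂ_[p] x - w‖ := by
      rw [h3]
      exact le_max_right _ _
    have key : ‖b‖ * max 1 ‖algebraMap ℚ_[p] ℂ_[p] x‖ ≤ ‖algebraMap ℚ_[p] ℂ_[p] x - w‖ * M := by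
      rcases le_or_gt ‖algebraMap ℚ_[p] ℂ_[p] x‖ M with hxM | hxM
      · exact mul_le_mul hd (max_le (le_max_left _ _) hxM) (max_one_pos _).le (norm_nonneg _)
      · have hwx : ‖w‖ < ‖algebraMap ℚ_[p] ℂ_[p] x‖ := (le_max_right _ _).trans_lt hxM
        have e : ‖algebraMap ℚ_[p] ℂ_[p] x - w‖ = ‖algebraMap ℚ_[p] ℂ_[p] x‖ := by
          rw [sub_eq_add_neg, IsUltrametricDist.norm_add_eq_max_of_norm_ne_norm, norm_neg,
            max_eq_left hwx.le]
          rw [norm_neg]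
          exact hwx.ne'
        rw [e, max_eq_right ((le_max_left _ _).trans hxM.le), mul_comm]
        exact mul_le_mul_of_nonneg_left hbM (norm_nonneg _)
    nlinarith

/-- Together with `IsConjPair.treeRadius_le` this makes `treeRadius` the distance from w to
P^1(ℚ_p). For w = a + bξ a nearest point is a, unless |a| is too small compared with |w| > 1; then
|b| = |w| and ∞ is nearest. -/
theorem IsConjPair.exists_projDist_eq {w w' : ℂ_[p]} (hw : IsConjPair w w') :
    ∃ x ∈ projLine (⊥ : IntermediateField ℚ_[p] ℂ_[p]),
      projDist x (w : OnePoint ℂ_[p]) = treeRadius w w' := by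
  obtain ⟨a, b, hb, h1, h2, h3⟩ := hw.exists_coords
  have hM := max_one_pos w
  rcases le_or_gt (max 1 ‖w‖) (max 1 ‖a‖) with h | h
  · refine ⟨_, coe_mem_projLine.mpr (IntermediateField.mem_bot.mpr ⟨a, rfl⟩), ?_⟩
    have haw : ‖a‖ ≤ ‖w‖ := h1 ▸ le_max_left _ _
    have e : max 1 ‖a‖ = max 1 ‖w‖ := le_antisymm (max_le_max le_rfl haw) h
    rw [projDist_coe_coe, h3, sub_self, norm_zero, max_eq_right (norm_nonneg _), norm_algebraMap',
      e, treeRadius, h2, pow_two]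
  · refine ⟨_, infty_mem_projLine _, ?_⟩
    have hw1 : 1 < ‖w‖ := by
      by_contra! h'
      rw [max_eq_left h'] at h
      exact absurd (le_max_left _ _) (not_le.mpr h)
    rw [max_eq_right hw1.le] at h
    have haw : ‖a‖ < ‖w‖ := (le_max_right _ _).trans_lt h
    have hbw : ‖b‖ = ‖w‖ := by
      rcases max_choice ‖a‖ ‖b‖ with h' | h'
      · rw [h'] at h1
        exact absurd h1 haw.ne'
      · rw [h1, h']
    rw [projDist_infty_coe, treeRadius, h2, hbw, max_eq_right hw1.le]
    field_simp

theorem IsConjPair.exists_level {w w' : ℂ_[p]} (hw : IsConjPair w w') :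
    ∃ N : ℕ, treeRadius w w' = (p : ℝ) ^ (-(N : ℤ)) := by
  obtain ⟨a, b, hb, h1, h2, h3⟩ := hw.exists_coords
  obtain ⟨i, hi⟩ := exists_norm_eq_zpow hb
  obtain ⟨j, hj⟩ : ∃ j : ℤ, max 1 ‖w‖ = (p : ℝ) ^ j := by
    rcases max_choice 1 ‖w‖ with h | h
    · exact ⟨0, by rw [h, zpow_zero]⟩
    · rw [h, h1]
      rcases max_choice ‖a‖ ‖b‖ with h' | h'
      · have ha : a ≠ 0 := by
          rintro rfl
          rw [norm_zero] at h'
          have := le_max_right 0 ‖b‖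
          rw [h'] at this
          exact hb (norm_le_zero_iff.mp this)
        obtain ⟨i', hi'⟩ := exists_norm_eq_zpow ha
        exact ⟨-i', by rw [h', hi']⟩
      · exact ⟨-i, by rw [h', hi]⟩
  have e : treeRadius w w' = (p : ℝ) ^ (-(i + 2 * j)) := by
    rw [treeRadius, h2, hi, hj, ← zpow_natCast ((p : ℝ) ^ j) 2, ← zpow_mul,
      ← zpow_sub₀ prime_pos.ne']
    congr 1
    push_cast
    ring
  have hle : treeRadius w w' ≤ 1 :=
    (hw.treeRadius_le (infty_mem_projLine _)).trans (projDist_le_one _ _)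
  rw [e, ← zpow_zero (p : ℝ), zpow_le_zpow_iff_right₀ one_lt_prime] at hle
  obtain ⟨N, hN⟩ := Int.eq_ofNat_of_zero_le (show 0 ≤ i + 2 * j by linarith)
  exact ⟨N, by rw [e, hN]⟩

theorem IsConjPair.mem_affinoid_iff {w w' : ℂ_[p]} (hw : IsConjPair w w') {N : ℕ} :
    w ∈ affinoid (⊥ : IntermediateField ℚ_[p] ℂ_[p]) N ↔
      (p : ℝ) ^ (-(N : ℤ)) ≤ treeRadius w w' := by
  constructor
  · intro h
    obtain ⟨x, hx, h1⟩ := hw.exists_projDist_eq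
    rw [← h1]
    exact h x hx
  · exact fun h x hx => h.trans (hw.treeRadius_le hx)

theorem IsConjPair.reducesTo_iff {w w' : ℂ_[p]} (hw : IsConjPair w w')
    {v : Set (OnePoint ℂ_[p])} :
    ReducesTo (⊥ : IntermediateField ℚ_[p] ℂ_[p]) w v ↔
      ∃ N : ℕ, treeRadius w w' = (p : ℝ) ^ (-(N : ℤ)) ∧ v = closedDisc ⊥ (w : OnePoint ℂ_[p]) N := by
  obtain ⟨x, hx, h1⟩ := hw.exists_projDist_eq
  constructor
  · rintro ⟨⟨y, hy⟩, N, rfl, h2⟩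
    refine ⟨N, le_antisymm ?_ ?_, rfl⟩
    · refine (hw.treeRadius_le hy.1).trans ?_
      rw [projDist_comm]
      exact hy.2
    · rw [← h1]
      exact h2 x hx
  · rintro ⟨N, hN, rfl⟩
    refine ⟨⟨x, hx, ?_⟩, N, rfl, fun y hy => ?_⟩
    · rw [projDist_comm, h1, hN]
    · rw [← hN]
      exact hw.treeRadius_le hy

/-- Translate by p^N in the chart t or, when |x| > 1, in the chart 1/t. For N = 0 and |x| > 1 the
point 0 is used, because the translate could leave the chart at ∞. -/
theorem exists_projDist_eq_zpow {x : OnePoint ℂ_[p]}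
    (hx : x ∈ projLine (⊥ : IntermediateField ℚ_[p] ℂ_[p])) (N : ℕ) :
    ∃ y ∈ projLine (⊥ : IntermediateField ℚ_[p] ℂ_[p]), projDist x y = (p : ℝ) ^ (-(N : ℤ)) := by
  have hpN : ‖((p : ℂ_[p]) ^ N)‖ = (p : ℝ) ^ (-(N : ℤ)) := by
    rw [norm_pow, norm_p_complex, inv_pow, zpow_neg, zpow_natCast]
  have hpm : ∀ k : ℕ, (p : ℂ_[p]) ^ k ∈ (⊥ : IntermediateField ℚ_[p] ℂ_[p]) := fun k =>
    pow_mem (natCast_mem _ p) k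
  have hle : (p : ℝ) ^ (-(N : ℤ)) ≤ 1 := by
    rw [zpow_neg, zpow_natCast]
    exact inv_le_one_of_one_le₀ (one_le_pow₀ one_lt_prime.le)
  rcases hx with rfl | ⟨x, hx, rfl⟩
  · refine ⟨_, coe_mem_projLine.mpr (inv_mem (hpm N)), ?_⟩
    rw [projDist_infty_coe, norm_inv, hpN, zpow_neg, inv_inv, max_eq_right, one_div]
    rw [zpow_natCast]
    exact one_le_pow₀ one_lt_prime.le
  rcases le_or_gt ‖x‖ 1 with h1 | h1
  · refine ⟨_, coe_mem_projLine.mpr (add_mem hx (hpm N)), ?_⟩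
    have h2 : ‖x + (p : ℂ_[p]) ^ N‖ ≤ 1 :=
      (IsUltrametricDist.norm_add_le_max _ _).trans (max_le h1 (hpN.le.trans hle))
    rw [projDist_coe_coe, max_eq_left h1, max_eq_left h2, sub_add_cancel_left, norm_neg, hpN]
    simp
  have hx0 : x ≠ 0 := by
    rintro rfl
    rw [norm_zero] at h1
    exact absurd h1 (not_lt.mpr zero_le_one)
  rcases Nat.eq_zero_or_pos N with rfl | hN
  · refine ⟨_, coe_mem_projLine.mpr (zero_mem _), ?_⟩
    rw [projDist_coe_coe, sub_zero, norm_zero, max_eq_right h1.le, max_eq_left zero_le_one, mul_one,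
      div_self (norm_ne_zero_iff.mpr hx0)]
    simp
  by_cases hz : x⁻¹ + (p : ℂ_[p]) ^ N = 0
  · refine ⟨_, infty_mem_projLine _, ?_⟩
    have h2 : x⁻¹ = -(p : ℂ_[p]) ^ N := by linear_combination hz
    rw [projDist_coe_infty, max_eq_right h1.le, one_div, ← norm_inv, h2, norm_neg, hpN]
  · refine ⟨_, coe_mem_projLine.mpr (inv_mem (add_mem (inv_mem hx) (hpm N))), ?_⟩
    have hlt : (p : ℝ) ^ (-(N : ℤ)) < 1 := by
      rw [zpow_neg, zpow_natCast]
      exact inv_lt_one_of_one_lt₀ (one_lt_pow₀ one_lt_prime hN.ne')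
    have h2 : ‖x⁻¹ + (p : ℂ_[p]) ^ N‖ < 1 := by
      refine (IsUltrametricDist.norm_add_le_max _ _).trans_lt (max_lt ?_ (hpN.le.trans_lt hlt))
      rw [norm_inv]
      exact inv_lt_one_of_one_lt₀ h1
    have h3 : 1 < ‖(x⁻¹ + (p : ℂ_[p]) ^ N)⁻¹‖ := by
      rw [norm_inv]
      exact (one_lt_inv₀ (norm_pos_iff.mpr hz)).mpr h2
    rw [projDist_coe_coe, max_eq_right h1.le, max_eq_right h3.le, ← norm_mul, ← norm_div, ← hpN]
    congr 1
    have hz' : 1 + x * (p : ℂ_[p]) ^ N ≠ 0 := by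
      intro h
      apply hz
      field_simp
      rw [h, mul_zero]
    field_simp
    ring

/-- A nonempty disc of P^1(ℚ_p) of level N contains a point at distance exactly p^(-N) from any of
its members, so the set of points determines the level. -/
theorem level_unique {x y : OnePoint ℂ_[p]} {M N : ℕ}
    (h : closedDisc (⊥ : IntermediateField ℚ_[p] ℂ_[p]) x M = closedDisc ⊥ y N)
    (hne : (closedDisc (⊥ : IntermediateField ℚ_[p] ℂ_[p]) x M).Nonempty) : M = N := by
  have key : ∀ (x y : OnePoint ℂ_[p]) (M N : ℕ),
      closedDisc (⊥ : IntermediateField ℚ_[p] ℂ_[p]) x M = closedDisc ⊥ y N →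
      (closedDisc (⊥ : IntermediateField ℚ_[p] ℂ_[p]) x M).Nonempty → M ≤ N := by
    rintro x y M N h ⟨z, hz⟩
    by_contra! hlt
    obtain ⟨t, ht, htz⟩ := exists_projDist_eq_zpow hz.1 N
    have hz' := h ▸ hz
    have ht' : t ∈ closedDisc (⊥ : IntermediateField ℚ_[p] ℂ_[p]) y N :=
      ⟨ht, (projDist_le_max y t z).trans (max_le hz'.2 htz.le)⟩
    rw [← h] at ht'
    have h1 : projDist z t ≤ (p : ℝ) ^ (-(M : ℤ)) := by
      refine (projDist_le_max z t x).trans (max_le ?_ ht'.2)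
      rw [projDist_comm]
      exact hz.2
    rw [htz, zpow_le_zpow_iff_right₀ one_lt_prime] at h1
    omega
  exact le_antisymm (key x y M N h hne) (key y x N M h.symm (h ▸ hne))

/-- Points of level `N` have the same reduction if and only if they are close. -/
theorem IsConjPair.reducesTo_closedDisc_iff {w w' u u' : ℂ_[p]} (hw : IsConjPair w w')
    (hu : IsConjPair u u') {N : ℕ} (hN : treeRadius u u' = (p : ℝ) ^ (-(N : ℤ))) :
    ReducesTo (⊥ : IntermediateField ℚ_[p] ℂ_[p]) w (closedDisc ⊥ (u : OnePoint ℂ_[p]) N) ↔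
      treeRadius w w' = (p : ℝ) ^ (-(N : ℤ)) ∧
        projDist (u : OnePoint ℂ_[p]) (w : OnePoint ℂ_[p]) ≤ (p : ℝ) ^ (-(N : ℤ)) := by
  rw [hw.reducesTo_iff]
  constructor
  · rintro ⟨M, hM, he⟩
    obtain ⟨y, hy, hy1⟩ := hu.exists_projDist_eq
    have hym : y ∈ closedDisc ⊥ (u : OnePoint ℂ_[p]) N :=
      ⟨hy, by rw [projDist_comm, hy1, hN]⟩
    obtain rfl := level_unique he ⟨y, hym⟩
    have hyw := he ▸ hym
    refine ⟨hM, (projDist_le_max _ _ y).trans (max_le hym.2 ?_)⟩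
    rw [projDist_comm]
    exact hyw.2
  · rintro ⟨h1, h2⟩
    exact ⟨N, h1, closedDisc_eq_of_projDist_le _ h2⟩

theorem IsConjPair.closedDisc_mem_vertices {w w' : ℂ_[p]} (hw : IsConjPair w w') {N : ℕ}
    (hN : treeRadius w w' = (p : ℝ) ^ (-(N : ℤ))) :
    closedDisc ⊥ (w : OnePoint ℂ_[p]) N ∈ vertices (⊥ : IntermediateField ℚ_[p] ℂ_[p]) := by
  obtain ⟨x, hx, hx1⟩ := hw.exists_projDist_eq
  exact ⟨x, hx, N, (closedDisc_eq_of_projDist_le _ (hx1.trans hN).le).symm⟩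

/-- The affinoids exhaust the upper half-plane. -/
theorem exists_mem_affinoid {z : ℂ_[p]} (hz : z ∈ upperHalf (unramifiedQuadratic p)) :
    ∃ m : ℕ, z ∈ affinoid (unramifiedQuadratic p) m := by
  obtain ⟨ε, hε, hball⟩ := Metric.isOpen_iff.mp isClosed_unramifiedQuadratic.isOpen_compl z hz
  have hdist : ∀ x ∈ unramifiedQuadratic p, ε ≤ ‖x - z‖ := by
    intro x hx
    by_contra! h
    exact hball (by simpa [dist_eq_norm] using h) hx
  have hM := max_one_pos z
  obtain ⟨m, hm⟩ := exists_pow_lt_of_lt_one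
    (show 0 < min (ε / max 1 ‖z‖ ^ 2) (1 / max 1 ‖z‖) by positivity)
    (inv_lt_one_of_one_lt₀ (one_lt_prime (p := p)))
  have hm' : (p : ℝ) ^ (-(m : ℤ)) < min (ε / max 1 ‖z‖ ^ 2) (1 / max 1 ‖z‖) := by
    rwa [zpow_neg, zpow_natCast, ← inv_pow]
  refine ⟨m, ?_⟩
  rintro _ (rfl | ⟨x, hx, rfl⟩)
  · rw [projDist_infty_coe]
    exact hm'.le.trans (min_le_right _ _)
  · rw [projDist_coe_coe]
    rcases le_or_gt ‖x‖ (max 1 ‖z‖) with h | h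
    · refine hm'.le.trans ((min_le_left _ _).trans ?_)
      rw [pow_two]
      exact div_le_div₀ (norm_nonneg _) (hdist x hx) (mul_pos (max_one_pos x) hM)
        (mul_le_mul_of_nonneg_right (max_le (le_max_left _ _) h) hM.le)
    · have hzx : ‖z‖ < ‖x‖ := (le_max_right _ _).trans_lt h
      have h1x : 1 < ‖x‖ := (le_max_left _ _).trans_lt h
      have e : ‖x - z‖ = ‖x‖ := by
        rw [sub_eq_add_neg, IsUltrametricDist.norm_add_eq_max_of_norm_ne_norm, norm_neg,
          max_eq_left hzx.le]
        rw [norm_neg]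
        exact hzx.ne'
      rw [e, max_eq_right h1x.le, div_mul_cancel_left₀ (zero_lt_one.trans h1x).ne', ← one_div]
      exact hm'.le.trans (min_le_right _ _)

theorem affinoid_subset_upperHalf (F : IntermediateField ℚ_[p] ℂ_[p]) (m : ℕ) :
    affinoid F m ⊆ upperHalf F := by
  intro z hz hzF
  have h := hz _ (coe_mem_projLine.mpr hzF)
  rw [projDist_self] at h
  exact absurd h (not_le.mpr (zpow_neg_pos _))

end TreeRadius


/-! ### Orbits under SL_2(ℤ[1/p]) and their quadratic forms. -/

section Orbits

variable {p : ℕ} [Fact p.Prime]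

/-- The inclusion of `ℚ` into its algebraic closure. -/
noncomputable abbrev ratEmb : ℚ →+* AlgebraicClosure ℚ := algebraMap ℚ (AlgebraicClosure ℚ)

theorem map_ratEmb {F : Type*} [DivisionRing F] [CharZero F] (ι : AlgebraicClosure ℚ →+* F) (q : ℚ) :
    ι (ratEmb q) = q := by
  rw [eq_ratCast, map_ratCast]

theorem ratCast_mem' {F : IntermediateField ℚ_[p] ℂ_[p]} (q : ℚ) : (q : ℂ_[p]) ∈ F :=
  SubfieldClass.ratCast_mem F q

theorem isIntegral_rat (w : AlgebraicClosure ℚ) : IsIntegral ℚ w := by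
  have h := ((AlgebraicClosure.isAlgebraic ℚ).isAlgebraic w).isIntegral
  convert h using 1
  · rfl
  · exact Subsingleton.elim _ _

theorem exists_integral_form {τ : AlgebraicClosure ℚ} (h : (minpoly ℚ τ).natDegree = 2) :
    ∃ A B C : ℤ, A ≠ 0 ∧ ratEmb A * τ ^ 2 + ratEmb B * τ + ratEmb C = 0 := by
  set b := (minpoly ℚ τ).coeff 1 with hb
  set c := (minpoly ℚ τ).coeff 0 with hc
  have hint : IsIntegral ℚ τ := isIntegral_rat τ
  have hlead : (minpoly ℚ τ).coeff 2 = 1 := by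
    rw [← h]
    exact minpoly.monic hint
  have h0 : τ ^ 2 + ratEmb b * τ + ratEmb c = 0 := by
    have h1 := minpoly.aeval ℚ τ
    rw [aeval_eq_sum_range, h, Finset.sum_range_succ, Finset.sum_range_succ, Finset.sum_range_one,
      hlead, ← hb, ← hc] at h1
    simp only [Algebra.smul_def, map_one, pow_zero, mul_one, pow_one, one_mul] at h1
    linear_combination h1
  refine ⟨b.den * c.den, b.num * c.den, c.num * b.den, ?_, ?_⟩
  · exact mul_ne_zero (by exact_mod_cast b.den_ne_zero) (by exact_mod_cast c.den_ne_zero)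
  · have eb : (b.num : ℚ) = b * b.den := (Rat.mul_den_eq_num b).symm
    have ec : (c.num : ℚ) = c * c.den := (Rat.mul_den_eq_num c).symm
    push_cast
    rw [eb, ec]
    simp only [map_mul, map_natCast]
    linear_combination ((b.den : AlgebraicClosure ℚ) * (c.den : AlgebraicClosure ℚ)) * h0

theorem not_rational_of_natDegree {τ : AlgebraicClosure ℚ} (h : (minpoly ℚ τ).natDegree = 2) :
    ∀ q : ℚ, τ ≠ ratEmb q := by
  intro q hq
  have h1 : 2 ≤ (minpoly ℚ τ).natDegree := h.ge
  rw [minpoly.two_le_natDegree_iff (isIntegral_rat τ)] at h1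
  exact h1 ⟨q, hq.symm⟩

/-- Dividing by A gives a monic quadratic with root w; w is irrational, so this is its minimal
polynomial, and Vieta's formulas apply. -/
theorem conj_spec {w : AlgebraicClosure ℚ} (hw : ∀ q : ℚ, w ≠ ratEmb q) {A B C : ℚ} (hA : A ≠ 0)
    (h : ratEmb A * w ^ 2 + ratEmb B * w + ratEmb C = 0) :
    ratEmb A * (w + conj w) = -ratEmb B ∧ ratEmb A * (w * conj w) = ratEmb C := by
  have hint : IsIntegral ℚ w := isIntegral_rat w
  have hA' : ratEmb A ≠ 0 := by simpa using hA
  set P : ℚ[X] := Polynomial.X ^ 2 + (Polynomial.C (B / A) * Polynomial.X + Polynomial.C (C / A))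
    with hP
  have hdeg : (Polynomial.C (B / A) * Polynomial.X + Polynomial.C (C / A)).degree <
      ((2 : ℕ) : WithBot ℕ) := degree_linear_lt
  have hPm : P.Monic := monic_X_pow_add hdeg
  have hPd : P.natDegree = 2 := by
    rw [hP]
    exact natDegree_eq_of_degree_eq_some (by
      rw [degree_add_eq_left_of_degree_lt] <;> rw [degree_X_pow]
      exact hdeg)
  have hroot : aeval w P = 0 := by
    simp only [hP, map_add, map_mul, map_pow, aeval_X, aeval_C, map_div₀]
    field_simp
    linear_combination h
  have h2 : 2 ≤ (minpoly ℚ w).natDegree := by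
    rw [minpoly.two_le_natDegree_iff hint]
    rintro ⟨q, hq⟩
    exact hw q hq.symm
  have he : P = minpoly ℚ w :=
    eq_of_monic_of_dvd_of_natDegree_le (minpoly.monic hint) hPm (minpoly.dvd ℚ w hroot)
      (hPd.le.trans h2)
  have hc : conj w = ratEmb (-(B / A)) - w := by
    rw [conj, ← he, hP]
    congr 3
    simp [coeff_C]
  rw [hc, map_neg, map_div₀]
  constructor
  · field_simp
    ring
  · field_simp
    linear_combination -h

theorem zInv_exists_pow (q : ℚ) (hq : q ∈ ZInv p) : ∃ (k : ℕ) (z : ℤ), q * (p : ℚ) ^ k = z := by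
  have hp : (p : ℚ) ≠ 0 := by exact_mod_cast (Fact.out : p.Prime).ne_zero
  induction hq using Algebra.adjoin_induction with
  | mem x hx =>
    rw [Set.mem_singleton_iff] at hx
    exact ⟨1, 1, by rw [hx, pow_one, inv_mul_cancel₀ hp, Int.cast_one]⟩
  | algebraMap z => exact ⟨0, z, by simp⟩
  | add x y _ _ hx hy =>
    obtain ⟨k, z, hz⟩ := hx
    obtain ⟨k', z', hz'⟩ := hy
    refine ⟨k + k', z * p ^ k' + z' * p ^ k, ?_⟩
    push_cast
    rw [← hz, ← hz']
    ring
  | mul x y _ _ hx hy =>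
    obtain ⟨k, z, hz⟩ := hx
    obtain ⟨k', z', hz'⟩ := hy
    refine ⟨k + k', z * z', ?_⟩
    push_cast
    rw [← hz, ← hz']
    ring

/-- Elements of ℤ[1/p] have only powers of p as denominators, so their p-adic size controls the
whole denominator. -/
theorem zInv_integral_of_norm_le {q : ℚ} (hq : q ∈ ZInv p) {M : ℕ}
    (h : ‖(q : ℂ_[p])‖ ≤ (p : ℝ) ^ M) : ∃ z : ℤ, q * (p : ℚ) ^ M = z := by
  have hp : (p : ℚ) ≠ 0 := by exact_mod_cast (Fact.out : p.Prime).ne_zero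
  obtain ⟨k, z, hz⟩ := zInv_exists_pow q hq
  rcases le_or_gt k M with hk | hk
  · refine ⟨z * p ^ (M - k), ?_⟩
    push_cast
    rw [← hz, mul_assoc, ← pow_add, Nat.add_sub_cancel' hk]
  · have hzn : ‖(z : ℚ_[p])‖ ≤ (p : ℝ) ^ (-((k - M : ℕ) : ℤ)) := by
      have e : ‖(z : ℚ_[p])‖ = ‖(q : ℂ_[p])‖ * ((p : ℝ)⁻¹) ^ k := by
        rw [← norm_algebraMap' ℂ_[p] (z : ℚ_[p]), map_intCast, ← norm_p_complex, ← norm_pow,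
          ← norm_mul]
        congr 1
        exact_mod_cast congrArg (Rat.cast (K := ℂ_[p])) hz.symm
      have hpp := prime_pos (p := p)
      rw [e]
      calc _ ≤ (p : ℝ) ^ M * ((p : ℝ)⁻¹) ^ k := by gcongr
        _ = _ := by
          rw [zpow_neg, zpow_natCast, inv_pow, ← div_eq_mul_inv, div_eq_iff (by positivity),
            inv_mul_eq_div, eq_div_iff (by positivity), ← pow_add, Nat.add_sub_cancel' hk.le]
    rw [Padic.norm_int_le_pow_iff_dvd] at hzn
    obtain ⟨z', hz'⟩ := hzn
    refine ⟨z', ?_⟩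
    have hz'' : (z : ℚ) = (p : ℚ) ^ (k - M) * z' := by
      rw [hz']
      push_cast
      ring
    have : q * (p : ℚ) ^ M * (p : ℚ) ^ (k - M) = z' * (p : ℚ) ^ (k - M) := by
      rw [mul_assoc, ← pow_add, Nat.add_sub_cancel' hk.le, hz, hz'']
      ring
    exact mul_right_cancel₀ (pow_ne_zero _ hp) this

/-- The data of a Möbius transformation of determinant one over `ℤ[1/p]`. -/
theorem exists_entries {τ w : AlgebraicClosure ℚ} (hw : w ∈ orbit p τ) :
    ∃ a b c d : ℚ, a ∈ ZInv p ∧ b ∈ ZInv p ∧ c ∈ ZInv p ∧ d ∈ ZInv p ∧ a * d - b * c = 1 ∧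
      w = (ratEmb a * τ + ratEmb b) / (ratEmb c * τ + ratEmb d) := by
  obtain ⟨γ, hγ⟩ := hw
  refine ⟨γ 0 0, γ 0 1, γ 1 0, γ 1 1, (γ 0 0).2, (γ 0 1).2, (γ 1 0).2, (γ 1 1).2, ?_, hγ⟩
  have h := γ.det_coe
  rw [Matrix.det_fin_two] at h
  exact_mod_cast congrArg (Subtype.val) h

theorem denom_ne_zero {τ : AlgebraicClosure ℚ} (hτ : ∀ q : ℚ, τ ≠ ratEmb q) {a b c d : ℚ}
    (h : a * d - b * c = 1) : ratEmb c * τ + ratEmb d ≠ 0 := by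
  intro h0
  rcases eq_or_ne c 0 with rfl | hc
  · have hd : d = 0 := by simpa using h0
    rw [hd] at h
    simp at h
  · refine hτ (-d / c) ?_
    have hc' : ratEmb c ≠ 0 := by simpa using hc
    rw [map_div₀, map_neg, eq_div_iff hc']
    linear_combination h0

/-- The inverse Möbius transformation. -/
theorem inverse_moebius {τ w : AlgebraicClosure ℚ} (hτ : ∀ q : ℚ, τ ≠ ratEmb q) {a b c d : ℚ}
    (h : a * d - b * c = 1) (hw : w = (ratEmb a * τ + ratEmb b) / (ratEmb c * τ + ratEmb d)) :
    τ = (ratEmb d * w - ratEmb b) / (ratEmb a - ratEmb c * w) ∧ ratEmb a - ratEmb c * w ≠ 0 := by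
  have hden := denom_ne_zero hτ h
  have h' : ratEmb a * ratEmb d - ratEmb b * ratEmb c = 1 := by
    rw [← map_mul, ← map_mul, ← map_sub, h, map_one]
  have e : ratEmb a - ratEmb c * w = 1 / (ratEmb c * τ + ratEmb d) := by
    rw [hw]
    field_simp
    linear_combination h'
  have hne : ratEmb a - ratEmb c * w ≠ 0 := by
    rw [e]
    exact one_div_ne_zero hden
  refine ⟨?_, hne⟩
  have hw' : w * (ratEmb c * τ + ratEmb d) = ratEmb a * τ + ratEmb b := by
    rw [hw, div_mul_cancel₀ _ hden]
  rw [eq_div_iff hne]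
  linear_combination -hw'

theorem orbit_not_rational {τ w : AlgebraicClosure ℚ} (hτ : ∀ q : ℚ, τ ≠ ratEmb q)
    (hw : w ∈ orbit p τ) : ∀ q : ℚ, w ≠ ratEmb q := by
  obtain ⟨a, b, c, d, -, -, -, -, hdet, hw⟩ := exists_entries hw
  rintro q rfl
  refine hτ ((d * q - b) / (a - c * q)) ?_
  rw [map_div₀, map_sub, map_sub, map_mul, map_mul]
  exact (inverse_moebius hτ hdet hw).1

/-- Substituting the inverse Möbius transformation into the form of τ keeps the discriminant, since
the determinant is 1. The new leading coefficient is a value of the old form at a nonzero rational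
vector, hence nonzero because τ is irrational. -/
theorem orbit_form {τ w : AlgebraicClosure ℚ} (hτ : ∀ q : ℚ, τ ≠ ratEmb q)
    (hw : w ∈ orbit p τ) {A B C : ℤ} (hA : A ≠ 0)
    (hABC : ratEmb A * τ ^ 2 + ratEmb B * τ + ratEmb C = 0) :
    ∃ A' B' C' : ℚ, A' ∈ ZInv p ∧ B' ∈ ZInv p ∧ C' ∈ ZInv p ∧ A' ≠ 0 ∧
      B' ^ 2 - 4 * A' * C' = ((B ^ 2 - 4 * A * C : ℤ) : ℚ) ∧
      ratEmb A' * w ^ 2 + ratEmb B' * w + ratEmb C' = 0 := by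
  obtain ⟨a, b, c, d, ha, hb, hc, hd, hdet, hw⟩ := exists_entries hw
  have hz : ∀ z : ℤ, (z : ℚ) ∈ ZInv p := fun z => intCast_mem _ z
  have h2 : (2 : ℚ) ∈ ZInv p := by exact_mod_cast hz 2
  obtain ⟨hinv, hne⟩ := inverse_moebius hτ hdet hw
  have hroot : ratEmb (A * d ^ 2 - B * d * c + C * c ^ 2) * w ^ 2 +
      ratEmb (-(2 * A * d * b) + B * (d * a + b * c) - 2 * C * c * a) * w +
      ratEmb (A * b ^ 2 - B * b * a + C * a ^ 2) = 0 := by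
    rw [eq_div_iff hne] at hinv
    simp only [map_add, map_sub, map_mul, map_pow, map_neg, map_ofNat]
    linear_combination (ratEmb a - ratEmb c * w) ^ 2 * hABC -
      (ratEmb A * ((ratEmb d * w - ratEmb b) + τ * (ratEmb a - ratEmb c * w)) +
        ratEmb B * (ratEmb a - ratEmb c * w)) * hinv
  refine ⟨A * d ^ 2 - B * d * c + C * c ^ 2,
    -(2 * A * d * b) + B * (d * a + b * c) - 2 * C * c * a,
    A * b ^ 2 - B * b * a + C * a ^ 2, ?_, ?_, ?_, ?_, ?_, hroot⟩
  · exact add_mem (sub_mem (mul_mem (hz A) (pow_mem hd 2)) (mul_mem (mul_mem (hz B) hd) hc))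
      (mul_mem (hz C) (pow_mem hc 2))
  · exact sub_mem (add_mem (neg_mem (mul_mem (mul_mem (mul_mem h2 (hz A)) hd) hb))
      (mul_mem (hz B) (add_mem (mul_mem hd ha) (mul_mem hb hc))))
      (mul_mem (mul_mem (mul_mem h2 (hz C)) hc) ha)
  · exact add_mem (sub_mem (mul_mem (hz A) (pow_mem hb 2)) (mul_mem (mul_mem (hz B) hb) ha))
      (mul_mem (hz C) (pow_mem ha 2))
  · intro h0
    rcases eq_or_ne c 0 with hc0 | hc0
    · have hd0 : d ≠ 0 := by
        rintro rfl
        rw [hc0] at hdet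
        simp at hdet
      rw [hc0] at h0
      have : (A : ℚ) * d ^ 2 = 0 := by linear_combination h0
      have hA' : (A : ℚ) ≠ 0 := by exact_mod_cast hA
      exact mul_ne_zero hA' (pow_ne_zero 2 hd0) this
    · have hx : (A : ℚ) * (-d / c) ^ 2 + B * (-d / c) + C = 0 := by
        field_simp
        linear_combination h0
      have hx' : ratEmb A * (ratEmb (-d / c)) ^ 2 + ratEmb B * ratEmb (-d / c) + ratEmb C = 0 := by
        rw [← map_pow, ← map_mul, ← map_mul, ← map_add, ← map_add, hx, map_zero]
      have hfac : (τ - ratEmb (-d / c)) * (ratEmb A * (τ + ratEmb (-d / c)) + ratEmb B) = 0 := by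
        linear_combination hABC - hx'
      have hA' : ratEmb (A : ℚ) ≠ 0 := by simpa using hA
      rcases mul_eq_zero.mp hfac with h1 | h1
      · exact hτ _ (sub_eq_zero.mp h1)
      · refine hτ (-B / A - (-d / c)) ?_
        rw [map_sub, map_div₀ _ (-(B : ℚ)), map_neg, eq_sub_iff_add_eq, eq_div_iff hA']
        linear_combination h1
  · push_cast
    have h4 : (a * d - b * c) ^ 2 = 1 := by rw [hdet, one_pow]
    linear_combination ((B : ℚ) ^ 2 - 4 * A * C) * h4

end Orbits


/-! ### Finiteness of the points of bounded level that separate two cusps. -/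

section Finiteness

variable {p : ℕ} [Fact p.Prime]
variable {ιInf : AlgebraicClosure ℚ →+* ℂ} {ιp : AlgebraicClosure ℚ →+* ℂ_[p]}

theorem IsInertRM.isConjPair {τ w : AlgebraicClosure ℚ} (hτ : IsInertRM ιInf ιp τ)
    (hw : w ∈ orbit p τ) : IsConjPair (ιp w) (ιp (conj w)) := by
  have hirr := not_rational_of_natDegree hτ.quadratic
  obtain ⟨A, B, C, hA, hABC⟩ := exists_integral_form hτ.quadratic
  have hwirr := orbit_not_rational hirr hw
  obtain ⟨A', B', C', -, -, -, hA', -, hw0⟩ := orbit_form hirr hw hA hABC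
  obtain ⟨h1, h2⟩ := conj_spec hwirr hA' hw0
  have hA0 : ratEmb A' ≠ 0 := by simpa using hA'
  obtain ⟨a, b, c, d, -, -, -, -, hdet, hwe⟩ := exists_entries hw
  have hinv := (inverse_moebius hirr hdet hwe).1
  refine ⟨?_, ?_, ?_, ?_⟩
  · rw [hwe, map_div₀, map_add, map_add, map_mul, map_mul, map_ratEmb, map_ratEmb, map_ratEmb,
      map_ratEmb]
    exact div_mem (add_mem (mul_mem (ratCast_mem' a) hτ.inert) (ratCast_mem' b))
      (add_mem (mul_mem (ratCast_mem' c) hτ.inert) (ratCast_mem' d))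
  · intro hmem
    refine hτ.mem_upperHalf ?_
    rw [hinv, map_div₀, map_sub, map_sub, map_mul, map_mul, map_ratEmb, map_ratEmb, map_ratEmb,
      map_ratEmb]
    exact div_mem (sub_mem (mul_mem (ratCast_mem' d) hmem) (ratCast_mem' b))
      (sub_mem (ratCast_mem' a) (mul_mem (ratCast_mem' c) hmem))
  · have e : w + conj w = ratEmb (-B' / A') := by
      rw [map_div₀, map_neg, eq_div_iff hA0, ← h1]
      ring
    rw [← map_add, e, map_ratEmb]
    exact ratCast_mem' _
  · have e : w * conj w = ratEmb (C' / A') := by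
      rw [map_div₀, eq_div_iff hA0, ← h2]
      ring
    rw [← map_mul, e, map_ratEmb]
    exact ratCast_mem' _

/-- Homogeneous integral coordinates of a cusp. -/
def cuspCoord : OnePoint ℚ → ℤ × ℤ
  | none => (1, 0)
  | some x => (x.num, x.den)

/-- The sign of a real quadratic form with irrational roots at a cusp. -/
theorem cuspInside_sign {A B C ω ω' : ℝ} (hA : A ≠ 0) (hs : A * (ω + ω') = -B)
    (hm : A * (ω * ω') = C) (h1 : ∀ q : ℚ, ω ≠ q) (h2 : ∀ q : ℚ, ω' ≠ q) (r : OnePoint ℚ) :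
    (cuspInside ω ω' r = 1 ∧ A * (A * (cuspCoord r).1 ^ 2 + B * (cuspCoord r).1 * (cuspCoord r).2 +
      C * (cuspCoord r).2 ^ 2) < 0) ∨
    (cuspInside ω ω' r = 0 ∧ 0 < A * (A * (cuspCoord r).1 ^ 2 + B * (cuspCoord r).1 *
      (cuspCoord r).2 + C * (cuspCoord r).2 ^ 2)) := by
  induction r using OnePoint.rec with
  | infty =>
    right
    refine ⟨rfl, ?_⟩
    change 0 < A * (A * ((1 : ℤ) : ℝ) ^ 2 + B * ((1 : ℤ) : ℝ) * ((0 : ℤ) : ℝ) +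
      C * ((0 : ℤ) : ℝ) ^ 2)
    have := pow_pos (abs_pos.mpr hA) 2
    rw [sq_abs] at this
    push_cast
    nlinarith
  | coe x =>
    have hden : (0 : ℝ) < x.den := by exact_mod_cast x.den_pos
    have hx : (x : ℝ) = x.num / x.den := Rat.cast_def x
    have e : A * (A * (x.num : ℝ) ^ 2 + B * (x.num : ℝ) * ((x.den : ℤ) : ℝ) +
        C * ((x.den : ℤ) : ℝ) ^ 2) = (A * x.den) ^ 2 * ((x - ω) * (x - ω')) := by
      rw [hx, ← hm, show B = -(A * (ω + ω')) by rw [hs, neg_neg]]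
      push_cast
      field_simp
      ring
    have hpos : 0 < (A * (x.den : ℝ)) ^ 2 := by positivity
    have hne1 : (x : ℝ) - ω ≠ 0 := fun h => h1 x (by linarith)
    have hne2 : (x : ℝ) - ω' ≠ 0 := fun h => h2 x (by linarith)
    have hci : cuspInside ω ω' (x : OnePoint ℚ) =
        if min ω ω' < (x : ℝ) ∧ (x : ℝ) < max ω ω' then 1 else 0 := rfl
    change (_ ∧ A * (A * (x.num : ℝ) ^ 2 + B * (x.num : ℝ) * ((x.den : ℤ) : ℝ) +
      C * ((x.den : ℤ) : ℝ) ^ 2) < 0) ∨ (_ ∧ 0 < A * (A * (x.num : ℝ) ^ 2 + B * (x.num : ℝ) *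
      ((x.den : ℤ) : ℝ) + C * ((x.den : ℤ) : ℝ) ^ 2))
    rw [e, hci]
    by_cases h : min ω ω' < (x : ℝ) ∧ (x : ℝ) < max ω ω'
    · left
      rw [if_pos h]
      refine ⟨rfl, mul_neg_of_pos_of_neg hpos ?_⟩
      rcases le_total ω ω' with hle | hle
      · rw [min_eq_left hle, max_eq_right hle] at h
        exact mul_neg_of_pos_of_neg (by linarith [h.1]) (by linarith [h.2])
      · rw [min_eq_right hle, max_eq_left hle] at h
        exact mul_neg_of_neg_of_pos (by linarith [h.2]) (by linarith [h.1])
    · right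
      rw [if_neg h]
      refine ⟨rfl, mul_pos hpos ?_⟩
      by_contra! hle
      apply h
      have hlt : ((x : ℝ) - ω) * (x - ω') < 0 := lt_of_le_of_ne hle (mul_ne_zero hne1 hne2)
      rcases mul_neg_iff.mp hlt with ⟨ha, hb⟩ | ⟨ha, hb⟩
      · exact ⟨(min_le_left _ _).trans_lt (by linarith), (lt_max_of_lt_right (by linarith))⟩
      · exact ⟨(min_le_right _ _).trans_lt (by linarith), (lt_max_of_lt_left (by linarith))⟩

/-- When uv < 0, the integer T is the sum of the nonnegative numbers b² and 4|uv|, which bounds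
both; u and v are nonzero integers, so |uv| bounds each of them. -/
theorem abs_le_of_sq_sub_eq {u v b T : ℤ} (hneg : u * v < 0) (h : b ^ 2 - 4 * (u * v) = T) :
    0 < T ∧ |u| ≤ T ∧ |b| ≤ T ∧ |v| ≤ T := by
  have hb := sq_nonneg b
  have hT0 : 0 < T := by linarith
  have huv : |u| * |v| ≤ T := by
    rw [← abs_mul, abs_of_neg hneg]
    linarith
  have hu1 : 1 ≤ |u| := Int.one_le_abs (fun h => by rw [h, zero_mul] at hneg; exact lt_irrefl _ hneg)
  have hv1 : 1 ≤ |v| := Int.one_le_abs (fun h => by rw [h, mul_zero] at hneg; exact lt_irrefl _ hneg)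
  refine ⟨hT0, (le_mul_of_one_le_right (abs_nonneg u) hv1).trans huv, ?_,
    (le_mul_of_one_le_left (abs_nonneg v) hu1).trans huv⟩
  have h1 : |b| ^ 2 ≤ T := by
    rw [sq_abs]
    linarith
  rcases lt_or_ge |b| 1 with h2 | h2
  · linarith
  · exact (le_self_pow₀ h2 two_ne_zero).trans h1

theorem abs_le_of_combination {x d u b v α β γ T : ℤ} (hd : d ≠ 0) (hu : |u| ≤ T) (hb : |b| ≤ T)
    (hv : |v| ≤ T) (h : x * d ^ 2 = α * u + β * b + γ * v) :
    |x| ≤ (|α| + |β| + |γ|) * T := by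
  have hd1 : 1 ≤ |d ^ 2| := Int.one_le_abs (pow_ne_zero 2 hd)
  calc |x| ≤ |x| * |d ^ 2| := le_mul_of_one_le_right (abs_nonneg x) hd1
    _ = |α * u + β * b + γ * v| := by rw [← abs_mul, h]
    _ ≤ |α * u| + |β * b| + |γ * v| := abs_add_three _ _ _
    _ ≤ |α| * T + |β| * T + |γ| * T := by
      rw [abs_mul, abs_mul, abs_mul]
      gcongr
    _ = _ := by ring

/-- An indefinite integral binary quadratic form of given discriminant which separates two given
points has bounded coefficients. -/
theorem form_coeff_bound (E r0 r1 s0 s1 : ℤ) : ∃ W : ℤ, ∀ A B C : ℤ, B ^ 2 - 4 * A * C = E →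
    (A * r0 ^ 2 + B * r0 * r1 + C * r1 ^ 2) * (A * s0 ^ 2 + B * s0 * s1 + C * s1 ^ 2) < 0 →
    |A| ≤ W ∧ |B| ≤ W ∧ |C| ≤ W := by
  refine ⟨max ((|s1 ^ 2| + |-(s1 * r1)| + |r1 ^ 2|) * (E * (r0 * s1 - r1 * s0) ^ 2))
    (max ((|-(2 * (s0 * s1))| + |r0 * s1 + r1 * s0| + |-(2 * (r0 * r1))|) *
      (E * (r0 * s1 - r1 * s0) ^ 2))
      ((|s0 ^ 2| + |-(s0 * r0)| + |r0 ^ 2|) * (E * (r0 * s1 - r1 * s0) ^ 2))), ?_⟩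
  intro A B C hE hneg
  -- This b is the polar value of the form at r and s. With the values at r and s it gives the form
  -- in the basis (r, s), whose discriminant is E times the squared determinant δ². Inverting the
  -- substitution recovers A, B, C with denominator δ².
  obtain ⟨hT0, hu, hb, hv⟩ := abs_le_of_sq_sub_eq (T := E * (r0 * s1 - r1 * s0) ^ 2)
    (b := 2 * A * r0 * s0 + B * (r0 * s1 + r1 * s0) + 2 * C * r1 * s1) hneg (by rw [← hE]; ring)
  have hδ : r0 * s1 - r1 * s0 ≠ 0 := by
    intro h0
    rw [h0] at hT0
    simp at hT0
  refine ⟨le_max_of_le_left (abs_le_of_combination hδ hu hb hv (by ring)),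
    le_max_of_le_right (le_max_of_le_left (abs_le_of_combination hδ hu hb hv (by ring))),
    le_max_of_le_right (le_max_of_le_right (abs_le_of_combination hδ hu hb hv (by ring)))⟩

theorem coeff_quadratic_two {F : Type*} [Field F] (a b c : F) :
    (Polynomial.C a * Polynomial.X ^ 2 + Polynomial.C b * Polynomial.X + Polynomial.C c).coeff 2 =
      a := by
  rw [coeff_add, coeff_add, coeff_C_mul, coeff_X_pow, coeff_C_mul, coeff_X, coeff_C]
  simp

theorem finite_roots_of_bounded_forms (W : ℤ) : {w : AlgebraicClosure ℚ | ∃ A B C : ℤ, A ≠ 0 ∧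
    |A| ≤ W ∧ |B| ≤ W ∧ |C| ≤ W ∧ ratEmb A * w ^ 2 + ratEmb B * w + ratEmb C = 0}.Finite := by
  have h : (⋃ A ∈ Set.Icc (-W) W, ⋃ B ∈ Set.Icc (-W) W, ⋃ C ∈ Set.Icc (-W) W,
      {w : AlgebraicClosure ℚ | A ≠ 0 ∧
        ratEmb A * w ^ 2 + ratEmb B * w + ratEmb C = 0}).Finite := by
    refine (Set.finite_Icc _ _).biUnion fun A _ => (Set.finite_Icc _ _).biUnion fun B _ =>
      (Set.finite_Icc _ _).biUnion fun C _ => ?_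
    by_cases hA : A = 0
    · simp [hA]
    · set P : (AlgebraicClosure ℚ)[X] := Polynomial.C (ratEmb A) * Polynomial.X ^ 2 +
        Polynomial.C (ratEmb B) * Polynomial.X + Polynomial.C (ratEmb C) with hP
      have hP0 : P ≠ 0 := by
        intro h0
        have h2 := coeff_quadratic_two (ratEmb A) (ratEmb B) (ratEmb C)
        rw [← hP, h0, coeff_zero] at h2
        apply hA
        have := (map_eq_zero ratEmb).mp h2.symm
        exact_mod_cast this
      classical
      refine (P.roots.toFinset.finite_toSet).subset ?_
      rintro w ⟨-, hw⟩
      rw [Finset.mem_coe, Multiset.mem_toFinset, mem_roots hP0, IsRoot.def, hP]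
      simpa using hw
  refine h.subset ?_
  rintro w ⟨A, B, C, hA, h1, h2, h3, hw⟩
  simp only [Set.mem_iUnion]
  exact ⟨A, abs_le.mp h1, B, abs_le.mp h2, C, abs_le.mp h3, hA, hw⟩

/-- Each such w is a root of a form over ℤ[1/p] with the discriminant of τ. Level at most N bounds
its denominators by p^N, and a nonzero intersection number means that the form has opposite signs at
r and s, so only finitely many forms occur. -/
theorem IsInertRM.finite_sigmaSetLE {τ : AlgebraicClosure ℚ} (hτ : IsInertRM ιInf ιp τ)
    (r s : OnePoint ℚ) (N : ℕ) : (sigmaSetLE ιInf ιp τ r s N).Finite := by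
  have hirr := not_rational_of_natDegree hτ.quadratic
  obtain ⟨A, B, C, hA, hABC⟩ := exists_integral_form hτ.quadratic
  obtain ⟨W, hW⟩ := form_coeff_bound ((B ^ 2 - 4 * A * C) * (p : ℤ) ^ (2 * N))
    (cuspCoord r).1 (cuspCoord r).2 (cuspCoord s).1 (cuspCoord s).2
  refine (finite_roots_of_bounded_forms W).subset ?_
  rintro w ⟨⟨hw, hint⟩, haff⟩
  have hwirr := orbit_not_rational hirr hw
  obtain ⟨A', B', C', mA, mB, mC, hA', hdisc, hw0⟩ := orbit_form hirr hw hA hABC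
  obtain ⟨h1, h2⟩ := conj_spec hwirr hA' hw0
  have hpair := hτ.isConjPair hw
  rw [hpair.mem_affinoid_iff, treeRadius, le_div_iff₀ (pow_pos (max_one_pos _) 2)] at haff
  have e1 := congrArg ιp h1
  have e2 := congrArg ιp h2
  rw [map_mul, map_add, map_neg, map_ratEmb, map_ratEmb] at e1
  rw [map_mul, map_mul, map_ratEmb, map_ratEmb] at e2
  set x := ιp w
  set x' := ιp (conj w)
  have hp := prime_pos (p := p)
  -- The square of A'(w - w̄) is the discriminant, an integer. The level bound then limits ‖A'‖
  -- max(1, ‖w‖)², which dominates all three coefficients.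
  have hd2 : ‖(A' : ℂ_[p])‖ * ‖x - x'‖ ≤ 1 := by
    have e3 : ((A' : ℂ_[p]) * (x - x')) ^ 2 = ((B ^ 2 - 4 * A * C : ℤ) : ℂ_[p]) := by
      have : ((B' ^ 2 - 4 * A' * C' : ℚ) : ℂ_[p]) = ((B ^ 2 - 4 * A * C : ℤ) : ℂ_[p]) := by
        rw [hdisc]
        norm_cast
      rw [← this]
      push_cast
      rw [← e2, show (B' : ℂ_[p]) = -((A' : ℂ_[p]) * (x + x')) by rw [e1, neg_neg]]
      ring
    have e4 : (‖(A' : ℂ_[p])‖ * ‖x - x'‖) ^ 2 ≤ 1 := by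
      rw [← norm_mul, ← norm_pow, e3]
      exact IsUltrametricDist.norm_intCast_le_one ℂ_[p] _
    exact (sq_le_one_iff₀ (by positivity)).mp e4
  have hM : ‖(A' : ℂ_[p])‖ * max 1 ‖x‖ ^ 2 ≤ (p : ℝ) ^ N := by
    have h3 : ‖(A' : ℂ_[p])‖ * ((p : ℝ) ^ (-(N : ℤ)) * max 1 ‖x‖ ^ 2) ≤ 1 :=
      (mul_le_mul_of_nonneg_left haff (norm_nonneg _)).trans hd2
    rw [zpow_neg, zpow_natCast] at h3
    have hpN : 0 < (p : ℝ) ^ N := by positivity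
    calc ‖(A' : ℂ_[p])‖ * max 1 ‖x‖ ^ 2
        = (p : ℝ) ^ N * (‖(A' : ℂ_[p])‖ * (((p : ℝ) ^ N)⁻¹ * max 1 ‖x‖ ^ 2)) := by
          field_simp
      _ ≤ (p : ℝ) ^ N * 1 := mul_le_mul_of_nonneg_left h3 hpN.le
      _ = _ := mul_one _
  have hx' : ‖x'‖ ≤ max 1 ‖x‖ := by
    have : x' = x - (x - x') := by ring
    rw [this]
    exact (norm_sub_le_max' _ _).trans ((max_le le_rfl hpair.norm_sub_le).trans (le_max_right _ _))
  have hx : ‖x‖ ≤ max 1 ‖x‖ := le_max_right _ _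
  have hM1 := one_le_max_one x
  have hAn : 0 ≤ ‖(A' : ℂ_[p])‖ := norm_nonneg _
  have nA : ‖(A' : ℂ_[p])‖ ≤ (p : ℝ) ^ N := by
    exact (le_mul_of_one_le_right hAn (one_le_pow₀ hM1)).trans hM
  have nB : ‖(B' : ℂ_[p])‖ ≤ (p : ℝ) ^ N := by
    refine le_trans ?_ hM
    rw [← norm_neg, ← e1, norm_mul]
    refine mul_le_mul_of_nonneg_left ?_ hAn
    refine (IsUltrametricDist.norm_add_le_max _ _).trans ((max_le hx hx').trans ?_)
    exact le_self_pow₀ hM1 two_ne_zero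
  have nC : ‖(C' : ℂ_[p])‖ ≤ (p : ℝ) ^ N := by
    refine le_trans ?_ hM
    rw [← e2, norm_mul, norm_mul, pow_two]
    exact mul_le_mul_of_nonneg_left (mul_le_mul hx hx' (norm_nonneg _) (max_one_pos _).le) hAn
  obtain ⟨A₀, hA₀⟩ := zInv_integral_of_norm_le mA nA
  obtain ⟨B₀, hB₀⟩ := zInv_integral_of_norm_le mB nB
  obtain ⟨C₀, hC₀⟩ := zInv_integral_of_norm_le mC nC
  have hpQ : (p : ℚ) ≠ 0 := by exact_mod_cast (Fact.out : p.Prime).ne_zero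
  have hA₀0 : A₀ ≠ 0 := by
    rintro rfl
    rw [Int.cast_zero] at hA₀
    exact mul_ne_zero hA' (pow_ne_zero N hpQ) hA₀
  have hA₀r : ((A₀ : ℤ) : ℝ) ≠ 0 := by exact_mod_cast hA₀0
  have hw₀ : ratEmb A₀ * w ^ 2 + ratEmb B₀ * w + ratEmb C₀ = 0 := by
    rw [← hA₀, ← hB₀, ← hC₀, map_mul, map_mul, map_mul]
    linear_combination (ratEmb ((p : ℚ) ^ N)) * hw0
  have hdisc₀ : B₀ ^ 2 - 4 * A₀ * C₀ = (B ^ 2 - 4 * A * C) * (p : ℤ) ^ (2 * N) := by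
    have : ((B₀ ^ 2 - 4 * A₀ * C₀ : ℤ) : ℚ) = ((B ^ 2 - 4 * A * C) * (p : ℤ) ^ (2 * N) : ℤ) := by
      rw [Int.cast_mul, ← hdisc]
      push_cast
      rw [← hA₀, ← hB₀, ← hC₀]
      ring
    exact_mod_cast this
  have hA₀q : (A₀ : ℚ) ≠ 0 := by exact_mod_cast hA₀0
  obtain ⟨g1, g2⟩ := conj_spec hwirr hA₀q hw₀
  -- reality at the archimedean place
  obtain ⟨a, b, c, d, -, -, -, -, hdet, hwe⟩ := exists_entries hw
  have hreal : ∃ ω : ℝ, ιInf w = ω := by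
    refine ⟨(a * (ιInf τ).re + b) / (c * (ιInf τ).re + d), ?_⟩
    have hτr : ιInf τ = ((ιInf τ).re : ℂ) := Complex.ext rfl (by simpa using hτ.real)
    rw [hwe, map_div₀, map_add, map_add, map_mul, map_mul, map_ratEmb, map_ratEmb, map_ratEmb,
      map_ratEmb, hτr]
    push_cast
    simp
  obtain ⟨ω, hω⟩ := hreal
  have f1 := congrArg ιInf g1
  have f2 := congrArg ιInf g2
  rw [map_mul, map_add, map_neg, map_ratEmb, map_ratEmb, hω] at f1
  rw [map_mul, map_mul, map_ratEmb, map_ratEmb, hω] at f2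
  obtain ⟨ω', hω'⟩ : ∃ ω' : ℝ, ιInf (conj w) = ω' := by
    refine ⟨-(B₀ : ℝ) / A₀ - ω, ?_⟩
    have hA₀c : ((A₀ : ℚ) : ℂ) ≠ 0 := by exact_mod_cast hA₀0
    have : ιInf (conj w) = -((B₀ : ℚ) : ℂ) / ((A₀ : ℚ) : ℂ) - ω := by
      rw [eq_sub_iff_add_eq, eq_div_iff hA₀c]
      linear_combination f1
    rw [this]
    push_cast
    ring
  rw [hω'] at f1 f2
  have f1r : (A₀ : ℝ) * (ω + ω') = -(B₀ : ℝ) := by exact_mod_cast f1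
  have f2r : (A₀ : ℝ) * (ω * ω') = (C₀ : ℝ) := by exact_mod_cast f2
  have irr1 : ∀ q : ℚ, ω ≠ q := by
    intro q hq
    refine hwirr q (ιInf.injective ?_)
    rw [hω, hq, map_ratEmb]
    norm_cast
  have irr2 : ∀ q : ℚ, ω' ≠ q := by
    intro q hq
    refine irr1 (-(B₀ : ℚ) / A₀ - q) ?_
    push_cast
    rw [← hq, eq_sub_iff_add_eq, eq_div_iff hA₀r]
    linear_combination f1r
  have hne : cuspInside ω ω' r ≠ cuspInside ω ω' s := by
    intro heq
    apply hint
    rw [rmIntersection, geodesicIntersection, hω, hω', Complex.ofReal_re, Complex.ofReal_re, heq,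
      sub_self, mul_zero]
  have hsign : (A₀ * (cuspCoord r).1 ^ 2 + B₀ * (cuspCoord r).1 * (cuspCoord r).2 +
      C₀ * (cuspCoord r).2 ^ 2) * (A₀ * (cuspCoord s).1 ^ 2 + B₀ * (cuspCoord s).1 *
      (cuspCoord s).2 + C₀ * (cuspCoord s).2 ^ 2) < 0 := by
    have key : ∀ u v : ℝ, ((A₀ : ℝ) * u) * (A₀ * v) < 0 → u * v < 0 := by
      intro u v huv
      have : ((A₀ : ℝ) * u) * (A₀ * v) = (A₀ : ℝ) ^ 2 * (u * v) := by ring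
      rw [this] at huv
      by_contra! h0
      exact absurd huv (not_lt.mpr (mul_nonneg (sq_nonneg _) h0))
    have hr := cuspInside_sign hA₀r f1r f2r irr1 irr2 r
    have hs := cuspInside_sign hA₀r f1r f2r irr1 irr2 s
    have := key _ _ (by
      rcases hr with ⟨r1, r2⟩ | ⟨r1, r2⟩ <;> rcases hs with ⟨s1, s2⟩ | ⟨s1, s2⟩
      · exact absurd (r1.trans s1.symm) hne
      · exact mul_neg_of_neg_of_pos r2 s2
      · exact mul_neg_of_pos_of_neg r2 s2
      · exact absurd (r1.trans s1.symm) hne)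
    exact_mod_cast this
  obtain ⟨w1, w2, w3⟩ := hW A₀ B₀ C₀ hdisc₀ hsign
  exact ⟨A₀, B₀, C₀, hA₀0, w1, w2, w3, hw₀⟩

end Finiteness


/-! ### The jet functional attached to a quadratic point. -/

section JetFunctional

variable {𝕜 : Type*} [Field 𝕜]

/-- The coefficients of the functional on Taylor coefficients at `w` given by pairing with
`(X - w) ^ h * (X - w') ^ h / (w - w') ^ h`, where `δ = w - w'`. -/
def jetWeight (h : ℕ) (δ : 𝕜) (j : ℕ) : 𝕜 :=
  (-1) ^ j * ((2 * h).choose j : 𝕜)⁻¹ * (h.choose j : 𝕜) * (δ ^ (h - j))⁻¹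

/-- The functional on sequences of Taylor coefficients with weights `jetWeight`. -/
def jetFun (h : ℕ) (δ : 𝕜) (d : ℕ → 𝕜) : 𝕜 :=
  ∑ j ∈ Finset.range (h + 1), jetWeight h δ j * d j

theorem jetFun_sub (h : ℕ) (δ : 𝕜) (d e : ℕ → 𝕜) :
    jetFun h δ (fun j => d j - e j) = jetFun h δ d - jetFun h δ e := by
  simp only [jetFun, mul_sub, Finset.sum_sub_distrib]

theorem jetFun_const_mul (h : ℕ) (δ x : 𝕜) (d : ℕ → 𝕜) :
    jetFun h δ (fun j => x * d j) = x * jetFun h δ d := by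
  simp only [jetFun, Finset.mul_sum]
  exact Finset.sum_congr rfl fun j _ => by ring

theorem jetFun_sum {ι : Type*} (s : Finset ι) (h : ℕ) (δ : 𝕜) (d : ι → ℕ → 𝕜) :
    jetFun h δ (fun j => ∑ i ∈ s, d i j) = ∑ i ∈ s, jetFun h δ (d i) := by
  simp only [jetFun, Finset.mul_sum]
  exact Finset.sum_comm

variable [CharZero 𝕜]

theorem jetWeight_mul_choose {h j : ℕ} (hj : j ≤ h) (δ : 𝕜) :
    jetWeight h δ j * ((2 * h).choose j : 𝕜) =
      (-1) ^ j * (h.choose j : 𝕜) * (δ ^ (h - j))⁻¹ := by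
  have h1 : ((2 * h).choose j : 𝕜) ≠ 0 :=
    Nat.cast_ne_zero.mpr (Nat.choose_pos (by omega)).ne'
  rw [jetWeight]
  field_simp

/-- This is the shape in which the weights appear in the correcting polynomial, with the single
denominator choose(2h, h). -/
theorem jetWeight_eq {h j : ℕ} (hj : j ≤ h) (δ : 𝕜) :
    jetWeight h δ j = (-1) ^ j * ((2 * h - j).choose (h - j) : 𝕜) * (δ ^ (h - j))⁻¹ /
      ((2 * h).choose h : 𝕜) := by
  have h1 : ((2 * h).choose j : 𝕜) ≠ 0 :=
    Nat.cast_ne_zero.mpr (Nat.choose_pos (by omega)).ne'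
  have h2 : ((2 * h).choose h : 𝕜) ≠ 0 :=
    Nat.cast_ne_zero.mpr (Nat.choose_pos (by omega)).ne'
  have h3 : ((2 * h).choose h : 𝕜) * (h.choose j : 𝕜) =
      ((2 * h).choose j : 𝕜) * ((2 * h - j).choose (h - j) : 𝕜) := by
    exact_mod_cast Nat.choose_mul (n := 2 * h) (k := h) (s := j) hj
  rw [jetWeight, eq_div_iff h2]
  calc _ = (-1) ^ j * ((2 * h).choose j : 𝕜)⁻¹ * (((2 * h).choose h : 𝕜) * (h.choose j : 𝕜)) *
        (δ ^ (h - j))⁻¹ := by ring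
    _ = _ := by
      rw [h3]
      field_simp

/-- Reproducing property: the jet functional of w sends (t - z)^(2h) to P_w(z). This is where the
factor in front of the logarithm in the explicit formula comes from. -/
theorem sum_jetWeight {h : ℕ} {w w' : 𝕜} (hw : w - w' ≠ 0) (z : 𝕜) :
    ∑ j ∈ Finset.range (h + 1), jetWeight h (w - w') j * (((2 * h).choose j : 𝕜) *
      (w - z) ^ (2 * h - j)) = (z - w) ^ h * (z - w') ^ h / (w - w') ^ h := by
  have e : (z - w') ^ h = ∑ j ∈ Finset.range (h + 1),
      (w - w') ^ j * (z - w) ^ (h - j) * (h.choose j : 𝕜) := by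
    rw [← add_pow]
    congr 1
    ring
  rw [e, Finset.mul_sum, Finset.sum_div]
  refine Finset.sum_congr rfl fun j hj => ?_
  have hjh : j ≤ h := Nat.lt_succ_iff.mp (Finset.mem_range.mp hj)
  have e1 : (w - z) ^ (2 * h - j) = (-1) ^ j * (z - w) ^ (2 * h - j) := by
    rw [← neg_sub z w, neg_pow]
    congr 1
    have : (-1 : 𝕜) ^ (2 * h - j) * (-1) ^ j = 1 := by
      rw [← pow_add, Nat.sub_add_cancel (by omega), pow_mul]
      simp
    have h2 : (-1 : 𝕜) ^ j * (-1) ^ j = 1 := by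
      rw [← mul_pow]
      simp
    calc (-1 : 𝕜) ^ (2 * h - j) = (-1 : 𝕜) ^ (2 * h - j) * ((-1) ^ j * (-1) ^ j) := by
          rw [h2, mul_one]
      _ = _ := by rw [← mul_assoc, this, one_mul]
  have h2 : (-1 : 𝕜) ^ j * (-1) ^ j = 1 := by
    rw [← mul_pow]
    simp
  rw [← mul_assoc, jetWeight_mul_choose hjh, e1, show 2 * h - j = h + (h - j) by omega, pow_add]
  have e2 : ((w - w') ^ (h - j))⁻¹ = (w - w') ^ j / (w - w') ^ h := by
    rw [eq_div_iff (pow_ne_zero _ hw), inv_mul_eq_iff_eq_mul₀ (pow_ne_zero _ hw), ← pow_add,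
      Nat.sub_add_cancel hjh]
  rw [e2]
  linear_combination ((h.choose j : 𝕜) * ((w - w') ^ j / (w - w') ^ h) * (z - w) ^ h *
    (z - w) ^ (h - j)) * h2

end JetFunctional

/-! ### The invariant pairing as a functional on Taylor coefficients. -/

section PolynomialPairing

variable {p : ℕ} [Fact p.Prime]

theorem neg_one_pow_mul_self' (j : ℕ) : (-1 : ℂ_[p]) ^ j * (-1) ^ j = 1 := by
  rw [← mul_pow]
  simp

theorem neg_one_pow_sub' {i j : ℕ} (h : i ≤ j) : (-1 : ℂ_[p]) ^ (j - i) = (-1) ^ j * (-1) ^ i := by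
  have h1 : (-1 : ℂ_[p]) ^ (j - i) * (-1) ^ i = (-1) ^ j := by rw [← pow_add, Nat.sub_add_cancel h]
  rw [← h1, mul_assoc, neg_one_pow_mul_self', mul_one]

theorem polyPairing_sum_left {ι : Type*} (s : Finset ι) (n : ℕ) (P : ι → ℂ_[p][X])
    (Q : ℂ_[p][X]) : polyPairing n (∑ i ∈ s, P i) Q = ∑ i ∈ s, polyPairing n (P i) Q := by
  simp only [polyPairing, finsetSum_coeff, Finset.mul_sum, Finset.sum_mul]
  exact Finset.sum_comm

theorem polyPairing_smul_left (n : ℕ) (m : ℤ) (P Q : ℂ_[p][X]) :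
    polyPairing n (m • P) Q = m * polyPairing n P Q := by
  simp only [polyPairing, coeff_smul, Finset.mul_sum]
  refine Finset.sum_congr rfl fun j _ => ?_
  rw [zsmul_eq_mul]
  ring

theorem polyPairing_C_mul_left (n : ℕ) (x : ℂ_[p]) (P Q : ℂ_[p][X]) :
    polyPairing n (C x * P) Q = x * polyPairing n P Q := by
  simp only [polyPairing, coeff_C_mul, Finset.mul_sum]
  exact Finset.sum_congr rfl fun j _ => by ring

theorem polyPairing_zero_left (n : ℕ) (Q : ℂ_[p][X]) : polyPairing n 0 Q = 0 := by
  simp [polyPairing]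

theorem taylor_coeff_eq_sum {n : ℕ} {Q : ℂ_[p][X]} (hQ : Q.natDegree ≤ n) (w : ℂ_[p]) (j : ℕ) :
    (taylor w Q).coeff j =
      ∑ m ∈ Finset.range (n + 1), Q.coeff m * (w ^ (m - j) * (m.choose j : ℂ_[p])) := by
  conv_lhs => rw [as_sum_range_C_mul_X_pow' Q (Nat.lt_succ_iff.mpr hQ)]
  rw [map_sum, finsetSum_coeff]
  refine Finset.sum_congr rfl fun m _ => ?_
  have := taylor_coeff_X_sub_C_pow w 0 m j
  rw [C_0, sub_zero, sub_zero] at this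
  rw [taylor_mul, taylor_C, coeff_C_mul, this]

/-- The pairing is invariant under translation, so powers of X - w extract Taylor coefficients at w
just as powers of X do at 0. In coefficients this is the trinomial identity for choose(2h, m)
choose(m, j). -/
theorem polyPairing_X_sub_C_pow {h j : ℕ} (hj : j ≤ 2 * h) (w : ℂ_[p]) {Q : ℂ_[p][X]}
    (hQ : Q.natDegree ≤ 2 * h) :
    polyPairing (2 * h) ((X - C w) ^ (2 * h - j)) Q =
      (-1) ^ j * ((2 * h).choose j : ℂ_[p])⁻¹ * (taylor w Q).coeff j := by
  rw [taylor_coeff_eq_sum hQ, polyPairing, ← Finset.sum_range_reflect, Finset.mul_sum]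
  refine Finset.sum_congr rfl fun m hm => ?_
  have hm' : m ≤ 2 * h := Nat.lt_succ_iff.mp (Finset.mem_range.mp hm)
  rw [show 2 * h + 1 - 1 - m = 2 * h - m by omega, show 2 * h - (2 * h - m) = m by omega,
    Nat.choose_symm hm', sub_eq_add_neg X (C w), ← C_neg,
    coeff_X_add_C_pow]
  have h1 : ((2 * h).choose j : ℂ_[p]) ≠ 0 := Nat.cast_ne_zero.mpr (Nat.choose_pos hj).ne'
  have h2 : ((2 * h).choose m : ℂ_[p]) ≠ 0 := Nat.cast_ne_zero.mpr (Nat.choose_pos hm').ne'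
  rcases lt_or_ge m j with hmj | hmj
  · rw [Nat.choose_eq_zero_of_lt hmj, Nat.choose_eq_zero_of_lt (show 2 * h - j < 2 * h - m by omega)]
    simp
  have h3 : ((2 * h).choose m : ℂ_[p]) * (m.choose j : ℂ_[p]) =
      ((2 * h).choose j : ℂ_[p]) * ((2 * h - j).choose (2 * h - m) : ℂ_[p]) := by
    rw [← Nat.choose_symm_of_eq_add (show 2 * h - j = (m - j) + (2 * h - m) by omega)]
    exact_mod_cast Nat.choose_mul (n := 2 * h) (k := m) (s := j) hmj
  rw [show 2 * h - j - (2 * h - m) = m - j by omega, neg_pow w]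
  have h4 : (-1 : ℂ_[p]) ^ (2 * h - m) * (-1) ^ (m - j) = (-1) ^ j := by
    rw [← pow_add, show 2 * h - m + (m - j) = 2 * h - j by omega]
    rw [neg_one_pow_sub' hj, pow_mul]
    simp
  rw [← h4]
  field_simp
  linear_combination (-(w ^ (m - j))) * Q.coeff m * h3

theorem rmPoly_eq {h : ℕ} {w w' : ℂ_[p]} (hw : w - w' ≠ 0) :
    C (((w - w') ^ h)⁻¹) * ((X - C w) ^ h * (X - C w') ^ h) =
      ∑ j ∈ Finset.range (h + 1), C ((h.choose j : ℂ_[p]) * ((w - w') ^ (h - j))⁻¹) *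
        (X - C w) ^ (2 * h - j) := by
  have e : (X - C w') ^ h = ∑ j ∈ Finset.range (h + 1),
      (C (w - w')) ^ j * (X - C w) ^ (h - j) * (h.choose j : ℂ_[p][X]) := by
    rw [← add_pow]
    congr 1
    rw [C_sub]
    ring
  rw [e, Finset.mul_sum, Finset.mul_sum]
  refine Finset.sum_congr rfl fun j hj => ?_
  have hjh : j ≤ h := Nat.lt_succ_iff.mp (Finset.mem_range.mp hj)
  have e2 : ((w - w') ^ (h - j))⁻¹ = (w - w') ^ j * ((w - w') ^ h)⁻¹ := by
    rw [← div_eq_mul_inv, eq_div_iff (pow_ne_zero _ hw),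
      inv_mul_eq_iff_eq_mul₀ (pow_ne_zero _ hw), ← pow_add, Nat.sub_add_cancel hjh]
  rw [e2, show 2 * h - j = h + (h - j) by omega, pow_add]
  simp only [C_mul, C_pow, map_natCast]
  ring

/-- P_w is divisible by (X - w)^h, so only Taylor coefficients of order at most h survive. The
right-hand side no longer needs Q to be a polynomial, which allows P_w to be paired with the
logarithmic kernel. -/
theorem polyPairing_rmPoly {h : ℕ} {w w' : ℂ_[p]} (hw : w - w' ≠ 0) {Q : ℂ_[p][X]}
    (hQ : Q.natDegree ≤ 2 * h) :
    polyPairing (2 * h) (C (((w - w') ^ h)⁻¹) * ((X - C w) ^ h * (X - C w') ^ h)) Q =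
      jetFun h (w - w') (fun j => (taylor w Q).coeff j) := by
  rw [rmPoly_eq hw, polyPairing_sum_left, jetFun]
  refine Finset.sum_congr rfl fun j hj => ?_
  have hjh : j ≤ h := Nat.lt_succ_iff.mp (Finset.mem_range.mp hj)
  rw [polyPairing_C_mul_left, polyPairing_X_sub_C_pow (by omega) w hQ, jetWeight]
  ring

end PolynomialPairing

/-! ### The correcting polynomial as a value of the jet functional. -/

section ExplicitSummand

variable {p : ℕ} [Fact p.Prime]

/-- The Taylor coefficients at `w` of `t ↦ log (t - z) - θ log t`, with constant term `x`. -/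
noncomputable def logQuotCoeff (θ x w z : ℂ_[p]) (q : ℕ) : ℂ_[p] :=
  if q = 0 then x else (-1) ^ (q + 1) / q * (((w - z) ^ q)⁻¹ - θ * (w ^ q)⁻¹)

/-- The polynomial part of the functional applied to `(t - z) ^ n (log (t - z) - θ log t)`. -/
theorem jetFun_mulPowCoeff_logQuotCoeff {h : ℕ} {w w' z : ℂ_[p]} (hw : w - w' ≠ 0) (θ x : ℂ_[p]) :
    jetFun h (w - w') (mulPowCoeff (2 * h) (w - z) 1 (logQuotCoeff θ x w z)) =
      (z - w) ^ h * (z - w') ^ h / (w - w') ^ h * x +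
      (∑ j ∈ Finset.range (h + 1), ∑ k ∈ Finset.range j, jetWeight h (w - w') j *
        (((2 * h).choose k : ℂ_[p]) * (w - z) ^ (2 * h - k) *
          ((-1) ^ (j - k + 1) / (j - k : ℕ) * ((w - z) ^ (j - k))⁻¹))
      - θ * ∑ j ∈ Finset.range (h + 1), ∑ k ∈ Finset.range j, jetWeight h (w - w') j *
        (((2 * h).choose k : ℂ_[p]) * (w - z) ^ (2 * h - k) *
          ((-1) ^ (j - k + 1) / (j - k : ℕ) * (w ^ (j - k))⁻¹))) := by
  rw [← sum_jetWeight hw z, Finset.sum_mul, Finset.mul_sum, ← Finset.sum_sub_distrib,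
    ← Finset.sum_add_distrib, jetFun]
  refine Finset.sum_congr rfl fun j hj => ?_
  have hjh : j ≤ h := Nat.lt_succ_iff.mp (Finset.mem_range.mp hj)
  -- For j ≤ h the Cauchy product stops at k = j, well below 2h. The term k = j carries the value of
  -- the logarithm and gives P_w(z); the terms k < j are the two double sums.
  have e : mulPowCoeff (2 * h) (w - z) 1 (logQuotCoeff θ x w z) j =
      ∑ k ∈ Finset.range (j + 1), ((2 * h).choose k : ℂ_[p]) * (w - z) ^ (2 * h - k) *
        logQuotCoeff θ x w z (j - k) := by
    rw [mulPowCoeff]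
    symm
    refine Finset.sum_subset_zero_on_sdiff (fun k hk => ?_) (fun k hk => ?_) (fun k hk => ?_)
    · rw [Finset.mem_range] at hk ⊢
      omega
    · rw [Finset.mem_sdiff, Finset.mem_range, Finset.mem_range] at hk
      rw [if_neg (by omega)]
    · rw [Finset.mem_range] at hk
      rw [if_pos (by omega), one_pow, mul_one]
  rw [e, Finset.sum_range_succ, Nat.sub_self, mul_add, Finset.mul_sum, Finset.mul_sum,
    ← Finset.sum_sub_distrib, add_comm]
  congr 1
  · rw [logQuotCoeff, if_pos rfl]
    ring
  · refine Finset.sum_congr rfl fun k hk => ?_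
    rw [Finset.mem_range] at hk
    rw [logQuotCoeff, if_neg (by omega)]
    ring

theorem neg_pow_sub_comm' (w z : ℂ_[p]) (i : ℕ) : (z - w) ^ i = (-1) ^ i * (w - z) ^ i := by
  rw [← neg_sub w z, neg_pow]

theorem zpow_sub_eq_inv {h j : ℕ} (hj : j ≤ h) (δ : ℂ_[p]) :
    δ ^ ((j : ℤ) - (h : ℤ)) = (δ ^ (h - j))⁻¹ := by
  rw [show ((j : ℤ) - (h : ℤ)) = -((h - j : ℕ) : ℤ) by omega, zpow_neg, zpow_natCast]

/-- Derivatives of log(t - z) contribute q_w, their negative powers of w - z being absorbed by (w -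
z)^(2h-k). Derivatives of log t, present only if |w| > 1, contribute the extra terms of p_w. -/
theorem correction_eq {h : ℕ} {w w' z : ℂ_[p]} (hwz : w - z ≠ 0) (θ : ℂ_[p])
    (hθ : θ = if ‖w‖ ≤ 1 then 0 else 1) :
    correction (2 * h) w w' z =
      ∑ j ∈ Finset.range (h + 1), ∑ k ∈ Finset.range j, jetWeight h (w - w') j *
        (((2 * h).choose k : ℂ_[p]) * (w - z) ^ (2 * h - k) *
          ((-1) ^ (j - k + 1) / (j - k : ℕ) * ((w - z) ^ (j - k))⁻¹))
      - θ * ∑ j ∈ Finset.range (h + 1), ∑ k ∈ Finset.range j, jetWeight h (w - w') j *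
        (((2 * h).choose k : ℂ_[p]) * (w - z) ^ (2 * h - k) *
          ((-1) ^ (j - k + 1) / (j - k : ℕ) * (w ^ (j - k))⁻¹)) := by
  rw [correction, Nat.mul_div_cancel_left h two_pos]
  refine (congrArg₂ (· + ·) ?_ ?_).trans (sub_eq_add_neg _ _).symm
  · rw [← Finset.sum_neg_distrib, Finset.range_eq_Ico, Finset.sum_eq_sum_Ico_succ_bot (by omega)]
    rw [Finset.range_zero, Finset.sum_empty, zero_add]
    refine Finset.sum_congr (by ext; simp) fun j hj => ?_
    rw [Finset.mem_Ico] at hj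
    rw [Finset.sum_mul, Finset.sum_mul, ← Finset.sum_neg_distrib]
    refine Finset.sum_congr rfl fun k hk => ?_
    rw [Finset.mem_range] at hk
    have e1 : (w - z) ^ (2 * h - k) * ((w - z) ^ (j - k))⁻¹ = (w - z) ^ (2 * h - j) := by
      rw [show 2 * h - k = 2 * h - j + (j - k) by omega, pow_add, mul_assoc,
        mul_inv_cancel₀ (pow_ne_zero _ hwz), mul_one]
    rw [jetWeight_eq (by omega), zpow_sub_eq_inv (by omega), pow_succ, neg_one_pow_sub' hk.le,
      neg_one_pow_sub' (show k ≤ 2 * h by omega), neg_pow_sub_comm' w z,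
      neg_one_pow_sub' (show j ≤ 2 * h by omega), ← e1, Nat.cast_sub hk.le]
    have h2 : (-1 : ℂ_[p]) ^ (2 * h) = 1 := by rw [pow_mul]; simp
    rw [h2]
    ring
  · rw [hθ]
    split_ifs with hw1
    · ring
    rw [one_mul, Finset.range_eq_Ico, Finset.sum_comm' (s' := fun k => Finset.Ico (k + 1) (h + 1))
      (t' := Finset.range h) (by intro x y; simp; omega), ← Finset.sum_neg_distrib]
    -- The extra terms are ordered by the exponent i = 2h - k of z - w; the inner index is then the
    -- order j - k of the derivative of the logarithm.
    refine Finset.sum_bij' (fun i _ => 2 * h - i) (fun k _ => 2 * h - k) ?_ ?_ ?_ ?_ ?_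
    · intro i hi
      rw [Finset.mem_Icc] at hi
      rw [Finset.mem_range]
      omega
    · intro i hi
      rw [Finset.mem_range] at hi
      rw [Finset.mem_Icc]
      omega
    · intro i hi
      rw [Finset.mem_Icc] at hi
      omega
    · intro i hi
      rw [Finset.mem_range] at hi
      omega
    · intro i hi
      rw [Finset.mem_Icc] at hi
      rw [Finset.mul_sum, Finset.sum_mul, ← Finset.sum_neg_distrib]
      refine Finset.sum_bij' (fun j _ => j + (2 * h - i)) (fun j _ => j - (2 * h - i)) ?_ ?_ ?_ ?_ ?_
      · intro j hj
        rw [Finset.mem_Icc] at hj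
        rw [Finset.mem_Ico]
        omega
      · intro j hj
        rw [Finset.mem_Ico] at hj
        rw [Finset.mem_Icc]
        omega
      · intro j hj
        omega
      · intro j hj
        rw [Finset.mem_Ico] at hj
        omega
      · intro j hj
        rw [Finset.mem_Icc] at hj
        have e0 : ((h : ℤ) - (i : ℤ) + (j : ℤ)) = ((j + (2 * h - i) : ℕ) : ℤ) - (h : ℤ) := by omega
        rw [jetWeight_eq (by omega), e0, zpow_sub_eq_inv (by omega),
          show j + (2 * h - i) - (2 * h - i) = j by omega, show 2 * h - (2 * h - i) = i by omega,
          Nat.choose_symm hi.2, show 2 * h - (j + (2 * h - i)) = i - j by omega,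
          show h - (j + (2 * h - i)) = i - j - h by omega, neg_pow_sub_comm' w z,
          add_comm j (2 * h - i)]
        have h2 := neg_one_pow_mul_self' (p := p) i
        rw [pow_succ, div_eq_mul_inv, div_eq_mul_inv, div_eq_mul_inv, mul_inv, mul_inv]
        linear_combination ((2 * h).choose i * ((-1) ^ j * (-1) ^ (2 * h - i + j) *
          ((i - j).choose (i - j - h)) * ((w - w') ^ (i - j - h))⁻¹ * (((2 * h).choose h : ℂ_[p])⁻¹ *
            (j : ℂ_[p])⁻¹ * (w ^ j)⁻¹)) * (w - z) ^ i) * h2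

end ExplicitSummand


/-! ### Norm estimates for the jet functional. -/

section Estimates

variable {p : ℕ} [Fact p.Prime]

theorem norm_sum_le_of_forall {ι : Type*} {s : Finset ι} {f : ι → ℂ_[p]} {B : ℝ} (hB : 0 ≤ B)
    (h : ∀ i ∈ s, ‖f i‖ ≤ B) : ‖∑ i ∈ s, f i‖ ≤ B :=
  IsUltrametricDist.norm_sum_le_of_forall_le_of_nonneg hB h

theorem norm_intCast_mul_le (m : ℤ) (x : ℂ_[p]) : ‖(m : ℂ_[p]) * x‖ ≤ ‖x‖ := by
  rw [norm_mul]
  exact mul_le_of_le_one_left (norm_nonneg _) (IsUltrametricDist.norm_intCast_le_one ℂ_[p] m)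

theorem norm_hasSum_sub_sum_le {f : ℕ → ℂ_[p]} {x : ℂ_[p]} (hf : HasSum f x) {m : ℕ} {B : ℝ}
    (hB : 0 ≤ B) (h : ∀ k, m ≤ k → ‖f k‖ ≤ B) : ‖x - ∑ k ∈ Finset.range m, f k‖ ≤ B := by
  have h1 : Tendsto (fun s : Finset ℕ => ‖∑ k ∈ s, f k - ∑ k ∈ Finset.range m, f k‖) atTop
      (𝓝 ‖x - ∑ k ∈ Finset.range m, f k‖) := (Tendsto.sub_const hf _).norm
  refine le_of_tendsto h1 ?_
  filter_upwards [eventually_ge_atTop (Finset.range m)] with s hs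
  rw [← Finset.sum_sdiff hs, add_sub_cancel_right]
  refine norm_sum_le_of_forall hB fun k hk => h k ?_
  rw [Finset.mem_sdiff, Finset.mem_range, not_lt] at hk
  exact hk.2

theorem norm_hasSum_le {f : ℕ → ℂ_[p]} {x : ℂ_[p]} (hf : HasSum f x) {B : ℝ}
    (hB : 0 ≤ B) (h : ∀ k, ‖f k‖ ≤ B) : ‖x‖ ≤ B := by
  simpa using norm_hasSum_sub_sum_le hf (m := 0) hB fun k _ => h k

/-- The ultrametric inequality bounds the whole tail by a single increment, so the limit satisfies
the same estimate with no loss in the constant. -/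
theorem exists_limit_of_increments {x : ℕ → ℂ_[p]} {A : ℝ} (hA : 0 ≤ A) {l : ℕ}
    (h : ∀ N, l ≤ N → ‖x (N + 1) - x N‖ ≤ A * (p : ℝ) ^ (-(N : ℤ))) :
    ∃ y, ∀ N, l ≤ N → ‖x N - y‖ ≤ A * (p : ℝ) ^ (-(N : ℤ)) := by
  have hp : (1 : ℝ) ≤ p := one_lt_prime.le
  have anti : ∀ M N : ℕ, M ≤ N → A * (p : ℝ) ^ (-(N : ℤ)) ≤ A * (p : ℝ) ^ (-(M : ℤ)) := by
    intro M N hMN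
    have := zpow_le_zpow_right₀ hp (show -(N : ℤ) ≤ -(M : ℤ) by omega)
    gcongr
  have key : ∀ N, l ≤ N → ∀ k, ‖x (N + k) - x N‖ ≤ A * (p : ℝ) ^ (-(N : ℤ)) := by
    intro N hN k
    induction k with
    | zero => simpa using mul_nonneg hA (zpow_neg_pos (p := p) N).le
    | succ k ih =>
      rw [← sub_add_sub_cancel _ (x (N + k)) _]
      refine (IsUltrametricDist.norm_add_le_max _ _).trans (max_le ?_ ih)
      exact (h (N + k) (by omega)).trans (anti _ _ (by omega))
  have hlim : Tendsto (fun N : ℕ => A * (p : ℝ) ^ (-(N : ℤ))) atTop (𝓝 0) := by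
    have : Tendsto (fun N : ℕ => ((p : ℝ)⁻¹) ^ N) atTop (𝓝 0) :=
      tendsto_pow_atTop_nhds_zero_of_lt_one (by positivity) (inv_lt_one_of_one_lt₀ one_lt_prime)
    simpa [zpow_neg] using this.const_mul A
  have hcau : CauchySeq x := by
    rw [Metric.cauchySeq_iff']
    intro ε hε
    obtain ⟨N, hN1, hN2⟩ := ((hlim.eventually_lt_const hε).and (eventually_ge_atTop l)).exists
    refine ⟨N, fun M hM => ?_⟩
    obtain ⟨k, rfl⟩ := Nat.exists_eq_add_of_le hM
    rw [dist_eq_norm]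
    exact (key N hN2 k).trans_lt hN1
  obtain ⟨y, hy⟩ := cauchySeq_tendsto_of_complete hcau
  refine ⟨y, fun N hN => ?_⟩
  refine le_of_tendsto (tendsto_const_nhds.sub hy).norm ?_
  filter_upwards [eventually_ge_atTop N] with M hM
  obtain ⟨k, rfl⟩ := Nat.exists_eq_add_of_le hM
  rw [norm_sub_rev]
  exact key N hN k

/-- A bound for the constants in `jetWeight`. -/
noncomputable def jetBound (p h : ℕ) [Fact p.Prime] : ℝ :=
  ∑ j ∈ Finset.range (h + 1), ‖(((2 * h).choose j : ℕ) : ℂ_[p])⁻¹‖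

theorem jetBound_nonneg (h : ℕ) : 0 ≤ jetBound p h := Finset.sum_nonneg fun _ _ => norm_nonneg _

theorem norm_jetWeight_le {h j : ℕ} (hj : j ≤ h) {δ : ℂ_[p]} (hδ : δ ≠ 0) :
    ‖jetWeight h δ j‖ ≤ jetBound p h * (‖δ‖ ^ j / ‖δ‖ ^ h) := by
  have hδ' : ‖δ‖ ≠ 0 := norm_ne_zero_iff.mpr hδ
  have e : ‖(δ ^ (h - j))⁻¹‖ = ‖δ‖ ^ j / ‖δ‖ ^ h := by
    rw [norm_inv, norm_pow, eq_div_iff (pow_ne_zero _ hδ'),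
      inv_mul_eq_iff_eq_mul₀ (pow_ne_zero _ hδ'), ← pow_add, Nat.sub_add_cancel hj]
  rw [jetWeight, norm_mul, e, norm_mul, norm_mul]
  refine mul_le_mul_of_nonneg_right ?_ (by positivity)
  have h1 : ‖(((2 * h).choose j : ℕ) : ℂ_[p])⁻¹‖ ≤ jetBound p h :=
    Finset.single_le_sum (f := fun j => ‖(((2 * h).choose j : ℕ) : ℂ_[p])⁻¹‖)
      (fun _ _ => norm_nonneg _) (Finset.mem_range.mpr (by omega))
  have h2 : ‖((-1 : ℂ_[p]) ^ j)‖ = 1 := by simp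
  rw [h2, one_mul]
  calc _ ≤ ‖(((2 * h).choose j : ℕ) : ℂ_[p])⁻¹‖ * 1 := by
        gcongr
        exact norm_natCast_le_one' _
    _ ≤ _ := by rwa [mul_one]

theorem norm_jetFun_le {h : ℕ} {δ : ℂ_[p]} (hδ : δ ≠ 0) {d : ℕ → ℂ_[p]} {B : ℝ} (hB : 0 ≤ B)
    (hd : ∀ j ≤ h, ‖d j‖ * ‖δ‖ ^ j ≤ B) : ‖jetFun h δ d‖ ≤ jetBound p h * (B / ‖δ‖ ^ h) := by
  have hC := jetBound_nonneg (p := p) h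
  refine norm_sum_le_of_forall (by positivity) fun j hj => ?_
  have hjh : j ≤ h := Nat.lt_succ_iff.mp (Finset.mem_range.mp hj)
  rw [norm_mul]
  calc _ ≤ jetBound p h * (‖δ‖ ^ j / ‖δ‖ ^ h) * ‖d j‖ := by
        gcongr
        exact norm_jetWeight_le hjh hδ
    _ = jetBound p h * ((‖d j‖ * ‖δ‖ ^ j) / ‖δ‖ ^ h) := by ring
    _ ≤ _ := by
      gcongr
      exact hd j hjh

/-- The Taylor coefficients at `w` of `t ↦ (t - a) ^ i`. -/
noncomputable def powJet (a : ℂ_[p]) (i : ℕ) (w : ℂ_[p]) (j : ℕ) : ℂ_[p] :=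
  (w - a) ^ (i - j) * (i.choose j : ℂ_[p])

/-- The Taylor coefficients at `w` of `t ↦ t ^ (-i - 1)`. -/
noncomputable def invPowJet (i : ℕ) (w : ℂ_[p]) (j : ℕ) : ℂ_[p] :=
  (-1) ^ j * ((j + i).choose i : ℂ_[p]) * (w ^ (j + i + 1))⁻¹

theorem taylor_coeff_sum_pow (u w : ℂ_[p]) (e : ℕ → ℂ_[p]) (m j : ℕ) :
    (taylor w (∑ k ∈ Finset.range m, C (e k) * (X - C u) ^ k)).coeff j =
      ∑ k ∈ Finset.range m, e k * powJet u k w j := by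
  rw [map_sum, finsetSum_coeff]
  refine Finset.sum_congr rfl fun k _ => ?_
  rw [taylor_mul, taylor_C, coeff_C_mul, taylor_coeff_X_sub_C_pow, powJet]

theorem natDegree_sum_pow_le (u : ℂ_[p]) (e : ℕ → ℂ_[p]) (n : ℕ) :
    (∑ k ∈ Finset.range (n + 1), C (e k) * (X - C u) ^ k).natDegree ≤ n := by
  refine natDegree_sum_le_of_forall_le _ _ fun k hk => ?_
  refine (natDegree_C_mul_le _ _).trans ?_
  rw [natDegree_pow, natDegree_X_sub_C, mul_one]
  exact Nat.lt_succ_iff.mp (Finset.mem_range.mp hk)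

/-- A Taylor coefficient of order j costs ρ^(-j) and its weight is at most a constant times
‖δ‖^(j-h). As ρ ≤ ‖δ‖, the worst case is j = h, which leaves ρ^(k-h). -/
theorem norm_jetFun_powJet_le {h : ℕ} {δ : ℂ_[p]} {ρ : ℝ} (hρ : 0 < ρ) (hρδ : ρ ≤ ‖δ‖)
    {u w : ℂ_[p]} (hw : ‖w - u‖ ≤ ρ) (k : ℕ) :
    ‖jetFun h δ (powJet u k w)‖ ≤ jetBound p h * (ρ ^ k / ρ ^ h) := by
  have hδ : 0 < ‖δ‖ := hρ.trans_le hρδ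
  have hC := jetBound_nonneg (p := p) h
  refine (norm_jetFun_le (norm_pos_iff.mp hδ) (B := ρ ^ k * (‖δ‖ / ρ) ^ h) (by positivity)
    fun j hj => ?_).trans (le_of_eq ?_)
  · calc _ ≤ ρ ^ k / ρ ^ j * ‖δ‖ ^ j := by
          gcongr
          exact norm_pow_sub_mul_choose_le hw k j hρ
      _ = ρ ^ k * (‖δ‖ / ρ) ^ j := by
        rw [div_pow]
        ring
      _ ≤ _ := by
        gcongr ρ ^ k * ?_
        exact pow_le_pow_right₀ ((one_le_div hρ).mpr hρδ) hj
  · rw [div_pow]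
    field_simp

theorem hasSum_jetFun {h : ℕ} {δ : ℂ_[p]} {e : ℕ → ℂ_[p]} {f : ℕ → ℕ → ℂ_[p]} {d : ℕ → ℂ_[p]}
    (hd : ∀ j, HasSum (fun k => e k * f k j) (d j)) :
    HasSum (fun k => e k * jetFun h δ (f k)) (jetFun h δ d) := by
  have h1 : HasSum (fun k => ∑ j ∈ Finset.range (h + 1), jetWeight h δ j * (e k * f k j))
      (jetFun h δ d) := hasSum_sum fun j _ => (hd j).mul_left _
  refine hasSum_of_eq h1 (fun k => ?_) rfl
  rw [jetFun, Finset.mul_sum]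
  exact Finset.sum_congr rfl fun j _ => by ring

/-- The functional `jetFun` depends on the Taylor polynomial at a nearby point up to a small error. -/
theorem norm_jetFun_sub_taylor_le {h n : ℕ} {δ : ℂ_[p]} {ρ : ℝ} (hρ : 0 < ρ) (hρδ : ρ ≤ ‖δ‖)
    {u w : ℂ_[p]} (hw : ‖w - u‖ ≤ ρ) {g : ℂ_[p] → ℂ_[p]} {e d : ℕ → ℂ_[p]} {r B : ℝ} (hr : 0 < r)
    (he : Tendsto (fun k => ‖e k‖ * ρ ^ k) atTop (𝓝 0)) (hg : ExpandsAt g u ρ e)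
    (hd : ExpandsAt g w r d) (hB : 0 ≤ B) (heB : ∀ k, n < k → ‖e k‖ * ρ ^ k ≤ B) :
    ‖jetFun h δ d - jetFun h δ (fun j =>
      (taylor w (∑ k ∈ Finset.range (n + 1), C (e k) * (X - C u) ^ k)).coeff j)‖ ≤
      jetBound p h * (B / ρ ^ h) := by
  have hC := jetBound_nonneg (p := p) h
  have h1 : HasSum (fun k => e k * jetFun h δ (powJet u k w)) (jetFun h δ d) :=
    hasSum_jetFun fun j => hg.hasSum_recenter hr hρ hw he hd j
  simp only [taylor_coeff_sum_pow]
  rw [jetFun_sum]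
  simp only [jetFun_const_mul]
  refine norm_hasSum_sub_sum_le h1 (by positivity) fun k hk => ?_
  rw [norm_mul]
  calc _ ≤ ‖e k‖ * (jetBound p h * (ρ ^ k / ρ ^ h)) := by
        gcongr
        exact norm_jetFun_powJet_le hρ hρδ hw k
    _ = jetBound p h * ((‖e k‖ * ρ ^ k) / ρ ^ h) := by ring
    _ ≤ _ := by
      gcongr
      exact heB k hk

end Estimates

/-! ### Degree-zero systems of quadratic points, sorted by level. -/

section System

variable {p : ℕ} [Fact p.Prime] {ι : Type*}

open Classical in
/-- A locally finite divisor with integral weights `c` on quadratic points `w`, whose part of level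
at most `N` is `S N`, and which is annihilated by polynomials of degree at most `2 * h` on every
fibre of the reduction to the tree of `ℚ_p`. -/
structure IsDegreeZeroSystem (h : ℕ) (w w' : ι → ℂ_[p]) (c : ι → ℤ) (S : ℕ → Finset ι) : Prop where
  pair : ∀ N, ∀ x ∈ S N, IsConjPair (w x) (w' x)
  mem_iff : ∀ M N, ∀ x ∈ S N, x ∈ S M ↔ (p : ℝ) ^ (-(M : ℤ)) ≤ treeRadius (w x) (w' x)
  fibre : ∀ N, ∀ u ∈ S N, treeRadius (w u) (w' u) = (p : ℝ) ^ (-(N : ℤ)) → ∀ Q : ℂ_[p][X],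
    Q.natDegree ≤ 2 * h →
      ∑ x ∈ S N with treeRadius (w x) (w' x) = (p : ℝ) ^ (-(N : ℤ)) ∧
          projDist (w u : OnePoint ℂ_[p]) (w x) ≤ (p : ℝ) ^ (-(N : ℤ)),
        (c x : ℂ_[p]) * jetFun h (w x - w' x) (fun j => (taylor (w x) Q).coeff j) = 0

variable {h : ℕ} {w w' : ι → ℂ_[p]} {c : ι → ℤ} {S : ℕ → Finset ι}

theorem zpow_neg_le_iff {M N : ℕ} : (p : ℝ) ^ (-(M : ℤ)) ≤ (p : ℝ) ^ (-(N : ℤ)) ↔ N ≤ M := by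
  rw [zpow_le_zpow_iff_right₀ one_lt_prime]
  omega

namespace IsDegreeZeroSystem

theorem subset (hS : IsDegreeZeroSystem h w w' c S) {M N : ℕ} (hMN : M ≤ N) : S M ⊆ S N := by
  intro x hx
  rw [hS.mem_iff N M x hx]
  exact (zpow_neg_le_iff.mpr hMN).trans ((hS.mem_iff M M x hx).mp hx)

theorem mem_level (hS : IsDegreeZeroSystem h w w' c S) {N : ℕ} {x : ι} (hx : x ∈ S (N + 1)) :
    treeRadius (w x) (w' x) = (p : ℝ) ^ (-((N + 1 : ℕ) : ℤ)) ↔ x ∉ S N := by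
  rw [hS.mem_iff N _ x hx]
  have h1 := (hS.mem_iff (N + 1) _ x hx).mp hx
  obtain ⟨M, hM⟩ := (hS.pair _ x hx).exists_level
  rw [hM, zpow_neg_le_iff] at h1
  rw [hM, zpow_neg_le_iff, zpow_right_inj₀ prime_pos one_lt_prime.ne']
  omega

open Classical in
theorem sum_succ (hS : IsDegreeZeroSystem h w w' c S) (N : ℕ) (P : ι → Prop) (f : ι → ℂ_[p]) :
    ∑ x ∈ S (N + 1) with P x, f x = ∑ x ∈ S N with P x, f x +
      ∑ x ∈ S (N + 1) with treeRadius (w x) (w' x) = (p : ℝ) ^ (-((N + 1 : ℕ) : ℤ)) ∧ P x, f x := by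
  rw [← Finset.sum_filter_add_sum_filter_not ((S (N + 1)).filter P) (fun x => x ∈ S N)]
  congr 1
  · refine Finset.sum_congr ?_ fun _ _ => rfl
    ext x
    simp only [Finset.mem_filter]
    exact ⟨fun hx => ⟨hx.2, hx.1.2⟩, fun hx => ⟨⟨hS.subset (Nat.le_succ N) hx.1, hx.2⟩, hx.1⟩⟩
  · refine Finset.sum_congr ?_ fun _ _ => rfl
    ext x
    simp only [Finset.mem_filter]
    constructor
    · rintro ⟨⟨h1, h2⟩, h3⟩
      exact ⟨h1, (hS.mem_level h1).mpr h3, h2⟩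
    · rintro ⟨h1, h2, h3⟩
      exact ⟨⟨h1, h3⟩, (hS.mem_level h1).mp h2⟩

open Classical in
-- This is how degree zero enters all estimates. The points of level N are grouped by the disc of
-- radius p^(-N) containing them. On each group a polynomial of degree at most 2h may be subtracted
-- at no cost, and the ultrametric inequality keeps the largest remaining term. The first hypothesis
-- says that P does not cut a group.
theorem norm_sum_level_le (hS : IsDegreeZeroSystem h w w' c S) (N : ℕ) (P : ι → Prop)
    (hP : ∀ u ∈ S N, ∀ x ∈ S N, treeRadius (w u) (w' u) = (p : ℝ) ^ (-(N : ℤ)) →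
      treeRadius (w x) (w' x) = (p : ℝ) ^ (-(N : ℤ)) →
      projDist (w u : OnePoint ℂ_[p]) (w x) ≤ (p : ℝ) ^ (-(N : ℤ)) → P u → P x)
    (d : ι → ℕ → ℂ_[p]) {B : ℝ} (hB : 0 ≤ B)
    (hd : ∀ u ∈ S N, treeRadius (w u) (w' u) = (p : ℝ) ^ (-(N : ℤ)) → P u →
      ∃ Q : ℂ_[p][X], Q.natDegree ≤ 2 * h ∧ ∀ x ∈ S N,
        treeRadius (w x) (w' x) = (p : ℝ) ^ (-(N : ℤ)) →
        projDist (w u : OnePoint ℂ_[p]) (w x) ≤ (p : ℝ) ^ (-(N : ℤ)) →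
        ‖jetFun h (w x - w' x) (d x) -
          jetFun h (w x - w' x) (fun j => (taylor (w x) Q).coeff j)‖ ≤ B) :
    ‖∑ x ∈ S N with treeRadius (w x) (w' x) = (p : ℝ) ^ (-(N : ℤ)) ∧ P x,
      (c x : ℂ_[p]) * jetFun h (w x - w' x) (d x)‖ ≤ B := by
  set V := (S N).filter (fun x => treeRadius (w x) (w' x) = (p : ℝ) ^ (-(N : ℤ)) ∧ P x) with hV
  set G : ι → Set (OnePoint ℂ_[p]) :=
    fun x => closedDisc (unramifiedQuadratic p) (w x : OnePoint ℂ_[p]) N with hG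
  rw [← Finset.sum_fiberwise_of_maps_to (s := V) (t := V.image G) (g := G)
    (fun x hx => Finset.mem_image_of_mem G hx)]
  refine norm_sum_le_of_forall hB fun b hb => ?_
  obtain ⟨u, hu, rfl⟩ := Finset.mem_image.mp hb
  rw [hV, Finset.mem_filter] at hu
  obtain ⟨hu1, hu2, hu3⟩ := hu
  obtain ⟨Q, hQ, hQd⟩ := hd u hu1 hu2 hu3
  have hset : V.filter (fun x => G x = G u) = (S N).filter (fun x =>
      treeRadius (w x) (w' x) = (p : ℝ) ^ (-(N : ℤ)) ∧
        projDist (w u : OnePoint ℂ_[p]) (w x) ≤ (p : ℝ) ^ (-(N : ℤ))) := by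
    ext x
    simp only [hV, Finset.mem_filter]
    constructor
    · rintro ⟨⟨h1, h2, -⟩, h3⟩
      refine ⟨h1, h2, ?_⟩
      have : (w x : OnePoint ℂ_[p]) ∈ G x :=
        ⟨coe_mem_projLine.mpr (hS.pair N x h1).mem, by
          rw [projDist_self]; exact (zpow_neg_pos _).le⟩
      rw [h3] at this
      exact this.2
    · rintro ⟨h1, h2, h3⟩
      exact ⟨⟨h1, h2, hP u hu1 x h1 hu2 h2 h3 hu3⟩, (closedDisc_eq_of_projDist_le _ h3).symm⟩
  rw [hset]
  have h0 := hS.fibre N u hu1 hu2 Q hQ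
  rw [← sub_zero (∑ x ∈ _, _), ← h0, ← Finset.sum_sub_distrib]
  refine norm_sum_le_of_forall hB fun x hx => ?_
  rw [Finset.mem_filter] at hx
  rw [← mul_sub]
  exact (norm_intCast_mul_le _ _).trans (hQd x hx.1 hx.2.1 hx.2.2)

end IsDegreeZeroSystem

end System


/-! ### Limits of moments. -/

section Moments

variable {p : ℕ} [Fact p.Prime] {ι : Type*}
variable {h : ℕ} {w w' : ι → ℂ_[p]} {c : ι → ℤ} {S : ℕ → Finset ι}

open Classical in
/-- `M` is the limit of the moments of the divisor `S N` with respect to a sequence of test functions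
with Taylor coefficients `d i x` at `w x`, restricted to the `x` with `P x`. -/
structure IsMomentLimit (h : ℕ) (w w' : ι → ℂ_[p]) (c : ι → ℤ) (S : ℕ → Finset ι) (P : ι → Prop)
    (d : ℕ → ι → ℕ → ℂ_[p]) (l : ℕ) (θ : ℝ) (κ : ℕ → ℝ) (A : ℝ) (M : ℕ → ℂ_[p]) : Prop where
  nonneg : 0 ≤ A
  norm_sub_le : ∀ N, l ≤ N → ∀ i,
    ‖∑ x ∈ S N with P x, (c x : ℂ_[p]) * jetFun h (w x - w' x) (d i x) - M i‖ ≤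
      κ i * (A * θ ^ i) * (p : ℝ) ^ (-(N : ℤ))
  norm_le : ∀ i, ‖M i‖ ≤ A * θ ^ i

open Classical in
-- Passing from level N to N + 1 adds only points of level exactly N + 1, so bounds for single
-- levels are bounds for increments. The factor κ i records moments that are already stationary from
-- level l on (κ i = 0).
theorem IsDegreeZeroSystem.exists_isMomentLimit (hS : IsDegreeZeroSystem h w w' c S) {P : ι → Prop}
    {d : ℕ → ι → ℕ → ℂ_[p]} {l : ℕ} {θ : ℝ} (hθ : 0 < θ) {κ : ℕ → ℝ} (hκ : ∀ i, 0 ≤ κ i)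
    (hκ1 : ∀ i, κ i ≤ 1) {A A₀ : ℝ} (hA : 0 ≤ A)
    (hinc : ∀ N, l ≤ N → ∀ i,
      ‖∑ x ∈ S (N + 1) with treeRadius (w x) (w' x) = (p : ℝ) ^ (-((N + 1 : ℕ) : ℤ)) ∧ P x,
        (c x : ℂ_[p]) * jetFun h (w x - w' x) (d i x)‖ ≤ κ i * (A * θ ^ i) * (p : ℝ) ^ (-(N : ℤ)))
    (hbase : ∀ i, ‖∑ x ∈ S l with P x, (c x : ℂ_[p]) * jetFun h (w x - w' x) (d i x)‖ ≤
      A₀ * θ ^ i) :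
    ∃ A' M, IsMomentLimit h w w' c S P d l θ κ A' M := by
  have h1 : ∀ i, ∃ y, ∀ N, l ≤ N →
      ‖∑ x ∈ S N with P x, (c x : ℂ_[p]) * jetFun h (w x - w' x) (d i x) - y‖ ≤
        κ i * (A * θ ^ i) * (p : ℝ) ^ (-(N : ℤ)) := by
    intro i
    refine exists_limit_of_increments (x := fun N => ∑ x ∈ S N with P x,
      (c x : ℂ_[p]) * jetFun h (w x - w' x) (d i x))
      (mul_nonneg (hκ i) (by positivity)) fun N hN => ?_
    rw [hS.sum_succ N P, add_sub_cancel_left]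
    exact hinc N hN i
  choose M hM using h1
  have hp1 : (p : ℝ) ^ (-(l : ℤ)) ≤ 1 := by
    rw [← zpow_zero (p : ℝ)]
    exact zpow_le_zpow_right₀ one_lt_prime.le (by omega)
  refine ⟨max A A₀, M, le_max_of_le_left hA, fun N hN i => (hM i N hN).trans ?_, fun i => ?_⟩
  · have := (zpow_neg_pos (p := p) N).le
    have := hκ i
    gcongr
    exact le_max_left _ _
  · have h2 := hM i l le_rfl
    rw [← sub_sub_cancel (∑ x ∈ S l with P x, (c x : ℂ_[p]) * jetFun h (w x - w' x) (d i x)) (M i)]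
    refine (norm_sub_le_max' _ _).trans (max_le ((hbase i).trans ?_) (h2.trans ?_))
    · gcongr
      exact le_max_right _ _
    · calc κ i * (A * θ ^ i) * (p : ℝ) ^ (-(l : ℤ)) ≤ 1 * (A * θ ^ i) * 1 := by
            have := hκ i
            gcongr
            exact hκ1 i
        _ = A * θ ^ i := by ring
        _ ≤ _ := by
          gcongr
          exact le_max_left _ _

open Classical in
-- Expand the test function term by term; each term errs by its coefficient times the error of its
-- moment. Where κ i = 0 there is no error, so `B` need not control those coefficients.
theorem IsMomentLimit.norm_sum_sub_le {P : ι → Prop} {d : ℕ → ι → ℕ → ℂ_[p]} {l : ℕ} {θ : ℝ}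
    {κ : ℕ → ℝ} {A : ℝ} {M : ℕ → ℂ_[p]} (hM : IsMomentLimit h w w' c S P d l θ κ A M)
    {e : ℕ → ℂ_[p]} (he : Tendsto (fun i => ‖e i‖ * θ ^ i) atTop (𝓝 0)) {B : ℝ} (hB : 0 ≤ B)
    (heB : ∀ i, κ i * (‖e i‖ * θ ^ i) ≤ B) {D : ι → ℕ → ℂ_[p]}
    (hD : ∀ N, ∀ x ∈ S N, P x → ∀ j, HasSum (fun i => e i * d i x j) (D x j)) :
    Summable (fun i => M i * e i) ∧ ∀ N, l ≤ N →
      ‖∑ x ∈ S N with P x, (c x : ℂ_[p]) * jetFun h (w x - w' x) (D x) - ∑' i, M i * e i‖ ≤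
        A * B * (p : ℝ) ^ (-(N : ℤ)) := by
  have hA := hM.nonneg
  have hsum : Summable (fun i => M i * e i) := by
    refine summable_of_norm_tendsto (u := fun i => A * (‖e i‖ * θ ^ i))
      (by simpa using he.const_mul A) fun i => ?_
    rw [norm_mul]
    calc _ ≤ (A * θ ^ i) * ‖e i‖ := by
          gcongr
          exact hM.norm_le i
      _ = _ := by ring
  refine ⟨hsum, fun N hN => ?_⟩
  have h1 : HasSum (fun i => ∑ x ∈ S N with P x,
      (c x : ℂ_[p]) * (e i * jetFun h (w x - w' x) (d i x)))
      (∑ x ∈ S N with P x, (c x : ℂ_[p]) * jetFun h (w x - w' x) (D x)) := by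
    refine hasSum_sum fun x hx => ?_
    rw [Finset.mem_filter] at hx
    exact (hasSum_jetFun (hD N x hx.1 hx.2)).mul_left _
  have hp := (zpow_neg_pos (p := p) N).le
  refine norm_hasSum_le (h1.sub hsum.hasSum) (by positivity) fun i => ?_
  have h2 : ∑ x ∈ S N with P x, (c x : ℂ_[p]) * (e i * jetFun h (w x - w' x) (d i x)) - M i * e i =
      e i * (∑ x ∈ S N with P x, (c x : ℂ_[p]) * jetFun h (w x - w' x) (d i x) - M i) := by
    rw [mul_sub, Finset.mul_sum, mul_comm (M i)]
    congr 1
    exact Finset.sum_congr rfl fun x _ => by ring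
  rw [h2, norm_mul]
  calc _ ≤ ‖e i‖ * (κ i * (A * θ ^ i) * (p : ℝ) ^ (-(N : ℤ))) := by
        gcongr
        exact hM.norm_sub_le N hN i
    _ = A * (κ i * (‖e i‖ * θ ^ i)) * (p : ℝ) ^ (-(N : ℤ)) := by ring
    _ ≤ _ := by
      gcongr
      exact heB i

theorem norm_jetFun_le_sum {δ : ℂ_[p]} {d : ℕ → ℂ_[p]} {B s : ℝ} (hd : ∀ j, ‖d j‖ ≤ B * s ^ j) :
    ‖jetFun h δ d‖ ≤ (∑ j ∈ Finset.range (h + 1), ‖jetWeight h δ j‖ * s ^ j) * B := by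
  rw [jetFun, Finset.sum_mul]
  refine (norm_sum_le _ _).trans (Finset.sum_le_sum fun j _ => ?_)
  rw [norm_mul]
  calc _ ≤ ‖jetWeight h δ j‖ * (B * s ^ j) := by
        gcongr
        exact hd j
    _ = _ := by ring

open Classical in
-- Serves the starting level only, where finitely many points occur and a crude constant suffices;
-- what matters is the exponential growth in i.
theorem exists_norm_sum_le (T : Finset ι) {P : ι → Prop} (d : ℕ → ι → ℕ → ℂ_[p]) {θ s : ℝ}
    (hθ : 0 < θ) (hs : 0 < s) (hd : ∀ i, ∀ x ∈ T, P x → ∀ j, ‖d i x j‖ ≤ θ ^ i * s ^ j) :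
    ∃ A₀ : ℝ, ∀ i, ‖∑ x ∈ T with P x, (c x : ℂ_[p]) * jetFun h (w x - w' x) (d i x)‖ ≤
      A₀ * θ ^ i := by
  refine ⟨∑ x ∈ T, ∑ j ∈ Finset.range (h + 1), ‖jetWeight h (w x - w' x) j‖ * s ^ j, fun i => ?_⟩
  have h0 : ∀ x, 0 ≤ ∑ j ∈ Finset.range (h + 1), ‖jetWeight h (w x - w' x) j‖ * s ^ j :=
    fun x => Finset.sum_nonneg fun j _ => by positivity
  refine norm_sum_le_of_forall (mul_nonneg (Finset.sum_nonneg fun x _ => h0 x) (by positivity))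
    fun x hx => ?_
  rw [Finset.mem_filter] at hx
  refine (norm_intCast_mul_le _ _).trans ((norm_jetFun_le_sum (hd i x hx.1 hx.2)).trans ?_)
  gcongr
  exact Finset.single_le_sum
    (f := fun x => ∑ j ∈ Finset.range (h + 1), ‖jetWeight h (w x - w' x) j‖ * s ^ j)
    (fun x _ => h0 x) hx.1

end Moments

/-! ### Projective discs in affine coordinates. -/

section Discs

variable {p : ℕ} [Fact p.Prime]

/-- On a projective disc that avoids ∞ the quantity max(1, ‖·‖) is constant, so the disc is affine
with radius scaled by its square. -/
theorem projDist_le_imp {x y : ℂ_[p]} {ε : ℝ} (h : projDist (x : OnePoint ℂ_[p]) y ≤ ε)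
    (hε : ε < projDist OnePoint.infty (x : OnePoint ℂ_[p])) :
    max 1 ‖y‖ = max 1 ‖x‖ ∧ ‖y - x‖ ≤ ε * max 1 ‖x‖ ^ 2 := by
  have hx := max_one_pos x
  have hy := max_one_pos y
  have h1 : projDist OnePoint.infty (y : OnePoint ℂ_[p]) =
      projDist OnePoint.infty (x : OnePoint ℂ_[p]) :=
    projDist_eq_of_lt (h.trans_lt hε)
  rw [projDist_infty_coe, projDist_infty_coe, one_div, one_div, inv_inj] at h1
  refine ⟨h1, ?_⟩
  rw [projDist_coe_coe, h1, div_le_iff₀ (by positivity)] at h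
  rw [norm_sub_rev, sq]
  exact h

/-- The radius of the disc of `P^1` around `a` cut out by `projDist ≤ p ^ (-l)`, if that disc does not
contain `∞`. -/
noncomputable def discRadius (l : ℕ) (a : ℂ_[p]) : ℝ := (p : ℝ) ^ (-(l : ℤ)) * max 1 ‖a‖ ^ 2

theorem discRadius_pos (l : ℕ) (a : ℂ_[p]) : 0 < discRadius l a :=
  mul_pos (zpow_neg_pos _) (pow_pos (max_one_pos a) 2)

theorem zpow_neg_lt_one {l : ℕ} (hl : 0 < l) : (p : ℝ) ^ (-(l : ℤ)) < 1 := by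
  rw [← zpow_zero (p : ℝ)]
  exact zpow_lt_zpow_right₀ one_lt_prime (by omega)

theorem projDist_infty_le_iff {l : ℕ} (hl : 0 < l) {w : ℂ_[p]} :
    projDist OnePoint.infty (w : OnePoint ℂ_[p]) ≤ (p : ℝ) ^ (-(l : ℤ)) ↔ (p : ℝ) ^ l ≤ ‖w‖ := by
  have hp : (1 : ℝ) < (p : ℝ) ^ l := one_lt_pow₀ one_lt_prime (by omega)
  rw [projDist_infty_coe, zpow_neg, zpow_natCast, one_div,
    inv_le_inv₀ (max_one_pos w) (by linarith), le_max_iff]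
  constructor
  · rintro (h | h)
    · exact absurd h (not_le.mpr hp)
    · exact h
  · exact Or.inr

theorem norm_powJet_le {a w : ℂ_[p]} {ρ : ℝ} (hρ : 0 < ρ) (hw : ‖w - a‖ ≤ ρ) (i j : ℕ) :
    ‖powJet a i w j‖ ≤ ρ ^ i * (ρ⁻¹) ^ j := by
  rw [inv_pow, ← div_eq_mul_inv]
  exact norm_pow_sub_mul_choose_le hw i j hρ

theorem norm_invPowJet_le (w : ℂ_[p]) (i j : ℕ) :
    ‖invPowJet i w j‖ ≤ (‖w‖ ^ (j + i + 1))⁻¹ := by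
  rw [invPowJet, norm_mul, norm_mul, norm_inv, norm_pow w]
  have h2 : ‖((-1 : ℂ_[p]) ^ j)‖ = 1 := by simp
  rw [h2, one_mul]
  exact mul_le_of_le_one_left (by positivity) (norm_natCast_le_one' _)

theorem tendsto_norm_powJet (a u : ℂ_[p]) (i : ℕ) (δ : ℝ) :
    Tendsto (fun k => ‖powJet a i u k‖ * δ ^ k) atTop (𝓝 0) := by
  refine tendsto_const_nhds.congr' ?_
  filter_upwards [eventually_gt_atTop i] with k hk
  rw [powJet, Nat.choose_eq_zero_of_lt hk, Nat.cast_zero, mul_zero, norm_zero, zero_mul]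

end Discs

/-! ### The contribution of a single level to the moments. -/

section Increments

variable {p : ℕ} [Fact p.Prime] {ι : Type*}
variable {h : ℕ} {w w' : ι → ℂ_[p]} {c : ι → ℤ} {S : ℕ → Finset ι}

open Classical in
theorem IsDegreeZeroSystem.sum_powJet_eq_zero (hS : IsDegreeZeroSystem h w w' c S) {l N : ℕ}
    (hN : l ≤ N) (a : ℂ_[p]) {i : ℕ} (hi : i ≤ 2 * h) :
    ∑ x ∈ S N with treeRadius (w x) (w' x) = (p : ℝ) ^ (-(N : ℤ)) ∧
        projDist (a : OnePoint ℂ_[p]) (w x) ≤ (p : ℝ) ^ (-(l : ℤ)),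
      (c x : ℂ_[p]) * jetFun h (w x - w' x) (powJet a i (w x)) = 0 := by
  rw [← norm_le_zero_iff]
  refine hS.norm_sum_level_le N _ ?_ (fun x => powJet a i (w x)) le_rfl ?_
  · intro u _ x _ _ _ h1 h2
    exact (projDist_le_max _ _ (w u : OnePoint ℂ_[p])).trans
      (max_le h2 (h1.trans (zpow_neg_le_iff.mpr hN)))
  · intro u _ _ _
    refine ⟨(X - C a) ^ i, ?_, fun x _ _ _ => ?_⟩
    · rw [natDegree_pow, natDegree_X_sub_C, mul_one]
      exact hi
    · have : (fun j => (taylor (w x) ((X - C a) ^ i)).coeff j) = powJet a i (w x) :=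
        funext fun j => taylor_coeff_X_sub_C_pow _ _ _ _
      rw [this, sub_self, norm_zero]

open Classical in
-- Subtract the Taylor polynomial of (t - a)^i of degree 2h at one point of each group. With q the
-- ratio of the group's radius to the radius ρ of the ambient disc, the remainder is at most ρ^i
-- q^(2h+1) and the functional costs (qρ)^(-h).
theorem IsDegreeZeroSystem.norm_sum_powJet_le (hS : IsDegreeZeroSystem h w w' c S) {l N : ℕ}
    (hN : l ≤ N) {a : ℂ_[p]}
    (ha : (p : ℝ) ^ (-(l : ℤ)) < projDist OnePoint.infty (a : OnePoint ℂ_[p])) (i : ℕ) :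
    ‖∑ x ∈ S N with treeRadius (w x) (w' x) = (p : ℝ) ^ (-(N : ℤ)) ∧
        projDist (a : OnePoint ℂ_[p]) (w x) ≤ (p : ℝ) ^ (-(l : ℤ)),
      (c x : ℂ_[p]) * jetFun h (w x - w' x) (powJet a i (w x))‖ ≤
      jetBound p h / discRadius l a ^ h * (p : ℝ) ^ l * discRadius l a ^ i *
        (p : ℝ) ^ (-(N : ℤ)) := by
  have hC := jetBound_nonneg (p := p) h
  set ρ := discRadius l a with hρ
  have hρ0 : 0 < ρ := discRadius_pos l a
  have hpN := zpow_neg_pos (p := p) N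
  have hNl : (p : ℝ) ^ (-(N : ℤ)) ≤ (p : ℝ) ^ (-(l : ℤ)) := zpow_neg_le_iff.mpr hN
  refine hS.norm_sum_level_le N _ ?_ (fun x => powJet a i (w x)) (by positivity) ?_
  · intro u _ x _ _ _ h1 h2
    exact (projDist_le_max _ _ (w u : OnePoint ℂ_[p])).trans (max_le h2 (h1.trans hNl))
  intro u hu hut hua
  set δ := (p : ℝ) ^ (-(N : ℤ)) * max 1 ‖a‖ ^ 2 with hδ
  obtain ⟨q, hq⟩ : ∃ q, q = (p : ℝ) ^ (-(N : ℤ)) * (p : ℝ) ^ l := ⟨_, rfl⟩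
  have hδq : δ = q * ρ := by
    rw [hδ, hq, hρ, discRadius, zpow_neg (p : ℝ) l, zpow_natCast]
    have : (p : ℝ) ^ l ≠ 0 := pow_ne_zero _ prime_pos.ne'
    field_simp
  have hq0 : 0 < q := hq ▸ mul_pos hpN (pow_pos prime_pos _)
  have hq1 : q ≤ 1 := by
    rw [hq, ← le_div_iff₀ (pow_pos prime_pos _), one_div, ← zpow_natCast, ← zpow_neg]
    exact hNl
  obtain ⟨hum, hur⟩ := projDist_le_imp hua ha
  have hub : (p : ℝ) ^ (-(N : ℤ)) < projDist OnePoint.infty (w u : OnePoint ℂ_[p]) := by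
    rw [projDist_infty_coe, hum, ← projDist_infty_coe]
    exact hNl.trans_lt ha
  refine ⟨_, natDegree_sum_pow_le (w u) (powJet a i (w u)) (2 * h), fun x hx hxt hxu => ?_⟩
  obtain ⟨hxm, hxr⟩ := projDist_le_imp hxu hub
  have hpair := hS.pair N x hx
  have hxδ : ‖w x - w' x‖ = δ := by rw [hpair.norm_sub_eq, hxt, hxm, hum]
  refine (norm_jetFun_sub_taylor_le hpair.norm_sub_pos le_rfl
    (g := fun t => (t - a) ^ i) (r := 1) (B := ρ ^ i * q ^ (2 * h + 1)) ?_ zero_lt_one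
    (tendsto_norm_powJet _ _ _ _) (expandsAt_pow a (w u) i _) (expandsAt_pow a (w x) i _)
    (by positivity) fun k hk => ?_).trans ?_
  · rw [hxδ, hδ, ← hum]
    exact hxr
  · rw [hxδ, hδq]
    calc _ ≤ ρ ^ i * (ρ⁻¹) ^ k * (q * ρ) ^ k := by
          gcongr
          exact norm_powJet_le hρ0 hur i k
      _ = ρ ^ i * q ^ k := by
        rw [mul_pow, inv_pow]
        field_simp
      _ ≤ _ := by
        gcongr ρ ^ i * ?_
        exact pow_le_pow_of_le_one hq0.le hq1 hk
  · rw [hxδ, hδq]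
    calc jetBound p h * (ρ ^ i * q ^ (2 * h + 1) / (q * ρ) ^ h)
        = jetBound p h / ρ ^ h * ρ ^ i * q ^ (h + 1) := by
          rw [show 2 * h + 1 = h + (h + 1) by ring, pow_add q h, mul_pow]
          field_simp
      -- A factor q^(h+1) is available; a single q, which equals p^(l-N), already gives convergence.
      _ ≤ jetBound p h / ρ ^ h * ρ ^ i * q := by
        gcongr
        exact pow_le_of_le_one hq0.le hq1 (Nat.succ_ne_zero h)
      _ = _ := by
        rw [hq]
        ring

open Classical in
-- Groups not containing ∞ in their disc are treated by Taylor expansion of t^(-i-1), as on finite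
-- discs. The group around ∞ is estimated directly, because negative powers of t are already small
-- there.
theorem IsDegreeZeroSystem.norm_sum_invPowJet_le (hS : IsDegreeZeroSystem h w w' c S) {l N : ℕ}
    (hl : 0 < l) (hN : l ≤ N) (i : ℕ) :
    ‖∑ x ∈ S N with treeRadius (w x) (w' x) = (p : ℝ) ^ (-(N : ℤ)) ∧
        projDist OnePoint.infty (w x : OnePoint ℂ_[p]) ≤ (p : ℝ) ^ (-(l : ℤ)),
      (c x : ℂ_[p]) * jetFun h (w x - w' x) (invPowJet i (w x))‖ ≤
      jetBound p h * ((p : ℝ) ^ (-(l : ℤ))) ^ i * (p : ℝ) ^ (-(N : ℤ)) := by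
  have hC := jetBound_nonneg (p := p) h
  have hpN := zpow_neg_pos (p := p) N
  have hpl := zpow_neg_pos (p := p) l
  have hNl : (p : ℝ) ^ (-(N : ℤ)) ≤ (p : ℝ) ^ (-(l : ℤ)) := zpow_neg_le_iff.mpr hN
  have hpow : (1 : ℝ) < (p : ℝ) ^ l := one_lt_pow₀ one_lt_prime (by omega)
  refine hS.norm_sum_level_le N _ ?_ (fun x => invPowJet i (w x)) (by positivity) ?_
  · intro u _ x _ _ _ h1 h2
    exact (projDist_le_max _ _ (w u : OnePoint ℂ_[p])).trans (max_le h2 (h1.trans hNl))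
  intro u hu hut hua
  have hul := (projDist_infty_le_iff hl).mp hua
  have hu1 : 1 < ‖w u‖ := hpow.trans_le hul
  have hu0 : 0 < ‖w u‖ := zero_lt_one.trans hu1
  have hum : max 1 ‖w u‖ = ‖w u‖ := max_eq_right hu1.le
  obtain ⟨q, hq⟩ : ∃ q, q = (p : ℝ) ^ (-(N : ℤ)) * ‖w u‖ := ⟨_, rfl⟩
  have hq0 : 0 < q := by
    rw [hq]
    positivity
  -- Common end of both cases, with y the norm of the points and q = p^(-N) y; q < 1 away from ∞ and
  -- q = 1 in the group of ∞.
  have hfinal : ∀ y q : ℝ, (p : ℝ) ^ l ≤ y → q = (p : ℝ) ^ (-(N : ℤ)) * y → q ≤ 1 →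
      (y ^ (i + 1))⁻¹ * q ^ (h + 1) / y ^ h ≤
      ((p : ℝ) ^ (-(l : ℤ))) ^ i * (p : ℝ) ^ (-(N : ℤ)) := by
    intro y q hy hqy hq1
    have hy1 : 1 < y := hpow.trans_le hy
    have hy0 : 0 < y := zero_lt_one.trans hy1
    have hq0 : 0 ≤ q := by
      rw [hqy]
      positivity
    have hinv : (y ^ i)⁻¹ ≤ ((p : ℝ) ^ (-(l : ℤ))) ^ i := by
      rw [← inv_pow, zpow_neg, zpow_natCast]
      gcongr
    calc (y ^ (i + 1))⁻¹ * q ^ (h + 1) / y ^ h ≤ (y ^ (i + 1))⁻¹ * q / 1 := by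
          gcongr
          · exact pow_le_of_le_one hq0 hq1 (Nat.succ_ne_zero h)
          · exact one_le_pow₀ hy1.le
      _ = (y ^ i)⁻¹ * (p : ℝ) ^ (-(N : ℤ)) := by
        rw [hqy, pow_succ]
        field_simp
      _ ≤ _ := by gcongr
  rcases lt_or_ge q 1 with hq1 | hq1
  · have hub : (p : ℝ) ^ (-(N : ℤ)) < projDist OnePoint.infty (w u : OnePoint ℂ_[p]) := by
      rw [projDist_infty_coe, hum, lt_div_iff₀ hu0]
      exact hq ▸ hq1
    refine ⟨_, natDegree_sum_pow_le (w u) (invPowJet i (w u)) (2 * h), fun x hx hxt hxu => ?_⟩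
    obtain ⟨hxm, hxr⟩ := projDist_le_imp hxu hub
    have hpair := hS.pair N x hx
    have hxδ : ‖w x - w' x‖ = q * ‖w u‖ := by
      rw [hpair.norm_sub_eq, hxt, hxm, hum, hq]
      ring
    have hxn : ‖w x‖ = ‖w u‖ := by
      rw [hum] at hxm
      rcases max_choice 1 ‖w x‖ with h1 | h1
      · rw [h1] at hxm
        exact absurd hxm hu1.ne
      · rw [← h1, hxm]
    have hb : ∀ k, ‖invPowJet i (w u) k‖ * ‖w x - w' x‖ ^ k ≤ (‖w u‖ ^ (i + 1))⁻¹ * q ^ k := by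
      intro k
      rw [hxδ]
      calc _ ≤ (‖w u‖ ^ (k + i + 1))⁻¹ * (q * ‖w u‖) ^ k := by
            gcongr
            exact norm_invPowJet_le _ _ _
        _ = _ := by
          rw [add_assoc, pow_add, mul_pow]
          field_simp
    refine (norm_jetFun_sub_taylor_le hpair.norm_sub_pos le_rfl
      (g := fun t => (t ^ (i + 1))⁻¹) (r := ‖w u‖ / 2)
      (B := (‖w u‖ ^ (i + 1))⁻¹ * q ^ (2 * h + 1)) ?_ (by positivity)
      ?_ (expandsAt_inv_pow (w u) i ?_) (expandsAt_inv_pow (w x) i ?_)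
      (by positivity) fun k hk => (hb k).trans ?_).trans ?_
    · rw [hxδ, hq, mul_assoc, ← sq, ← hum]
      exact hxr
    · refine squeeze_zero (fun k => by positivity) hb ?_
      simpa using (tendsto_pow_atTop_nhds_zero_of_lt_one hq0.le hq1).const_mul
        ((‖w u‖ ^ (i + 1))⁻¹)
    · rw [hxδ]
      exact mul_lt_of_lt_one_left hu0 hq1
    · rw [hxn]
      linarith
    · gcongr ?_ * ?_
      exact pow_le_pow_of_le_one hq0.le hq1.le hk
    · rw [hxδ, mul_assoc (jetBound p h)]
      gcongr ?_ * ?_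
      refine le_trans (le_of_eq ?_) (hfinal _ q hul hq hq1.le)
      rw [show 2 * h + 1 = h + (h + 1) by ring, pow_add q h, mul_pow]
      field_simp
  · have huN : projDist OnePoint.infty (w u : OnePoint ℂ_[p]) ≤ (p : ℝ) ^ (-(N : ℤ)) := by
      rw [projDist_infty_coe, hum, div_le_iff₀ hu0]
      exact hq ▸ hq1
    refine ⟨0, by simp, fun x hx hxt hxu => ?_⟩
    have hpair := hS.pair N x hx
    have hxN := (projDist_infty_le_iff (hl.trans_le hN)).mp
      ((projDist_le_max _ _ (w u : OnePoint ℂ_[p])).trans (max_le huN hxu))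
    have hxl : (p : ℝ) ^ l ≤ ‖w x‖ := (pow_le_pow_right₀ one_lt_prime.le hN).trans hxN
    have hx0 : 0 < ‖w x‖ := (zero_lt_one.trans hpow).trans_le hxl
    have hxδ : ‖w x - w' x‖ = (p : ℝ) ^ (-(N : ℤ)) * ‖w x‖ * ‖w x‖ := by
      rw [hpair.norm_sub_eq, hxt, max_eq_right (hpow.trans_le hxl).le]
      ring
    -- A point of level N in the disc around ∞ has norm exactly p^N: the level gives |w - w'| =
    -- p^(-N)|w|², and |w - w'| ≤ |w|.
    have hx1 : (p : ℝ) ^ (-(N : ℤ)) * ‖w x‖ = 1 := by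
      apply le_antisymm
      · exact le_of_mul_le_mul_right (by rw [← hxδ, one_mul]; exact hpair.norm_sub_le) hx0
      · rw [zpow_neg, zpow_natCast, ← div_eq_inv_mul, one_le_div (pow_pos prime_pos _)]
        exact hxN
    rw [hx1, one_mul] at hxδ
    have hz : jetFun h (w x - w' x) (fun j => (taylor (w x) (0 : ℂ_[p][X])).coeff j) = 0 := by
      simp [jetFun]
    rw [hz, sub_zero]
    refine (norm_jetFun_le (norm_pos_iff.mp hpair.norm_sub_pos) (B := (‖w x‖ ^ (i + 1))⁻¹)
      (by positivity) fun j _ => ?_).trans ?_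
    · rw [hxδ]
      calc _ ≤ (‖w x‖ ^ (j + i + 1))⁻¹ * ‖w x‖ ^ j := by
            gcongr
            exact norm_invPowJet_le _ _ _
        _ = _ := by
          rw [add_assoc, pow_add]
          field_simp
    · rw [hxδ, mul_assoc (jetBound p h)]
      gcongr ?_ * ?_
      refine le_trans (le_of_eq ?_) (hfinal _ 1 hxl hx1.symm le_rfl)
      rw [one_pow, mul_one]

end Increments


/-! ### Partition of P^1(K) into discs. -/

section Representatives

variable {p : ℕ} [Fact p.Prime] {F : IntermediateField ℚ_[p] ℂ_[p]} {m : ℕ} {R : Finset ℂ_[p]}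

/-- The point ∞ represents its own class, so by uniqueness a finite representative cannot lie in
that class. -/
theorem IsReps.lt_projDist_infty (hR : IsReps F m R) {a : ℂ_[p]} (ha : a ∈ R) :
    (p : ℝ) ^ (-(m : ℤ)) < projDist OnePoint.infty (a : OnePoint ℂ_[p]) := by
  by_contra! h
  obtain ⟨y, -, hy⟩ := hR.2 a (coe_mem_projLine.mpr (hR.1 a ha))
  have h1 := hy OnePoint.infty ⟨Or.inl rfl, h⟩
  have h2 := hy a ⟨Or.inr ⟨a, ha, rfl⟩, by rw [projDist_self]; exact (zpow_neg_pos _).le⟩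
  exact OnePoint.coe_ne_infty a (h2.trans h1.symm)

open Classical in
theorem IsReps.sum_eq {ι : Type*} (hR : IsReps F m R) (T : Finset ι) {w : ι → ℂ_[p]}
    (hw : ∀ x ∈ T, w x ∈ F) (f : ι → ℂ_[p]) :
    ∑ x ∈ T, f x = ∑ x ∈ T with projDist OnePoint.infty (w x : OnePoint ℂ_[p]) ≤
        (p : ℝ) ^ (-(m : ℤ)), f x +
      ∑ a ∈ R, ∑ x ∈ T with projDist (a : OnePoint ℂ_[p]) (w x) ≤ (p : ℝ) ^ (-(m : ℤ)), f x := by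
  simp only [Finset.sum_filter]
  rw [Finset.sum_comm, ← Finset.sum_add_distrib]
  refine Finset.sum_congr rfl fun x hx => ?_
  obtain ⟨y, ⟨hy1, hy2⟩, hy⟩ := hR.2 (w x) (coe_mem_projLine.mpr (hw x hx))
  rcases hy1 with rfl | ⟨a, ha, rfl⟩
  · rw [if_pos hy2, Finset.sum_eq_zero, add_zero]
    intro a ha
    refine if_neg fun h => ?_
    exact OnePoint.coe_ne_infty a (hy a ⟨Or.inr ⟨a, ha, rfl⟩, h⟩)
  · rw [if_neg, zero_add, Finset.sum_eq_single_of_mem a ha, if_pos hy2]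
    · intro b hb hba
      refine if_neg fun h => hba ?_
      exact OnePoint.coe_injective (hy b ⟨Or.inr ⟨b, hb, rfl⟩, h⟩)
    · intro h
      exact OnePoint.coe_ne_infty a (hy OnePoint.infty ⟨Or.inl rfl, h⟩).symm

end Representatives

/-! ### Evaluating limits of degree-zero systems from moments and local expansions. -/

section Approximation

variable {p : ℕ} [Fact p.Prime]

/-- Power series expansions of `g` on the discs around the points of `R` and `∞` modulo `p ^ m`, up
to terms of degree at most `2 * h` bounded by `B` on those discs. -/
structure BoundedExpansion (h m : ℕ) (R : Finset ℂ_[p]) (g : ℂ_[p] → ℂ_[p]) (e : ℂ_[p] → ℕ → ℂ_[p])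
    (eInf : ℕ → ℂ_[p]) (B : ℝ) : Prop where
  nonneg : 0 ≤ B
  expandsAt : ∀ a ∈ R, ExpandsAt g a (discRadius m a) (e a)
  tendsto : ∀ a ∈ R, Tendsto (fun i => ‖e a i‖ * discRadius m a ^ i) atTop (𝓝 0)
  bound : ∀ a ∈ R, ∀ i, 2 * h < i → ‖e a i‖ * discRadius m a ^ i ≤ B
  hasSum_infty : ∀ t, (p : ℝ) ^ m ≤ ‖t‖ → HasSum (fun i => eInf i * (t ^ (i + 1))⁻¹) (g t)
  tendsto_infty : Tendsto (fun i => ‖eInf i‖ * ((p : ℝ) ^ (-(m : ℤ))) ^ i) atTop (𝓝 0)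
  bound_infty : ∀ i, ‖eInf i‖ * ((p : ℝ) ^ (-(m : ℤ))) ^ i ≤ B

variable {ι : Type*} {h : ℕ} {w w' : ι → ℂ_[p]} {c : ι → ℤ} {S : ℕ → Finset ι}

theorem zpow_neg_succ_le (N : ℕ) : (p : ℝ) ^ (-((N + 1 : ℕ) : ℤ)) ≤ (p : ℝ) ^ (-(N : ℤ)) :=
  zpow_neg_le_iff.mpr (Nat.le_succ N)

open Classical in
/-- The moments of a degree-zero system on a disc which does not contain `∞`. -/
theorem IsDegreeZeroSystem.exists_moments (hS : IsDegreeZeroSystem h w w' c S) (l : ℕ) {a : ℂ_[p]}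
    (ha : (p : ℝ) ^ (-((l + 1 : ℕ) : ℤ)) < projDist OnePoint.infty (a : OnePoint ℂ_[p])) :
    ∃ A M, IsMomentLimit h w w' c S
      (fun x => projDist (a : OnePoint ℂ_[p]) (w x) ≤ (p : ℝ) ^ (-((l + 1 : ℕ) : ℤ)))
      (fun i x => powJet a i (w x)) l (discRadius (l + 1) a) (fun i => if i ≤ 2 * h then 0 else 1)
      A M := by
  have hρ := discRadius_pos (l + 1) a
  have hC := jetBound_nonneg (p := p) h
  obtain ⟨A₀, hA₀⟩ := exists_norm_sum_le (h := h) (c := c) (w := w) (w' := w')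
    (P := fun x => projDist (a : OnePoint ℂ_[p]) (w x) ≤ (p : ℝ) ^ (-((l + 1 : ℕ) : ℤ)))
    (S l) (fun i x => powJet a i (w x)) hρ (inv_pos.mpr hρ)
    (fun i x _ hx j => norm_powJet_le hρ (projDist_le_imp hx ha).2 i j)
  have hp0 : (0 : ℝ) < (p : ℝ) ^ (l + 1) := pow_pos prime_pos _
  refine hS.exists_isMomentLimit hρ (fun i => by split_ifs <;> norm_num)
    (fun i => by split_ifs <;> norm_num)
    (A := jetBound p h / discRadius (l + 1) a ^ h * (p : ℝ) ^ (l + 1)) (by positivity)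
    (fun N hN i => ?_) hA₀
  -- Moments of degree at most 2h do not change beyond level l: the points of each later level in
  -- the disc form complete groups, on which such polynomials sum to 0.
  split_ifs with hi
  · rw [zero_mul, zero_mul, hS.sum_powJet_eq_zero (by omega) a hi, norm_zero]
  · rw [one_mul]
    exact (hS.norm_sum_powJet_le (by omega) ha i).trans
      (mul_le_mul_of_nonneg_left (zpow_neg_succ_le N) (by positivity))

open Classical in
/-- The moments of a degree-zero system on a disc around `∞`. -/
theorem IsDegreeZeroSystem.exists_moments_infty (hS : IsDegreeZeroSystem h w w' c S) (l : ℕ) :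
    ∃ A M, IsMomentLimit h w w' c S
      (fun x => projDist OnePoint.infty (w x : OnePoint ℂ_[p]) ≤ (p : ℝ) ^ (-((l + 1 : ℕ) : ℤ)))
      (fun i x => invPowJet i (w x)) l ((p : ℝ) ^ (-((l + 1 : ℕ) : ℤ))) (fun _ => 1) A M := by
  have hC := jetBound_nonneg (p := p) h
  have hp1 : (1 : ℝ) ≤ (p : ℝ) ^ (l + 1) := one_le_pow₀ one_lt_prime.le
  obtain ⟨A₀, hA₀⟩ := exists_norm_sum_le (h := h) (c := c) (w := w) (w' := w')
    (P := fun x => projDist OnePoint.infty (w x : OnePoint ℂ_[p]) ≤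
      (p : ℝ) ^ (-((l + 1 : ℕ) : ℤ)))
    (S l) (fun i x => invPowJet i (w x)) (zpow_neg_pos (p := p) (l + 1 : ℕ)) one_pos
    (fun i x _ hx j => by
      have hx' := (projDist_infty_le_iff (Nat.succ_pos l)).mp hx
      refine (norm_invPowJet_le _ _ _).trans ?_
      rw [one_pow, mul_one, zpow_neg, zpow_natCast, inv_pow]
      refine inv_anti₀ (by positivity) ?_
      calc ((p : ℝ) ^ (l + 1)) ^ i ≤ ((p : ℝ) ^ (l + 1)) ^ (j + i + 1) :=
            pow_le_pow_right₀ hp1 (by omega)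
        _ ≤ _ := by gcongr)
  refine hS.exists_isMomentLimit (zpow_neg_pos _) (fun _ => zero_le_one) (fun _ => le_rfl)
    (A := jetBound p h) hC (fun N hN i => ?_) hA₀
  rw [one_mul]
  have hpl := zpow_neg_pos (p := p) ((l + 1 : ℕ) : ℤ)
  exact (hS.norm_sum_invPowJet_le (Nat.succ_pos l) (by omega) i).trans
    (mul_le_mul_of_nonneg_left (zpow_neg_succ_le N) (by positivity))

/-- The pairing of the limit of the divisors `S N` with a function is computed by the moments `M`,
`MInf` and the local expansions of the function modulo `p ^ (l + 1)`. -/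
structure IsApproximation (h : ℕ) (w w' : ι → ℂ_[p]) (c : ι → ℤ) (S : ℕ → Finset ι) (l : ℕ)
    (R : Finset ℂ_[p]) (M : ℂ_[p] → ℕ → ℂ_[p]) (MInf : ℕ → ℂ_[p]) (A : ℝ) : Prop where
  norm_le : ∀ a ∈ R, ∀ i, ‖M a i‖ ≤ A * discRadius (l + 1) a ^ i
  norm_infty_le : ∀ i, ‖MInf i‖ ≤ A * ((p : ℝ) ^ (-((l + 1 : ℕ) : ℤ))) ^ i
  approx : ∀ (g : ℂ_[p] → ℂ_[p]) (e : ℂ_[p] → ℕ → ℂ_[p]) (eInf : ℕ → ℂ_[p]) (B : ℝ)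
    (d : ι → ℕ → ℂ_[p]), BoundedExpansion h (l + 1) R g e eInf B →
    (∀ N, ∀ x ∈ S N, ∃ r > 0, ExpandsAt g (w x) r (d x)) →
    Summable (fun i => MInf i * eInf i) ∧ (∀ a ∈ R, Summable (fun i => M a i * e a i)) ∧
    ∀ N, l ≤ N → ‖∑ x ∈ S N, (c x : ℂ_[p]) * jetFun h (w x - w' x) (d x) -
      (∑' i, MInf i * eInf i + ∑ a ∈ R, ∑' i, M a i * e a i)‖ ≤
        A * B * (p : ℝ) ^ (-(N : ℤ))

/-- The moments and their constants depend only on the divisor and the discs, not on the test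
function. The same ones can therefore be used for the Cauchy kernel and for the logarithmic kernel,
uniformly in z. -/
theorem IsDegreeZeroSystem.exists_approximation (hS : IsDegreeZeroSystem h w w' c S) {l : ℕ}
    {R : Finset ℂ_[p]} (hR : IsReps (unramifiedQuadratic p) (l + 1) R) :
    ∃ M MInf A, IsApproximation h w w' c S l R M MInf A := by
  classical
  have h1 : ∀ a, ∃ A M, a ∈ R → IsMomentLimit h w w' c S
      (fun x => projDist (a : OnePoint ℂ_[p]) (w x) ≤ (p : ℝ) ^ (-((l + 1 : ℕ) : ℤ)))
      (fun i x => powJet a i (w x)) l (discRadius (l + 1) a) (fun i => if i ≤ 2 * h then 0 else 1)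
      A M := by
    intro a
    by_cases ha : a ∈ R
    · obtain ⟨A, M, hM⟩ := hS.exists_moments l (hR.lt_projDist_infty ha)
      exact ⟨A, M, fun _ => hM⟩
    · exact ⟨0, 0, fun h => absurd h ha⟩
  choose A M hM using h1
  obtain ⟨AInf, MInf, hMInf⟩ := hS.exists_moments_infty l
  have hsum0 : 0 ≤ ∑ a ∈ R, A a := Finset.sum_nonneg fun a ha => (hM a ha).nonneg
  have hAa : ∀ a ∈ R, A a ≤ AInf + ∑ a ∈ R, A a := by
    intro a ha
    have := Finset.single_le_sum (f := A) (fun a ha => (hM a ha).nonneg) ha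
    linarith [hMInf.nonneg]
  have hA0 : 0 ≤ AInf + ∑ a ∈ R, A a := add_nonneg hMInf.nonneg hsum0
  refine ⟨M, MInf, AInf + ∑ a ∈ R, A a, fun a ha i => ?_, fun i => ?_, ?_⟩
  · have := discRadius_pos (l + 1) a
    refine ((hM a ha).norm_le i).trans ?_
    gcongr
    exact hAa a ha
  · have := zpow_neg_pos (p := p) ((l + 1 : ℕ) : ℤ)
    refine (hMInf.norm_le i).trans ?_
    gcongr
    linarith
  intro g e eInf B d hg hd
  have hB := hg.nonneg
  have hfin : ∀ a ∈ R, _ := fun a ha => (hM a ha).norm_sum_sub_le (hg.tendsto a ha) hB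
    (fun i => by
      split_ifs with hi
      · rwa [zero_mul]
      · rw [one_mul]
        exact hg.bound a ha i (not_le.mp hi))
    (D := d) (fun N x hx hxa j => by
      obtain ⟨r, hr, hdx⟩ := hd N x hx
      exact (hg.expandsAt a ha).hasSum_recenter hr (discRadius_pos _ _)
        (projDist_le_imp hxa (hR.lt_projDist_infty ha)).2 (hg.tendsto a ha) hdx j)
  have hinf := hMInf.norm_sum_sub_le hg.tendsto_infty hB
    (fun i => by
      rw [one_mul]
      exact hg.bound_infty i)
    (D := d) (fun N x hx hxa j => by
      obtain ⟨r, hr, hdx⟩ := hd N x hx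
      refine ExpandsAt.hasSum_inv_pow (pow_pos prime_pos (l + 1)) hr
        ((projDist_infty_le_iff (Nat.succ_pos l)).mp hxa) ?_ hg.hasSum_infty hdx j
      have := hg.tendsto_infty
      rwa [zpow_neg, zpow_natCast] at this)
  refine ⟨hinf.1, fun a ha => (hfin a ha).1, fun N hN => ?_⟩
  have hpN := (zpow_neg_pos (p := p) N).le
  rw [hR.sum_eq (S N) (fun x hx => (hS.pair N x hx).mem), add_sub_add_comm,
    ← Finset.sum_sub_distrib]
  refine (IsUltrametricDist.norm_add_le_max _ _).trans (max_le ?_ ?_)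
  · refine (hinf.2 N hN).trans ?_
    gcongr
    linarith
  · refine norm_sum_le_of_forall (by positivity) fun a ha => ((hfin a ha).2 N hN).trans ?_
    gcongr
    exact hAa a ha

end Approximation


/-! ### The system attached to an RM-divisor and a pair of cusps. -/

section DivisorSystem

variable {p : ℕ} [Fact p.Prime]
variable {ιInf : AlgebraicClosure ℚ →+* ℂ} {ιp : AlgebraicClosure ℚ →+* ℂ_[p]}
variable {D : AlgebraicClosure ℚ →₀ ℤ}

theorem finite_divisor (hRM : ∀ τ ∈ D.support, IsInertRM ιInf ιp τ) (r s : OnePoint ℚ) (N : ℕ) :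
    (⋃ τ ∈ D.support, sigmaSetLE ιInf ιp τ r s N).Finite :=
  D.support.finite_toSet.biUnion fun τ hτ => (hRM τ hτ).finite_sigmaSetLE r s N

/-- The points of level at most `N` in the divisor attached to `D` and the cusps `r`, `s`. -/
noncomputable def divisorPoints (hRM : ∀ τ ∈ D.support, IsInertRM ιInf ιp τ) (r s : OnePoint ℚ)
    (N : ℕ) : Finset (AlgebraicClosure ℚ) :=
  (finite_divisor hRM r s N).toFinset

open Classical in
/-- The multiplicities in the divisor attached to `D` and the cusps `r`, `s`. -/
noncomputable def divisorWeight (p : ℕ) (ιInf : AlgebraicClosure ℚ →+* ℂ)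
    (D : AlgebraicClosure ℚ →₀ ℤ) (r s : OnePoint ℚ) (w : AlgebraicClosure ℚ) : ℤ :=
  D.sum fun τ m => if w ∈ orbit p τ then m * rmIntersection ιInf w r s else 0

theorem mem_divisorPoints (hRM : ∀ τ ∈ D.support, IsInertRM ιInf ιp τ) {r s : OnePoint ℚ} {N : ℕ}
    {w : AlgebraicClosure ℚ} : w ∈ divisorPoints hRM r s N ↔
      ∃ τ ∈ D.support, w ∈ sigmaSet p ιInf τ r s ∧
        ιp w ∈ affinoid (⊥ : IntermediateField ℚ_[p] ℂ_[p]) N := by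
  simp only [divisorPoints, Set.Finite.mem_toFinset, Set.mem_iUnion, sigmaSetLE, Set.mem_ofPred_eq,
    exists_prop]

theorem isConjPair_of_mem (hRM : ∀ τ ∈ D.support, IsInertRM ιInf ιp τ) {r s : OnePoint ℚ} {N : ℕ}
    {w : AlgebraicClosure ℚ} (hw : w ∈ divisorPoints hRM r s N) :
    IsConjPair (ιp w) (ιp (conj w)) := by
  obtain ⟨τ, hτ, h1, -⟩ := (mem_divisorPoints hRM).mp hw
  exact (hRM τ hτ).isConjPair h1.1

open Classical in
-- Exchanging the two summations replaces the sum over orbits by one finite sum over points with a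
-- total weight; different τ in the support may share an orbit. Orbit points with intersection
-- number 0 have weight contribution 0.
theorem sum_finsum_eq {M : Type*} [AddCommGroup M] (hRM : ∀ τ ∈ D.support, IsInertRM ιInf ιp τ)
    (r s : OnePoint ℚ) (N : ℕ) (Q : AlgebraicClosure ℚ → Prop)
    (hQ : ∀ τ ∈ D.support, ∀ w ∈ sigmaSet p ιInf τ r s, Q w →
      ιp w ∈ affinoid (⊥ : IntermediateField ℚ_[p] ℂ_[p]) N) (F : AlgebraicClosure ℚ → M) :
    (D.sum fun τ m => ∑ᶠ w ∈ {w | w ∈ sigmaSet p ιInf τ r s ∧ Q w},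
      (m * rmIntersection ιInf w r s) • F w) =
      ∑ w ∈ divisorPoints hRM r s N with Q w, divisorWeight p ιInf D r s w • F w := by
  simp only [divisorWeight, Finsupp.sum, Finset.sum_smul]
  rw [Finset.sum_comm]
  refine Finset.sum_congr rfl fun τ hτ => ?_
  have hsub : {w | w ∈ sigmaSet p ιInf τ r s ∧ Q w} ⊆
      ((divisorPoints hRM r s N).filter Q : Set (AlgebraicClosure ℚ)) := by
    intro w hw
    rw [Finset.mem_coe, Finset.mem_filter, mem_divisorPoints]
    exact ⟨⟨τ, hτ, hw.1, hQ τ hτ w hw.1 hw.2⟩, hw.2⟩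
  have hfin : {w | w ∈ sigmaSet p ιInf τ r s ∧ Q w}.Finite := (Finset.finite_toSet _).subset hsub
  rw [finsum_mem_eq_finite_toFinset_sum _ hfin]
  have hsub' : hfin.toFinset ⊆ (divisorPoints hRM r s N).filter Q := by
    intro w hw
    exact hsub (hfin.mem_toFinset.mp hw)
  rw [← Finset.sum_subset hsub']
  · refine Finset.sum_congr rfl fun w hw => ?_
    rw [hfin.mem_toFinset] at hw
    rw [if_pos hw.1.1]
  · intro w hw hw'
    rw [hfin.mem_toFinset] at hw'
    rw [Finset.mem_filter] at hw
    split_ifs with ho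
    · have h0 : rmIntersection ιInf w r s = 0 := by
        by_contra h0
        exact hw' ⟨⟨ho, h0⟩, hw.2⟩
      rw [h0, mul_zero, zero_smul]
    · rw [zero_smul]

/-- The degree condition is an identity of polynomials at each vertex; pairing it with Q turns it
into the vanishing of jet functionals on a fibre of the reduction, which is a disc of radius p^(-N).
-/
theorem isDegreeZeroSystem {h : ℕ} (hRM : ∀ τ ∈ D.support, IsInertRM ιInf ιp τ)
    (hD : IsDegreeZero ιInf ιp (2 * h) D) (r s : OnePoint ℚ) :
    IsDegreeZeroSystem h (fun w => ιp w) (fun w => ιp (conj w)) (divisorWeight p ιInf D r s)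
      (divisorPoints hRM r s) where
  pair N x hx := isConjPair_of_mem hRM hx
  mem_iff M N x hx := by
    rw [← (isConjPair_of_mem hRM hx).mem_affinoid_iff, mem_divisorPoints]
    obtain ⟨τ, hτ, h1, -⟩ := (mem_divisorPoints hRM).mp hx
    exact ⟨fun ⟨_, _, _, h⟩ => h, fun h => ⟨τ, hτ, h1, h⟩⟩
  fibre N u hu hN Q hQ := by
    classical
    have hup := isConjPair_of_mem hRM hu
    have h0 := hD r s _ (hup.closedDisc_mem_vertices hN)
    rw [degSymbol, sum_finsum_eq hRM r s N (fun w => ReducesTo ⊥ (ιp w) _)] at h0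
    · have h1 := congrArg (fun P => polyPairing (2 * h) P Q) h0
      rw [polyPairing_zero_left, polyPairing_sum_left] at h1
      rw [← h1]
      refine Finset.sum_congr (Finset.filter_congr fun x hx => ?_) fun x hx => ?_
      · exact ((isConjPair_of_mem hRM hx).reducesTo_closedDisc_iff hup hN).symm
      · rw [Finset.mem_filter] at hx
        have hxp := isConjPair_of_mem hRM hx.1
        rw [polyPairing_smul_left, rmPoly, Nat.mul_div_cancel_left h two_pos,
          polyPairing_rmPoly (norm_pos_iff.mp hxp.norm_sub_pos) hQ]
    · intro τ hτ w hw hred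
      have hwp := (hRM τ hτ).isConjPair hw.1
      rw [hwp.reducesTo_closedDisc_iff hup hN] at hred
      rw [hwp.mem_affinoid_iff, hred.1]

theorem explicitSum_eq {h : ℕ} (hRM : ∀ τ ∈ D.support, IsInertRM ιInf ιp τ) (L : ℂ_[p])
    (r s : OnePoint ℚ) (N : ℕ) (z : ℂ_[p]) :
    explicitSum ιInf ιp (2 * h) L D r s N z = ((2 * h).factorial : ℂ_[p])⁻¹ *
      ∑ w ∈ divisorPoints hRM r s N, (divisorWeight p ιInf D r s w : ℂ_[p]) *
        ((z - ιp w) ^ h * (z - ιp (conj w)) ^ h / (ιp w - ιp (conj w)) ^ h *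
            padicLog L (tFun (ιp w) z) + correction (2 * h) (ιp w) (ιp (conj w)) z) := by
  classical
  have h1 := sum_finsum_eq hRM r s N
    (fun w => ιp w ∈ affinoid (⊥ : IntermediateField ℚ_[p] ℂ_[p]) N) (fun _ _ _ _ hw => hw)
    (fun w => (z - ιp w) ^ h * (z - ιp (conj w)) ^ h / (ιp w - ιp (conj w)) ^ h *
            padicLog L (tFun (ιp w) z) + correction (2 * h) (ιp w) (ιp (conj w)) z)
  rw [Finset.filter_true_of_mem (fun w hw => by
    obtain ⟨_, _, _, h⟩ := (mem_divisorPoints hRM).mp hw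
    exact h)] at h1
  simp only [zsmul_eq_mul] at h1
  rw [← h1, explicitSum, Nat.mul_div_cancel_left h two_pos]
  rfl

/-- The points 0 and ∞ are at distance 1, so no disc of positive level contains all of P^1(ℚ_p). -/
theorem not_disjoint_sdiff_closedDisc {l : ℕ} (hl : 0 < l) (x : OnePoint ℂ_[p]) :
    ¬ Disjoint (projLine (unramifiedQuadratic p) \ closedDisc (unramifiedQuadratic p) x l)
      (projLine (⊥ : IntermediateField ℚ_[p] ℂ_[p])) := by
  intro hdis
  have key : ∀ y ∈ projLine (⊥ : IntermediateField ℚ_[p] ℂ_[p]),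
      projDist x y ≤ (p : ℝ) ^ (-(l : ℤ)) := by
    intro y hy
    by_contra h
    exact Set.disjoint_left.mp hdis ⟨projLine_mono bot_le hy, fun h' => h h'.2⟩ hy
  have h0 := key ((0 : ℂ_[p]) : OnePoint ℂ_[p]) (coe_mem_projLine.mpr (zero_mem _))
  have h1 := key OnePoint.infty (infty_mem_projLine _)
  have h2 := (projDist_le_max OnePoint.infty ((0 : ℂ_[p]) : OnePoint ℂ_[p]) x).trans
    (max_le (by rwa [projDist_comm]) h0)
  rw [projDist_infty_coe, norm_zero, max_eq_left zero_le_one, div_one] at h2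
  exact absurd h2 (not_le.mpr (zpow_neg_lt_one hl))

open Classical in
/-- The edge function on a disc is the sum over the points of smaller level in the disc. -/
theorem edgeFunction_closedDisc {n : ℕ} (hRM : ∀ τ ∈ D.support, IsInertRM ιInf ιp τ)
    (r s : OnePoint ℚ) (l : ℕ) (x : OnePoint ℂ_[p]) :
    edgeFunction ιInf ιp n D r s (closedDisc (unramifiedQuadratic p) x (l + 1)) =
      ∑ w ∈ divisorPoints hRM r s l with
        projDist x (ιp w : OnePoint ℂ_[p]) ≤ (p : ℝ) ^ (-((l + 1 : ℕ) : ℤ)),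
        divisorWeight p ιInf D r s w • rmPoly ιp n w := by
  have hmem : ∀ w : AlgebraicClosure ℚ, IsConjPair (ιp w) (ιp (conj w)) →
      (((ιp w : ℂ_[p]) : OnePoint ℂ_[p]) ∈ closedDisc (unramifiedQuadratic p) x (l + 1) ↔
        projDist x (ιp w : OnePoint ℂ_[p]) ≤ (p : ℝ) ^ (-((l + 1 : ℕ) : ℤ))) :=
    fun w hw => ⟨fun h => h.2, fun h => ⟨coe_mem_projLine.mpr hw.mem, h⟩⟩
  rw [edgeFunction]
  split_ifs with h1 h2
  · rw [sumOver, sum_finsum_eq hRM r s l (fun w => ((ιp w : ℂ_[p]) : OnePoint ℂ_[p]) ∈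
      closedDisc (unramifiedQuadratic p) x (l + 1))]
    · refine Finset.sum_congr (Finset.filter_congr fun w hw => ?_) fun _ _ => rfl
      exact hmem w (isConjPair_of_mem hRM hw)
    · intro τ hτ w hw hwx
      have hwp := (hRM τ hτ).isConjPair hw.1
      rw [hmem w hwp] at hwx
      rw [hwp.mem_affinoid_iff]
      -- A point of level above l would have a point of P^1(ℚ_p) within p^(-l-1), hence inside the
      -- disc.
      obtain ⟨N, hN⟩ := hwp.exists_level
      obtain ⟨y, hy, hyw⟩ := hwp.exists_projDist_eq
      rw [hN, zpow_neg_le_iff]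
      by_contra! hNl
      refine Set.disjoint_left.mp h1 ⟨projLine_mono bot_le hy, ?_⟩ hy
      refine (projDist_le_max _ _ (ιp w : OnePoint ℂ_[p])).trans (max_le hwx ?_)
      rw [projDist_comm, hyw, hN, zpow_neg_le_iff]
      exact hNl
  · exact absurd h2 (not_disjoint_sdiff_closedDisc (Nat.succ_pos l) x)
  -- The disc meets P^1(ℚ_p), so each of its points lies within p^(-l-1) of P^1(ℚ_p) and has level
  -- above l. The sum is empty, in agreement with the value 0.
  · rw [Finset.sum_eq_zero]
    intro w hw
    exfalso
    rw [Finset.mem_filter] at hw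
    have hwp := isConjPair_of_mem hRM hw.1
    obtain ⟨τ, -, -, haff⟩ := (mem_divisorPoints hRM).mp hw.1
    rw [hwp.mem_affinoid_iff] at haff
    obtain ⟨y, hy1, hy2⟩ := Set.not_disjoint_iff.mp h1
    have h3 := hwp.treeRadius_le hy2
    have h4 : projDist y (ιp w : OnePoint ℂ_[p]) ≤ (p : ℝ) ^ (-((l + 1 : ℕ) : ℤ)) := by
      refine (projDist_le_max _ _ x).trans (max_le ?_ hw.2)
      rw [projDist_comm]
      exact hy1.2
    have h5 := (haff.trans h3).trans h4
    rw [zpow_neg_le_iff] at h5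
    omega

end DivisorSystem


/-! ### Distances between affinoids and boundary discs. -/

section AffinoidGeometry

variable {p : ℕ} [Fact p.Prime] {F : IntermediateField ℚ_[p] ℂ_[p]} {l : ℕ} {z : ℂ_[p]}

theorem norm_le_of_mem_affinoid (hz : z ∈ affinoid F l) : ‖z‖ ≤ (p : ℝ) ^ l := by
  have h := hz OnePoint.infty (infty_mem_projLine F)
  rw [projDist_infty_coe, zpow_neg, zpow_natCast, one_div,
    inv_le_inv₀ (pow_pos prime_pos _) (max_one_pos z)] at h
  exact (le_max_right _ _).trans h

theorem le_norm_sub_of_mem_affinoid (hz : z ∈ affinoid F l) {a : ℂ_[p]} (ha : a ∈ F) :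
    (p : ℝ) ^ (-(l : ℤ)) * (max 1 ‖a‖ * max 1 ‖z‖) ≤ ‖z - a‖ := by
  have h := hz a (coe_mem_projLine.mpr ha)
  rw [projDist_coe_coe, le_div_iff₀ (mul_pos (max_one_pos a) (max_one_pos z)), norm_sub_rev] at h
  exact h

theorem norm_sub_pos_of_mem_affinoid (hz : z ∈ affinoid F l) {a : ℂ_[p]} (ha : a ∈ F) :
    0 < ‖z - a‖ :=
  (mul_pos (zpow_neg_pos _) (mul_pos (max_one_pos a) (max_one_pos z))).trans_le
    (le_norm_sub_of_mem_affinoid hz ha)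

/-- The ratio of the radius of a disc around `a` to the distance of `a` from points outside. -/
noncomputable def discRatio (m : ℕ) (a : ℂ_[p]) : ℝ :=
  max ((p : ℝ)⁻¹) ((p : ℝ) ^ (-(m : ℤ)) * max 1 ‖a‖)

theorem discRatio_pos (m : ℕ) (a : ℂ_[p]) : 0 < discRatio m a :=
  lt_max_of_lt_left (inv_pos.mpr prime_pos)

theorem discRatio_lt_one {m : ℕ} {a : ℂ_[p]}
    (ha : (p : ℝ) ^ (-(m : ℤ)) < projDist OnePoint.infty (a : OnePoint ℂ_[p])) :
    discRatio m a < 1 := by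
  refine max_lt (inv_lt_one_of_one_lt₀ one_lt_prime) ?_
  rwa [projDist_infty_coe, lt_div_iff₀ (max_one_pos a)] at ha

/-- If |a| is at most about |z|, the gap l < m between affinoid and disc yields a factor 1/p.
Otherwise |z - a| = |a|, and the ratio is p^(-m) max(1, |a|). Either way the bound does not depend
on z. -/
theorem discRadius_le_discRatio_mul {m : ℕ} (hm : l < m) (hz : z ∈ affinoid F l) {a : ℂ_[p]}
    (ha : a ∈ F) : discRadius m a ≤ discRatio m a * ‖z - a‖ := by
  have h := le_norm_sub_of_mem_affinoid hz ha
  have hma := max_one_pos a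
  have hpm := zpow_neg_pos (p := p) (m : ℤ)
  rcases le_or_gt (max 1 ‖a‖) (max 1 ‖z‖) with h1 | h1
  · have e : (p : ℝ) ^ (-(m : ℤ)) ≤ (p : ℝ)⁻¹ * (p : ℝ) ^ (-(l : ℤ)) := by
      rw [← zpow_neg_one, ← zpow_add₀ prime_pos.ne']
      exact zpow_le_zpow_right₀ one_lt_prime.le (by omega)
    have hpl := zpow_neg_pos (p := p) (l : ℤ)
    have hp0 : (0 : ℝ) < p := prime_pos
    calc discRadius m a ≤ (p : ℝ)⁻¹ * (p : ℝ) ^ (-(l : ℤ)) * (max 1 ‖a‖ * max 1 ‖z‖) := by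
          rw [discRadius, sq]
          gcongr
      _ = (p : ℝ)⁻¹ * ((p : ℝ) ^ (-(l : ℤ)) * (max 1 ‖a‖ * max 1 ‖z‖)) := by ring
      _ ≤ discRatio m a * ‖z - a‖ := by
        gcongr
        · exact (discRatio_pos m a).le
        · exact le_max_left _ _
  · have h2 : max 1 ‖a‖ = ‖a‖ := by
      rcases max_choice 1 ‖a‖ with h2 | h2
      · rw [h2] at h1
        exact absurd (le_max_left 1 ‖z‖) (not_le.mpr h1)
      · exact h2
    have h3 : ‖z‖ < ‖a‖ := (le_max_right 1 ‖z‖).trans_lt (h2 ▸ h1)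
    have h4 : ‖z - a‖ = ‖a‖ := by
      rw [norm_sub_rev, sub_eq_add_neg,
        IsUltrametricDist.norm_add_eq_max_of_norm_ne_norm (by rw [norm_neg]; exact h3.ne'), norm_neg,
        max_eq_left h3.le]
    rw [h4, ← h2, discRadius, sq, ← mul_assoc]
    gcongr
    exact le_max_right _ _

theorem discRadius_le_discRatio_mul_norm {m : ℕ} {a : ℂ_[p]} (ha : 1 < ‖a‖) :
    discRadius m a ≤ discRatio m a * ‖a‖ := by
  rw [discRadius, sq, ← mul_assoc]
  have h2 : max 1 ‖a‖ = ‖a‖ := max_eq_right ha.le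
  nth_rewrite 2 [h2]
  gcongr
  exact le_max_right _ _

theorem discRadius_lt {m : ℕ} (hm : l < m) (hz : z ∈ affinoid F l) {a : ℂ_[p]} (ha : a ∈ F)
    (ha' : (p : ℝ) ^ (-(m : ℤ)) < projDist OnePoint.infty (a : OnePoint ℂ_[p])) :
    discRadius m a < ‖z - a‖ :=
  (discRadius_le_discRatio_mul hm hz ha).trans_lt
    (mul_lt_of_lt_one_left (norm_sub_pos_of_mem_affinoid hz ha) (discRatio_lt_one ha'))

end AffinoidGeometry

/-! ### Local expansions of the Cauchy kernel. -/

section CauchyKernel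

variable {p : ℕ} [Fact p.Prime] {F : IntermediateField ℚ_[p] ℂ_[p]} {l : ℕ} {z : ℂ_[p]}

theorem norm_inv_pow_mul_le {x : ℂ_[p]} {ρ κ : ℝ} (hρ : 0 ≤ ρ) (hx : x ≠ 0) (h : ρ ≤ κ * ‖x‖)
    (i : ℕ) : ‖(x ^ (i + 1))⁻¹‖ * ρ ^ i ≤ ‖x‖⁻¹ * κ ^ i := by
  have hx' : 0 < ‖x‖ := norm_pos_iff.mpr hx
  rw [norm_inv, norm_pow]
  calc _ ≤ (‖x‖ ^ (i + 1))⁻¹ * (κ * ‖x‖) ^ i := by gcongr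
    _ = _ := by
      rw [mul_pow, pow_succ]
      field_simp

/-- All expansions are geometric series. The coefficients -z^i at ∞ and (z - a)^(-i-1) at a are
exactly the functions appearing in a Mittag-Leffler expansion in z. -/
theorem boundedExpansion_inv_sub {h : ℕ} {R : Finset ℂ_[p]} (hR : IsReps F (l + 1) R)
    (hz : z ∈ affinoid F l) :
    BoundedExpansion h (l + 1) R (fun t => (z - t)⁻¹) (fun a i => ((z - a) ^ (i + 1))⁻¹)
      (fun i => -z ^ i) ((p : ℝ) ^ l) := by
  have hzn := norm_le_of_mem_affinoid hz
  have hp0 : (0 : ℝ) < p := prime_pos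
  have hcoef : ∀ i, ‖-z ^ i‖ * ((p : ℝ) ^ (-((l + 1 : ℕ) : ℤ))) ^ i ≤ ((p : ℝ)⁻¹) ^ i := by
    intro i
    rw [norm_neg, norm_pow, ← mul_pow]
    gcongr
    calc _ ≤ (p : ℝ) ^ l * (p : ℝ) ^ (-((l + 1 : ℕ) : ℤ)) := by gcongr
      _ = _ := by
        rw [zpow_neg, zpow_natCast, pow_succ]
        field_simp
  have hlt : (p : ℝ)⁻¹ < 1 := inv_lt_one_of_one_lt₀ one_lt_prime
  have hfin : ∀ a ∈ R, ∀ i, ‖((z - a) ^ (i + 1))⁻¹‖ * discRadius (l + 1) a ^ i ≤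
      ‖z - a‖⁻¹ * discRatio (l + 1) a ^ i := fun a ha i =>
    norm_inv_pow_mul_le (discRadius_pos _ _).le
      (norm_pos_iff.mp (norm_sub_pos_of_mem_affinoid hz (hR.1 a ha)))
      (discRadius_le_discRatio_mul (Nat.lt_succ_self l) hz (hR.1 a ha)) i
  refine ⟨by positivity, fun a ha => ?_, fun a ha => ?_, fun a ha i _ => ?_, fun t ht => ?_, ?_,
    fun i => ?_⟩
  · exact expandsAt_inv_sub z a
      (discRadius_lt (Nat.lt_succ_self l) hz (hR.1 a ha) (hR.lt_projDist_infty ha))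
  · refine squeeze_zero (fun i => by have := discRadius_pos (l + 1) a; positivity) (hfin a ha) ?_
    simpa using (tendsto_pow_atTop_nhds_zero_of_lt_one (discRatio_pos (l + 1) a).le
      (discRatio_lt_one (hR.lt_projDist_infty ha))).const_mul (‖z - a‖⁻¹)
  · refine (hfin a ha i).trans ?_
    have h1 := le_norm_sub_of_mem_affinoid hz (hR.1 a ha)
    have h2 : ‖z - a‖⁻¹ ≤ (p : ℝ) ^ l := by
      rw [inv_le_comm₀ (norm_sub_pos_of_mem_affinoid hz (hR.1 a ha)) (pow_pos hp0 _),
        ← zpow_natCast, ← zpow_neg]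
      refine le_trans ?_ h1
      exact le_mul_of_one_le_right (zpow_neg_pos _).le
        (one_le_mul_of_one_le_of_one_le (le_max_left _ _) (le_max_left _ _))
    calc _ ≤ ‖z - a‖⁻¹ * 1 := by
          gcongr
          exact pow_le_one₀ (discRatio_pos _ _).le (discRatio_lt_one (hR.lt_projDist_infty ha)).le
      _ ≤ _ := by rwa [mul_one]
  · have ht0 : 0 < ‖t‖ := (pow_pos hp0 _).trans_le ht
    have hzt : ‖z‖ < ‖t‖ := hzn.trans_lt ((pow_lt_pow_right₀ one_lt_prime (Nat.lt_succ_self l)).trans_le ht)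
    have h1 : ‖z / t‖ < 1 := by rwa [norm_div, div_lt_one ht0]
    have ht' : t ≠ 0 := norm_pos_iff.mp ht0
    have hne : z - t ≠ 0 := by
      intro h0
      rw [sub_eq_zero.mp h0] at hzt
      exact lt_irrefl _ hzt
    refine hasSum_of_eq ((hasSum_geometric_of_norm_lt_one h1).mul_left (-t⁻¹)) (fun i => ?_) ?_
    · rw [div_pow, pow_succ]
      field_simp
    · rw [one_sub_div ht', inv_div, ← neg_sub t z, inv_neg]
      field_simp
  · exact squeeze_zero (fun i => by positivity) hcoef
      (tendsto_pow_atTop_nhds_zero_of_lt_one (by positivity) hlt)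
  · exact (hcoef i).trans ((pow_le_one₀ (by positivity) hlt.le).trans
      (one_le_pow₀ one_lt_prime.le))

end CauchyKernel

/-! ### The Schneider--Teitelbaum lift as a limit of sums over the divisor. -/

section Lift

variable {p : ℕ} [Fact p.Prime]
variable {ιInf : AlgebraicClosure ℚ →+* ℂ} {ιp : AlgebraicClosure ℚ →+* ℂ_[p]}
variable {D : AlgebraicClosure ℚ →₀ ℤ} {h : ℕ}

/-- The value of the divisor of level at most `N` on the Cauchy kernel. -/
noncomputable def kernelSum (hRM : ∀ τ ∈ D.support, IsInertRM ιInf ιp τ) (h : ℕ) (r s : OnePoint ℚ)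
    (N : ℕ) (z : ℂ_[p]) : ℂ_[p] :=
  ∑ w ∈ divisorPoints hRM r s N, (divisorWeight p ιInf D r s w : ℂ_[p]) *
    jetFun h (ιp w - ιp (conj w)) (fun j => ((z - ιp w) ^ (j + 1))⁻¹)

open Classical in
theorem liftSum_eq (hRM : ∀ τ ∈ D.support, IsInertRM ιInf ιp τ) (r s : OnePoint ℚ) (N : ℕ)
    (R : Finset ℂ_[p]) (z : ℂ_[p]) :
    liftSum (unramifiedQuadratic p) (2 * h) (edgeFunction ιInf ιp (2 * h) D r s) R (N + 1) z =
      ∑ a ∈ R, ∑ w ∈ divisorPoints hRM r s N with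
        projDist (a : OnePoint ℂ_[p]) (ιp w) ≤ (p : ℝ) ^ (-((N + 1 : ℕ) : ℤ)),
        (divisorWeight p ιInf D r s w : ℂ_[p]) * jetFun h (ιp w - ιp (conj w))
          (fun j => (taylor (ιp w) (kernelJet (2 * h) z a)).coeff j) := by
  rw [liftSum]
  refine Finset.sum_congr rfl fun a _ => ?_
  rw [edgeFunction_closedDisc hRM, polyPairing_sum_left]
  refine Finset.sum_congr rfl fun w hw => ?_
  rw [Finset.mem_filter] at hw
  rw [polyPairing_smul_left, rmPoly, Nat.mul_div_cancel_left h two_pos,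
    polyPairing_rmPoly (Q := kernelJet (2 * h) z a)
      (norm_pos_iff.mp (isConjPair_of_mem hRM hw.1).norm_sub_pos) (natDegree_sum_pow_le _ _ _)]

/-- Both sums run over the same points; they differ in that the discrete integral replaces the
kernel by its Taylor polynomial at the representative a. Points of level at most N satisfy |w - w'|
≥ ρ, where ρ is the radius of the disc around a, so the remainder is O(ρ^(h+1)/|z - a|^(2h+2)). -/
theorem norm_liftSum_sub_le (hRM : ∀ τ ∈ D.support, IsInertRM ιInf ιp τ) (r s : OnePoint ℚ)
    {l N : ℕ} (hlN : l ≤ N) {R : Finset ℂ_[p]} (hR : IsReps (unramifiedQuadratic p) (N + 1) R)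
    {z : ℂ_[p]} (hz : z ∈ affinoid (unramifiedQuadratic p) l) :
    ‖liftSum (unramifiedQuadratic p) (2 * h) (edgeFunction ιInf ιp (2 * h) D r s) R (N + 1) z -
      kernelSum hRM h r s N z‖ ≤
      jetBound p h * ((p : ℝ) ^ l) ^ (2 * h + 2) * ((p : ℝ) ^ (-((N + 1 : ℕ) : ℤ))) ^ (h + 1) := by
  classical
  have hC := jetBound_nonneg (p := p) h
  have hp0 : (0 : ℝ) < p := prime_pos
  have haff : ∀ w ∈ divisorPoints hRM r s N,
      (p : ℝ) ^ (-(N : ℤ)) ≤ treeRadius (ιp w) (ιp (conj w)) := fun w hw => by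
    obtain ⟨_, _, _, haff⟩ := (mem_divisorPoints hRM).mp hw
    exact (isConjPair_of_mem hRM hw).mem_affinoid_iff.mp haff
  rw [liftSum_eq hRM, kernelSum, hR.sum_eq _ (fun w hw => (isConjPair_of_mem hRM hw).mem),
    Finset.filter_false_of_mem, Finset.sum_empty, zero_add, ← Finset.sum_sub_distrib]
  · refine norm_sum_le_of_forall (by positivity) fun a ha => ?_
    rw [← Finset.sum_sub_distrib]
    refine norm_sum_le_of_forall (by positivity) fun w hw => ?_
    rw [Finset.mem_filter] at hw
    have hwp := isConjPair_of_mem hRM hw.1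
    have haK := hR.1 a ha
    have hainf := hR.lt_projDist_infty ha
    obtain ⟨hwm, hwr⟩ := projDist_le_imp hw.2 hainf
    have hρ := discRadius_pos (N + 1) a
    have hlt := discRadius_lt (Nat.lt_succ_of_le hlN) hz haK hainf
    have hza := norm_sub_pos_of_mem_affinoid hz haK
    have hb : ∀ k, ‖((z - a) ^ (k + 1))⁻¹‖ * discRadius (N + 1) a ^ k ≤
        ‖z - a‖⁻¹ * (discRadius (N + 1) a / ‖z - a‖) ^ k := fun k =>
      norm_inv_pow_mul_le hρ.le (norm_pos_iff.mp hza) (by rw [div_mul_cancel₀ _ hza.ne']) k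
    have hq0 : 0 ≤ discRadius (N + 1) a / ‖z - a‖ := by positivity
    have hq1 : discRadius (N + 1) a / ‖z - a‖ < 1 := (div_lt_one hza).mpr hlt
    rw [← mul_sub]
    refine (norm_intCast_mul_le _ _).trans ?_
    rw [norm_sub_rev]
    refine (norm_jetFun_sub_taylor_le (n := 2 * h) hρ ?_ hwr (r := ‖z - ιp w‖ / 2)
      (B := ‖z - a‖⁻¹ * (discRadius (N + 1) a / ‖z - a‖) ^ (2 * h + 1))
      ?_ ?_ (expandsAt_inv_sub z a hlt) (expandsAt_inv_sub z (ιp w) ?_) (by positivity)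
      fun k hk => (hb k).trans ?_).trans ?_
    · rw [hwp.norm_sub_eq, hwm, discRadius]
      gcongr
      exact (zpow_neg_succ_le N).trans (haff w hw.1)
    · exact half_pos (norm_sub_pos_of_mem_affinoid hz hwp.mem)
    · refine squeeze_zero (fun k => by positivity) hb ?_
      simpa using (tendsto_pow_atTop_nhds_zero_of_lt_one hq0 hq1).const_mul (‖z - a‖⁻¹)
    · exact half_lt_self (norm_sub_pos_of_mem_affinoid hz hwp.mem)
    · gcongr ?_ * ?_
      exact pow_le_pow_of_le_one hq0 hq1.le hk
    · rw [mul_assoc]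
      gcongr ?_ * ?_
      have h1 := le_norm_sub_of_mem_affinoid hz haK
      have h2 : max 1 ‖a‖ / ‖z - a‖ ≤ (p : ℝ) ^ l := by
        rw [div_le_iff₀ hza, ← div_le_iff₀' (pow_pos hp0 _), div_eq_inv_mul, ← zpow_natCast,
          ← zpow_neg]
        refine le_trans ?_ h1
        have := le_mul_of_one_le_right (max_one_pos a).le (le_max_left 1 ‖z‖)
        have := zpow_neg_pos (p := p) (l : ℤ)
        gcongr
      calc ‖z - a‖⁻¹ * (discRadius (N + 1) a / ‖z - a‖) ^ (2 * h + 1) / discRadius (N + 1) a ^ h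
          = (max 1 ‖a‖ / ‖z - a‖) ^ (2 * h + 2) * ((p : ℝ) ^ (-((N + 1 : ℕ) : ℤ))) ^ (h + 1) := by
            have hma := max_one_pos a
            have hpN := zpow_neg_pos (p := p) ((N + 1 : ℕ) : ℤ)
            rw [discRadius]
            generalize (p : ℝ) ^ (-((N + 1 : ℕ) : ℤ)) = y at *
            rw [div_pow, div_pow, mul_pow, mul_pow]
            field_simp
            ring
        _ ≤ _ := by
          have hpN := zpow_neg_pos (p := p) ((N + 1 : ℕ) : ℤ)
          have hma := max_one_pos a
          gcongr
  -- The disc around ∞ of level N + 1 contains no point of level at most N, so omitting it from the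
  -- discrete integral loses nothing.
  · intro w hw hle
    have h1 := ((haff w hw).trans
      ((isConjPair_of_mem hRM hw).treeRadius_le (infty_mem_projLine _))).trans hle
    rw [zpow_neg_le_iff] at h1
    omega

theorem IsApproximation.tendsto_kernelSum {hRM : ∀ τ ∈ D.support, IsInertRM ιInf ιp τ}
    {r s : OnePoint ℚ} {l : ℕ} {R : Finset ℂ_[p]} {M : ℂ_[p] → ℕ → ℂ_[p]} {MInf : ℕ → ℂ_[p]} {A : ℝ}
    (hM : IsApproximation h (fun w => ιp w) (fun w => ιp (conj w)) (divisorWeight p ιInf D r s)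
      (divisorPoints hRM r s) l R M MInf A) (hR : IsReps (unramifiedQuadratic p) (l + 1) R)
    {z : ℂ_[p]} (hz : z ∈ affinoid (unramifiedQuadratic p) l) :
    Tendsto (fun N => kernelSum hRM h r s N z) atTop
      (𝓝 (∑' i, -MInf i * z ^ i + ∑ a ∈ R, ∑' i, M a i / (z - a) ^ (i + 1))) := by
  obtain ⟨-, -, h3⟩ := hM.approx _ _ _ _ (fun w j => ((z - ιp w) ^ (j + 1))⁻¹)
    (boundedExpansion_inv_sub hR hz) (fun N w hw => by
      have h0 := norm_sub_pos_of_mem_affinoid hz (isConjPair_of_mem hRM hw).mem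
      exact ⟨‖z - ιp w‖ / 2, half_pos h0, expandsAt_inv_sub z (ιp w) (half_lt_self h0)⟩)
  rw [tendsto_iff_norm_sub_tendsto_zero]
  have hlim : Tendsto (fun N : ℕ => A * (p : ℝ) ^ l * (p : ℝ) ^ (-(N : ℤ))) atTop (𝓝 0) := by
    have : Tendsto (fun N : ℕ => ((p : ℝ)⁻¹) ^ N) atTop (𝓝 0) :=
      tendsto_pow_atTop_nhds_zero_of_lt_one (by positivity) (inv_lt_one_of_one_lt₀ one_lt_prime)
    simpa [zpow_neg] using this.const_mul (A * (p : ℝ) ^ l)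
  refine squeeze_zero' (Eventually.of_forall fun _ => norm_nonneg _) ?_ hlim
  filter_upwards [eventually_ge_atTop l] with N hN
  have h4 := h3 N hN
  simp only [mul_neg, ← neg_mul, ← div_eq_mul_inv] at h4
  exact h4

end Lift


/-! ### Rigid analyticity of the lift. -/

section RigidAnalytic

variable {p : ℕ} [Fact p.Prime]
variable {ιInf : AlgebraicClosure ℚ →+* ℂ} {ιp : AlgebraicClosure ℚ →+* ℂ_[p]}
variable {D : AlgebraicClosure ℚ →₀ ℤ} {h : ℕ}

theorem tendsto_zpow_neg : Tendsto (fun N : ℕ => (p : ℝ) ^ (-(N : ℤ))) atTop (𝓝 0) := by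
  have : Tendsto (fun N : ℕ => ((p : ℝ)⁻¹) ^ N) atTop (𝓝 0) :=
    tendsto_pow_atTop_nhds_zero_of_lt_one (by positivity) (inv_lt_one_of_one_lt₀ one_lt_prime)
  simpa [zpow_neg] using this

variable {hRM : ∀ τ ∈ D.support, IsInertRM ιInf ιp τ} {r s : OnePoint ℚ} {l : ℕ}
  {M : ℂ_[p] → ℕ → ℂ_[p]} {MInf : ℕ → ℂ_[p]} {A : ℝ} {R : ℕ → Finset ℂ_[p]}

theorem IsApproximation.tendsto_liftSum
    (hM : IsApproximation h (fun w => ιp w) (fun w => ιp (conj w)) (divisorWeight p ιInf D r s)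
      (divisorPoints hRM r s) l (R (l + 1)) M MInf A)
    (hR : ∀ l, IsReps (unramifiedQuadratic p) l (R l))
    {z : ℂ_[p]} (hz : z ∈ affinoid (unramifiedQuadratic p) l) :
    Tendsto (fun N => liftSum (unramifiedQuadratic p) (2 * h)
      (edgeFunction ιInf ιp (2 * h) D r s) (R N) N z) atTop
      (𝓝 (∑' i, -MInf i * z ^ i + ∑ a ∈ R (l + 1), ∑' i, M a i / (z - a) ^ (i + 1))) := by
  rw [← tendsto_add_atTop_iff_nat 1]
  have h0 : Tendsto (fun N => liftSum (unramifiedQuadratic p) (2 * h)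
      (edgeFunction ιInf ιp (2 * h) D r s) (R (N + 1)) (N + 1) z - kernelSum hRM h r s N z) atTop
      (𝓝 0) := by
    rw [tendsto_zero_iff_norm_tendsto_zero]
    have hlim : Tendsto (fun N : ℕ => jetBound p h * ((p : ℝ) ^ l) ^ (2 * h + 2) *
        ((p : ℝ) ^ (-((N + 1 : ℕ) : ℤ))) ^ (h + 1)) atTop (𝓝 0) := by
      have := ((tendsto_zpow_neg (p := p)).comp (tendsto_add_atTop_nat 1)).pow (h + 1)
      rw [zero_pow (Nat.succ_ne_zero h)] at this
      simpa only [mul_zero, Function.comp_apply] using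
        this.const_mul (jetBound p h * ((p : ℝ) ^ l) ^ (2 * h + 2))
    refine squeeze_zero' (Eventually.of_forall fun _ => norm_nonneg _) ?_ hlim
    filter_upwards [eventually_ge_atTop l] with N hN
    exact norm_liftSum_sub_le hRM r s hN (hR (N + 1)) hz
  have h1 := h0.add (hM.tendsto_kernelSum (hR (l + 1)) hz)
  simpa only [sub_add_cancel, zero_add] using h1

/-- The moments are bounded on discs of level l + 1, while the decay is measured on those of level
l; the difference is a factor p^(-i). -/
theorem IsApproximation.mittagLeffler
    (hM : IsApproximation h (fun w => ιp w) (fun w => ιp (conj w)) (divisorWeight p ιInf D r s)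
      (divisorPoints hRM r s) l (R (l + 1)) M MInf A)
    (hR : ∀ l, IsReps (unramifiedQuadratic p) l (R l)) :
    MittagLeffler (unramifiedQuadratic p) l (R (l + 1)) (weightKSymbol ιInf ιp (2 * h) D R r s)
      (fun i => -MInf i) M where
  decay_infty := by
    have hp0 : (0 : ℝ) < p := prime_pos
    have h1 : Tendsto (fun i : ℕ => A * ((p : ℝ)⁻¹) ^ i) atTop (𝓝 0) := by
      simpa using (tendsto_pow_atTop_nhds_zero_of_lt_one (by positivity)
        (inv_lt_one_of_one_lt₀ (one_lt_prime (p := p)))).const_mul A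
    refine squeeze_zero (fun i => by positivity) (fun i => ?_) h1
    rw [norm_neg]
    calc _ ≤ A * ((p : ℝ) ^ (-((l + 1 : ℕ) : ℤ))) ^ i * ((p : ℝ) ^ l) ^ i := by
          gcongr
          exact hM.norm_infty_le i
      _ = _ := by
        rw [mul_assoc, ← mul_pow, zpow_neg, zpow_natCast, pow_succ]
        congr 2
        field_simp
  decay a ha := by
    have hp0 : (0 : ℝ) < p := prime_pos
    have h1 : Tendsto (fun i : ℕ => A * ((p : ℝ)⁻¹) ^ i) atTop (𝓝 0) := by
      simpa using (tendsto_pow_atTop_nhds_zero_of_lt_one (by positivity)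
        (inv_lt_one_of_one_lt₀ (one_lt_prime (p := p)))).const_mul A
    refine squeeze_zero (fun i => by have := max_one_pos a; positivity) (fun i => ?_) h1
    have hma := max_one_pos a
    calc _ ≤ A * discRadius (l + 1) a ^ i * ((p : ℝ) ^ l / max 1 ‖a‖ ^ 2) ^ i := by
          gcongr
          exact hM.norm_le a ha i
      _ = _ := by
        rw [mul_assoc, ← mul_pow, discRadius, zpow_neg, zpow_natCast, pow_succ]
        congr 2
        field_simp
  eq_sum z hz := (hM.tendsto_liftSum hR hz).limUnder_eq

theorem weightKSymbol_isRigidAnalytic (hRM : ∀ τ ∈ D.support, IsInertRM ιInf ιp τ)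
    (hD : IsDegreeZero ιInf ιp (2 * h) D)
    (hR : ∀ l, IsReps (unramifiedQuadratic p) l (R l)) (r s : OnePoint ℚ) :
    IsRigidAnalytic (unramifiedQuadratic p) (weightKSymbol ιInf ιp (2 * h) D R r s) := by
  intro l
  obtain ⟨M, MInf, A, hM⟩ := (isDegreeZeroSystem hRM hD r s).exists_approximation (hR (l + 1))
  exact ⟨R (l + 1), _, M, hR (l + 1), hM.mittagLeffler hR⟩

end RigidAnalytic

/-! ### Local expansions of the logarithmic kernel. -/

section BoundaryKernel

variable {p : ℕ} [Fact p.Prime]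

open Classical in
/-- The Taylor coefficients of `boundaryKernel n L z` at `a`. -/
noncomputable def boundaryJet (n : ℕ) (L z a : ℂ_[p]) (j : ℕ) : ℂ_[p] :=
  -((n.factorial : ℂ_[p])⁻¹) * mulPowCoeff n (a - z) 1
    (logQuotCoeff (if ‖a‖ ≤ 1 then 0 else 1)
      (if ‖a‖ ≤ 1 then padicLog L (a - z) else padicLog L (1 - z / a)) a z) j

theorem norm_eq_of_norm_sub_lt {a t : ℂ_[p]} (h : ‖t - a‖ < ‖a‖) : ‖t‖ = ‖a‖ := by
  have h1 := IsUltrametricDist.norm_add_eq_max_of_norm_ne_norm h.ne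
  rw [sub_add_cancel, max_eq_right h.le] at h1
  exact h1

/-- The radius conditions keep the disc inside one branch of the definition: within the closed unit
disc, or where the norm is constant and exceeds 1. In the second branch log(1 - z/t) is log(t - z) -
log t. -/
theorem expandsAt_boundaryKernel (n : ℕ) (L z a : ℂ_[p]) {ρ : ℝ} (h0 : 0 ≤ ρ) (h1 : ρ < ‖a - z‖)
    (h2 : ‖a‖ ≤ 1 → ρ ≤ 1) (h3 : 1 < ‖a‖ → ρ < ‖a‖) :
    ExpandsAt (boundaryKernel n L z) a ρ (boundaryJet n L z a) := by
  have hlog : ExpandsAt (fun t => padicLog L (t - z)) a ρ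
      (logCoeff (padicLog L (a - z)) (a - z)) := by
    intro t ht
    have := expandsAt_padicLog L (a - z) h1 (t - z) (by rwa [sub_sub_sub_cancel_right])
    rwa [sub_sub_sub_cancel_right] at this
  have hz : ∀ t, ‖t - a‖ ≤ ρ → t - z ≠ 0 := by
    intro t ht htz
    rw [sub_eq_zero] at htz
    rw [← htz, norm_sub_rev] at h1
    exact absurd ht (not_le.mpr h1)
  rcases le_or_gt ‖a‖ 1 with ha | ha
  · have e : logCoeff (padicLog L (a - z)) (a - z) =
        logQuotCoeff 0 (padicLog L (a - z)) a z := by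
      funext j
      rw [logCoeff, logQuotCoeff]
      split_ifs
      · rfl
      · rw [zero_mul, sub_zero, div_mul_eq_mul_div, div_mul_eq_div_div, div_eq_mul_inv, div_eq_mul_inv,
          div_eq_mul_inv]
        ring
    rw [e] at hlog
    have hcongr := ((hlog.mul_pow_sub n z).const_mul (-((n.factorial : ℂ_[p])⁻¹))).congr
      (g' := boundaryKernel n L z) (fun t ht => by
      have : ‖t‖ ≤ 1 := by
        rw [← sub_add_cancel t a]
        exact (IsUltrametricDist.norm_add_le_max _ _).trans (max_le (ht.trans (h2 ha)) ha)
      rw [boundaryKernel, if_pos this, mul_assoc])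
    intro t ht
    simpa only [boundaryJet, if_pos ha] using hcongr t ht
  · have hza : a ≠ 0 := norm_pos_iff.mp (zero_lt_one.trans ha)
    have hlog2 := hlog.sub (expandsAt_padicLog L a (h3 ha))
    have e : (fun j => logCoeff (padicLog L (a - z)) (a - z) j - logCoeff (padicLog L a) a j) =
        logQuotCoeff 1 (padicLog L (1 - z / a)) a z := by
      funext j
      rw [logCoeff, logCoeff, logQuotCoeff]
      split_ifs with hj
      · rw [one_sub_div hza, padicLog_div L (hz a (by simpa using h0)) hza]
      · rw [one_mul]
        simp only [div_eq_mul_inv, mul_inv]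
        ring
    rw [e] at hlog2
    have hcongr := ((hlog2.mul_pow_sub n z).const_mul (-((n.factorial : ℂ_[p])⁻¹))).congr
      (g' := boundaryKernel n L z) (fun t ht => by
      have hta : ‖t‖ = ‖a‖ := norm_eq_of_norm_sub_lt (ht.trans_lt (h3 ha))
      have ht0 : t ≠ 0 := norm_pos_iff.mp (hta ▸ zero_lt_one.trans ha)
      rw [boundaryKernel, if_neg (by rw [hta]; exact not_le.mpr ha), mul_assoc, one_sub_div ht0,
        padicLog_div L (hz t ht) ht0])
    intro t ht
    simpa only [boundaryJet, if_neg (not_le.mpr ha)] using hcongr t ht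

/-- The Taylor coefficients at `s = 0` of `s ^ n * l_z (s⁻¹)`, where `l_z = boundaryKernel n L z`. -/
noncomputable def boundaryJetInfty (n : ℕ) (z : ℂ_[p]) (j : ℕ) : ℂ_[p] :=
  -((n.factorial : ℂ_[p])⁻¹) * mulPowCoeff n 1 (-z) (fun q => logCoeff 0 1 q * (-z) ^ q) j

theorem hasSum_boundaryJetInfty (n : ℕ) (L : ℂ_[p]) {z t : ℂ_[p]} (hz : ‖z‖ < ‖t‖) (ht : 1 < ‖t‖) :
    HasSum (fun j => boundaryJetInfty n z j * (t⁻¹) ^ j) ((t⁻¹) ^ n * boundaryKernel n L z t) := by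
  have ht0' : 0 < ‖t‖ := zero_lt_one.trans ht
  have ht0 : t ≠ 0 := norm_pos_iff.mp ht0'
  have hlt : ‖-(z / t)‖ < 1 := by rwa [norm_neg, norm_div, div_lt_one ht0']
  have e0 : 1 - z / t - 1 = -(z / t) := by ring
  have h1 : HasSum (fun j => logCoeff 0 1 j * (-z) ^ j * (t⁻¹) ^ j) (padicLog L (1 - z / t)) := by
    rw [padicLog_of_norm_sub_one_lt L (by rwa [e0]), e0]
    refine hasSum_of_eq (expandsAt_logOneAdd hlt (-(z / t)) (by rw [sub_zero])) (fun j => ?_) rfl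
    rw [sub_zero, mul_assoc, ← mul_pow]
    congr 2
    ring
  refine hasSum_of_eq ((hasSum_mulPowCoeff n 1 (-z) t⁻¹ _ _ h1).mul_left
    (-((n.factorial : ℂ_[p])⁻¹))) (fun j => ?_) ?_
  · rw [boundaryJetInfty, mul_assoc]
  · rw [boundaryKernel, if_neg (not_le.mpr ht)]
    have e1 : (t⁻¹) ^ n * (t - z) ^ n = (1 + -z * t⁻¹) ^ n := by
      rw [← mul_pow]
      congr 1
      field_simp
      ring
    rw [← e1]
    ring

/-- The polynomial part at `∞` of `boundaryKernel n L z`. -/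
noncomputable def boundaryPoly (n : ℕ) (z : ℂ_[p]) : ℂ_[p][X] :=
  ∑ j ∈ Finset.range (n + 1), C (boundaryJetInfty n z j) * X ^ (n - j)

theorem natDegree_boundaryPoly_le (n : ℕ) (z : ℂ_[p]) : (boundaryPoly n z).natDegree ≤ n := by
  refine natDegree_sum_le_of_forall_le _ _ fun j _ => ?_
  exact (natDegree_C_mul_X_pow_le _ _).trans (Nat.sub_le _ _)

/-- The terms of index at most n of the expansion in 1/t form the polynomial part after
multiplication by t^n; index n + 1 + i becomes t^(-i-1). -/
theorem hasSum_boundaryKernel_infty (n : ℕ) (L : ℂ_[p]) {z t : ℂ_[p]} (hz : ‖z‖ < ‖t‖)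
    (ht : 1 < ‖t‖) :
    HasSum (fun i => boundaryJetInfty n z (n + 1 + i) * (t ^ (i + 1))⁻¹)
      (boundaryKernel n L z t - (boundaryPoly n z).eval t) := by
  have ht0 : t ≠ 0 := norm_pos_iff.mp (zero_lt_one.trans ht)
  have h1 := ((hasSum_boundaryJetInfty n L hz ht).mul_left (t ^ n))
  have h2 := (hasSum_nat_add_iff' (n + 1)).mpr h1
  refine hasSum_of_eq h2 (fun i => ?_) ?_
  · rw [show i + (n + 1) = n + 1 + i by ring, mul_left_comm]
    congr 1
    rw [show n + 1 + i = n + (i + 1) by ring, pow_add (t⁻¹), ← mul_assoc, ← mul_pow,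
      mul_inv_cancel₀ ht0, one_pow, one_mul, inv_pow]
  · rw [← mul_assoc, ← mul_pow, mul_inv_cancel₀ ht0, one_pow, one_mul, boundaryPoly,
      eval_finsetSum]
    congr 1
    refine Finset.sum_congr rfl fun j hj => ?_
    have hjn : j ≤ n := Nat.lt_succ_iff.mp (Finset.mem_range.mp hj)
    rw [eval_mul, eval_C, eval_pow, eval_X, mul_left_comm]
    congr 1
    nth_rewrite 2 [← Nat.sub_add_cancel hjn]
    rw [pow_add, mul_assoc, ← mul_pow, mul_inv_cancel₀ ht0, one_pow, mul_one]

theorem norm_neg_inv_factorial_mul_le {n : ℕ} {x : ℂ_[p]} {y : ℝ} (h : ‖x‖ ≤ y) :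
    ‖-((n.factorial : ℂ_[p])⁻¹) * x‖ ≤ ‖(n.factorial : ℂ_[p])⁻¹‖ * y := by
  rw [norm_mul, norm_neg]
  gcongr

theorem norm_mulPowCoeff_le {n : ℕ} {α β : ℂ_[p]} {c : ℕ → ℂ_[p]} {j : ℕ} {B : ℝ} (hB : 0 ≤ B)
    (h : ∀ k ≤ n, k ≤ j → ‖α‖ ^ (n - k) * ‖β‖ ^ k * ‖c (j - k)‖ ≤ B) :
    ‖mulPowCoeff n α β c j‖ ≤ B := by
  refine norm_sum_le_of_forall hB fun k hk => ?_
  split_ifs with hkj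
  · refine le_trans ?_ (h k (Nat.lt_succ_iff.mp (Finset.mem_range.mp hk)) hkj)
    rw [norm_mul, norm_mul, norm_mul, norm_pow, norm_pow, mul_assoc, mul_assoc, mul_assoc]
    exact mul_le_of_le_one_left (by positivity) (norm_natCast_le_one' _)
  · rwa [norm_zero]

theorem norm_boundaryJetInfty_le (n : ℕ) {z : ℂ_[p]} {Y : ℝ} (hz : ‖z‖ ≤ Y) (j : ℕ) :
    ‖boundaryJetInfty n z j‖ ≤ ‖(n.factorial : ℂ_[p])⁻¹‖ * (j * Y ^ j) := by
  have hY : 0 ≤ Y := (norm_nonneg z).trans hz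
  refine norm_neg_inv_factorial_mul_le (norm_mulPowCoeff_le (by positivity) fun k _ hkj => ?_)
  rw [norm_one, one_pow, one_mul, norm_neg, norm_mul, norm_pow, norm_neg]
  have h1 : ‖logCoeff (0 : ℂ_[p]) 1 (j - k)‖ ≤ j := by
    by_cases h0 : j - k = 0
    · rw [h0, logCoeff, if_pos rfl, norm_zero]
      positivity
    · refine (norm_logCoeff_le 0 1 h0).trans ?_
      rw [norm_one, inv_one, one_pow, mul_one]
      exact_mod_cast Nat.sub_le j k
  calc _ = ‖logCoeff (0 : ℂ_[p]) 1 (j - k)‖ * ‖z‖ ^ j := by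
        rw [mul_left_comm, ← pow_add, Nat.add_sub_cancel' hkj]
    _ ≤ _ := by gcongr

theorem norm_logQuotCoeff_mul_le {θ x a z : ℂ_[p]} {ρ κ : ℝ} (hρ : 0 ≤ ρ)
    (hza : a - z ≠ 0) (h1 : ρ ≤ κ * ‖a - z‖) (h2 : θ = 0 ∨ θ = 1 ∧ a ≠ 0 ∧ ρ ≤ κ * ‖a‖) {q : ℕ}
    (hq : q ≠ 0) : ‖logQuotCoeff θ x a z q‖ * ρ ^ q ≤ q * κ ^ q := by
  have key : ∀ y : ℂ_[p], y ≠ 0 → ρ ≤ κ * ‖y‖ → ‖(y ^ q)⁻¹‖ * ρ ^ q ≤ κ ^ q := by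
    intro y hy hρy
    have hy' : 0 < ‖y‖ := norm_pos_iff.mpr hy
    rw [norm_inv, norm_pow, inv_mul_le_iff₀ (by positivity), ← mul_pow, mul_comm]
    gcongr
  have h3 : ‖((a - z) ^ q)⁻¹ - θ * (a ^ q)⁻¹‖ * ρ ^ q ≤ κ ^ q := by
    rcases h2 with rfl | ⟨rfl, ha, h4⟩
    · rw [zero_mul, sub_zero]
      exact key _ hza h1
    · rw [one_mul]
      calc _ ≤ max ‖((a - z) ^ q)⁻¹‖ ‖(a ^ q)⁻¹‖ * ρ ^ q := by
            gcongr
            exact norm_sub_le_max' _ _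
        _ = max (‖((a - z) ^ q)⁻¹‖ * ρ ^ q) (‖(a ^ q)⁻¹‖ * ρ ^ q) :=
          max_mul_of_nonneg _ _ (by positivity)
        _ ≤ _ := max_le (key _ hza h1) (key _ ha h4)
  rw [logQuotCoeff, if_neg hq, norm_mul, div_eq_mul_inv, norm_mul, mul_assoc]
  have h5 : ‖((-1 : ℂ_[p]) ^ (q + 1))‖ = 1 := by simp
  rw [h5, one_mul]
  gcongr
  exact norm_inv_natCast_le q

/-- For i > n every term of the Cauchy product uses a logarithm coefficient of positive index. Hence
neither L nor the value of the logarithm enters, and the bound depends on z only through Y and κ. -/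
theorem norm_boundaryJet_mul_le (n : ℕ) (L : ℂ_[p]) {z a : ℂ_[p]} {ρ κ Y : ℝ} (hρ : 0 ≤ ρ)
    (hκ : 0 < κ) (hκ1 : κ ≤ 1) (hza : a - z ≠ 0) (hY : ‖a - z‖ ≤ Y) (h1 : ρ ≤ κ * ‖a - z‖)
    (h2 : 1 < ‖a‖ → ρ ≤ κ * ‖a‖) {i : ℕ} (hi : n < i) :
    ‖boundaryJet n L z a i‖ * ρ ^ i ≤
      ‖(n.factorial : ℂ_[p])⁻¹‖ * (Y ^ n * (i * κ ^ i / κ ^ n)) := by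
  have hY0 : 0 ≤ Y := (norm_nonneg _).trans hY
  rcases hρ.eq_or_lt with h0 | hρ0
  · rw [← h0, zero_pow (by omega), mul_zero]
    positivity
  rw [← le_div_iff₀ (by positivity), mul_div_assoc]
  refine norm_neg_inv_factorial_mul_le (norm_mulPowCoeff_le (by positivity) fun k hk hki => ?_)
  rw [norm_one, one_pow, mul_one, le_div_iff₀ (by positivity)]
  have hρY : ρ ≤ Y := (h1.trans (mul_le_of_le_one_left (norm_nonneg _) hκ1)).trans hY
  have hlog := norm_logQuotCoeff_mul_le (x := if ‖a‖ ≤ 1 then padicLog L (a - z) else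
    padicLog L (1 - z / a)) (θ := if ‖a‖ ≤ 1 then 0 else 1) hρ hza h1 (by
      split_ifs with ha
      · exact Or.inl rfl
      · rw [not_le] at ha
        exact Or.inr ⟨rfl, norm_pos_iff.mp (zero_lt_one.trans ha), h2 ha⟩)
      (show i - k ≠ 0 by omega)
  rw [show ρ ^ i = ρ ^ k * ρ ^ (i - k) by rw [← pow_add, Nat.add_sub_cancel' hki]]
  calc _ = ‖a - z‖ ^ (n - k) * ρ ^ k * (‖logQuotCoeff (if ‖a‖ ≤ 1 then 0 else 1)
          (if ‖a‖ ≤ 1 then padicLog L (a - z) else padicLog L (1 - z / a)) a z (i - k)‖ *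
          ρ ^ (i - k)) := by ring
    _ ≤ Y ^ (n - k) * Y ^ k * ((i - k : ℕ) * κ ^ (i - k)) := by gcongr
    _ = Y ^ n * ((i - k : ℕ) * κ ^ (i - k)) := by rw [← pow_add, Nat.sub_add_cancel hk]
    _ ≤ Y ^ n * (i * κ ^ (i - n)) := by
      gcongr ?_ * (?_ * ?_)
      · exact_mod_cast Nat.sub_le i k
      · exact pow_le_pow_of_le_one hκ.le hκ1 (by omega)
    _ = _ := by
      rw [mul_div_assoc, pow_sub₀ κ hκ.ne' hi.le, div_eq_mul_inv]

end BoundaryKernel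


/-! ### Bounds for the logarithmic kernel, uniform on affinoids. -/

section BoundaryExpansion

variable {p : ℕ} [Fact p.Prime] {F : IntermediateField ℚ_[p] ℂ_[p]} {l : ℕ} {R : Finset ℂ_[p]}

theorem tendsto_const_mul_self_mul_pow (n : ℕ) (x y : ℝ) {κ : ℝ} (h0 : 0 ≤ κ) (h1 : κ < 1) :
    Tendsto (fun i : ℕ => x * (y * (i * κ ^ i / κ ^ n))) atTop (𝓝 0) := by
  have h := (((tendsto_self_mul_const_pow_of_lt_one h0 h1).div_const (κ ^ n)).const_mul y).const_mul x
  simpa using h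

theorem exists_bound_of_tendsto {u : ℕ → ℝ} (h : Tendsto u atTop (𝓝 0)) : ∃ b, 0 ≤ b ∧ ∀ i, u i ≤ b := by
  obtain ⟨b, hb⟩ := h.bddAbove_range
  exact ⟨max b 0, le_max_right _ _, fun i => le_max_of_le_left (hb ⟨i, rfl⟩)⟩

theorem norm_lt_of_lt_projDist_infty {m : ℕ} {a : ℂ_[p]}
    (ha : (p : ℝ) ^ (-(m : ℤ)) < projDist OnePoint.infty (a : OnePoint ℂ_[p])) :
    ‖a‖ < (p : ℝ) ^ m := by
  rw [projDist_infty_coe, zpow_neg, zpow_natCast, one_div,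
    inv_lt_inv₀ (pow_pos prime_pos _) (max_one_pos a)] at ha
  exact (le_max_right _ _).trans_lt ha

theorem expandsAt_boundaryKernel_disc (n : ℕ) (L : ℂ_[p]) {z : ℂ_[p]} (hz : z ∈ affinoid F l)
    {a : ℂ_[p]} (ha : a ∈ F)
    (hainf : (p : ℝ) ^ (-((l + 1 : ℕ) : ℤ)) < projDist OnePoint.infty (a : OnePoint ℂ_[p])) :
    ExpandsAt (boundaryKernel n L z) a (discRadius (l + 1) a) (boundaryJet n L z a) := by
  refine expandsAt_boundaryKernel n L z a (discRadius_pos _ _).le ?_ (fun h => ?_) (fun h => ?_)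
  · rw [norm_sub_rev]
    exact discRadius_lt (Nat.lt_succ_self l) hz ha hainf
  · rw [discRadius, max_eq_left h, one_pow, mul_one]
    exact (zpow_neg_lt_one (Nat.succ_pos l)).le
  · exact (discRadius_le_discRatio_mul_norm h).trans_lt
      (mul_lt_of_lt_one_left (zero_lt_one.trans h) (discRatio_lt_one hainf))

/-- One constant serves all z in the affinoid, and this gives uniform convergence. It is possible
because only coefficients of index above 2h on finite discs and the principal part at ∞ are bounded;
the rest is handled by stationary moments and by removing the polynomial part. -/
theorem exists_boundedExpansion_boundaryKernel (h : ℕ) (L : ℂ_[p]) (hR : IsReps F (l + 1) R) :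
    ∃ B, ∀ z ∈ affinoid F l, BoundedExpansion h (l + 1) R
      (fun t => boundaryKernel (2 * h) L z t - (boundaryPoly (2 * h) z).eval t)
      (fun a j => boundaryJet (2 * h) L z a j - (taylor a (boundaryPoly (2 * h) z)).coeff j)
      (fun i => boundaryJetInfty (2 * h) z (2 * h + 1 + i)) B := by
  have hp0 : (0 : ℝ) < p := prime_pos
  have hp1 : (1 : ℝ) ≤ p := one_lt_prime.le
  obtain ⟨Kf, hKf⟩ : ∃ Kf, Kf = ‖((2 * h).factorial : ℂ_[p])⁻¹‖ := ⟨_, rfl⟩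
  have hKf0 : 0 ≤ Kf := hKf ▸ norm_nonneg _
  have hv : ∀ a, ∃ b, 0 ≤ b ∧ (a ∈ R → ∀ i : ℕ, Kf * (((p : ℝ) ^ (l + 1)) ^ (2 * h) *
      (i * discRatio (l + 1) a ^ i / discRatio (l + 1) a ^ (2 * h))) ≤ b) := by
    intro a
    by_cases ha : a ∈ R
    · obtain ⟨b, hb0, hb⟩ := exists_bound_of_tendsto (tendsto_const_mul_self_mul_pow (2 * h) Kf
        (((p : ℝ) ^ (l + 1)) ^ (2 * h)) (discRatio_pos (l + 1) a).le
        (discRatio_lt_one (hR.lt_projDist_infty ha)))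
      exact ⟨b, hb0, fun _ => hb⟩
    · exact ⟨0, le_rfl, fun h => absurd h ha⟩
  choose b hb0 hb using hv
  have hulim : Tendsto (fun i : ℕ => Kf * ((2 * h + 1 + i : ℕ) * ((p : ℝ) ^ l) ^ (2 * h + 1 + i)) *
      ((p : ℝ) ^ (-((l + 1 : ℕ) : ℤ))) ^ i) atTop (𝓝 0) := by
    have hlt : (p : ℝ)⁻¹ < 1 := inv_lt_one_of_one_lt₀ one_lt_prime
    have h1 := tendsto_self_mul_const_pow_of_lt_one (inv_nonneg.mpr hp0.le) hlt
    have h2 := (tendsto_pow_atTop_nhds_zero_of_lt_one (inv_nonneg.mpr hp0.le) hlt).const_mul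
      ((2 * h + 1 : ℕ) : ℝ)
    have h3 := (h2.add h1).const_mul (Kf * ((p : ℝ) ^ l) ^ (2 * h + 1))
    rw [mul_zero, add_zero, mul_zero] at h3
    refine h3.congr fun i => ?_
    rw [zpow_neg, zpow_natCast, pow_add _ (2 * h + 1) i, pow_succ (p : ℝ) l, inv_pow, inv_pow, mul_pow]
    push_cast
    field_simp
  obtain ⟨bInf, hbInf0, hbInf⟩ := exists_bound_of_tendsto hulim
  have hB0 : 0 ≤ bInf + ∑ a ∈ R, b a := add_nonneg hbInf0 (Finset.sum_nonneg fun a _ => hb0 a)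
  refine ⟨bInf + ∑ a ∈ R, b a, fun z hz => ?_⟩
  have hzn := norm_le_of_mem_affinoid hz
  have hinf : ∀ i, ‖boundaryJetInfty (2 * h) z (2 * h + 1 + i)‖ *
      ((p : ℝ) ^ (-((l + 1 : ℕ) : ℤ))) ^ i ≤
      Kf * ((2 * h + 1 + i : ℕ) * ((p : ℝ) ^ l) ^ (2 * h + 1 + i)) *
      ((p : ℝ) ^ (-((l + 1 : ℕ) : ℤ))) ^ i := by
    intro i
    gcongr
    rw [hKf]
    exact norm_boundaryJetInfty_le _ hzn _
  have hdeg := natDegree_boundaryPoly_le (2 * h) z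
  have hfin : ∀ a ∈ R, ∀ i, 2 * h < i →
      ‖boundaryJet (2 * h) L z a i - (taylor a (boundaryPoly (2 * h) z)).coeff i‖ *
        discRadius (l + 1) a ^ i ≤ Kf * (((p : ℝ) ^ (l + 1)) ^ (2 * h) *
          (i * discRatio (l + 1) a ^ i / discRatio (l + 1) a ^ (2 * h))) := by
    intro a ha i hi
    have haF := hR.1 a ha
    have hainf := hR.lt_projDist_infty ha
    have hza := norm_sub_pos_of_mem_affinoid hz haF
    -- The polynomial part has degree at most 2h, so it does not affect the coefficients being
    -- bounded.
    rw [coeff_eq_zero_of_natDegree_lt (by rw [natDegree_taylor]; omega), sub_zero, hKf]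
    refine norm_boundaryJet_mul_le (2 * h) L (discRadius_pos _ _).le (discRatio_pos _ _)
      (discRatio_lt_one hainf).le ?_ ?_ ?_ (fun h => discRadius_le_discRatio_mul_norm h) hi
    · rwa [← norm_pos_iff, norm_sub_rev]
    · refine (norm_sub_le_max' _ _).trans (max_le (norm_lt_of_lt_projDist_infty hainf).le
        (hzn.trans (pow_le_pow_right₀ hp1 (Nat.le_succ l))))
    · rw [norm_sub_rev]
      exact discRadius_le_discRatio_mul (Nat.lt_succ_self l) hz haF
  refine ⟨hB0, fun a ha => ?_, fun a ha => ?_, fun a ha i hi => ?_, fun t ht => ?_, ?_, fun i => ?_⟩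
  · exact (expandsAt_boundaryKernel_disc (2 * h) L hz (hR.1 a ha) (hR.lt_projDist_infty ha)).sub
      (expandsAt_polynomial _ a _)
  · refine squeeze_zero' (Eventually.of_forall fun i => ?_) ?_
      (tendsto_const_mul_self_mul_pow (2 * h) Kf
        (((p : ℝ) ^ (l + 1)) ^ (2 * h)) (discRatio_pos (l + 1) a).le
        (discRatio_lt_one (hR.lt_projDist_infty ha)))
    · have := discRadius_pos (l + 1) a
      positivity
    · filter_upwards [eventually_gt_atTop (2 * h)] with i hi
      exact hfin a ha i hi
  · refine (hfin a ha i hi).trans ((hb a ha i).trans ?_)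
    have := Finset.single_le_sum (f := b) (fun a _ => hb0 a) ha
    linarith
  · have ht1 : 1 < ‖t‖ := (one_lt_pow₀ one_lt_prime (Nat.succ_ne_zero l)).trans_le ht
    exact hasSum_boundaryKernel_infty (2 * h) L
      (hzn.trans_lt ((pow_lt_pow_right₀ one_lt_prime (Nat.lt_succ_self l)).trans_le ht)) ht1
  · exact squeeze_zero (fun i => by positivity) hinf hulim
  · refine ((hinf i).trans (hbInf i)).trans ?_
    have := Finset.sum_nonneg fun a (_ : a ∈ R) => hb0 a
    linarith

theorem BoundedExpansion.localExpansion {h : ℕ} (hR : IsReps F (l + 1) R) {g : ℂ_[p] → ℂ_[p]}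
    {G : ℂ_[p][X]} (hG : G.natDegree ≤ 2 * h) {e : ℂ_[p] → ℕ → ℂ_[p]} {eInf : ℕ → ℂ_[p]} {B : ℝ}
    (hg : BoundedExpansion h (l + 1) R (fun t => g t - G.eval t) e eInf B) :
    LocalExpansion F (2 * h) l R g G eInf e where
  natDegree_le := hG
  hasSum a ha t _ hat := by
    have hat' : projDist (a : OnePoint ℂ_[p]) (t : OnePoint ℂ_[p]) ≤
        (p : ℝ) ^ (-((l + 1 : ℕ) : ℤ)) := by exact_mod_cast hat
    exact hg.expandsAt a ha t (projDist_le_imp hat' (hR.lt_projDist_infty ha)).2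
  hasSum_infty t _ ht := by
    have ht' : projDist OnePoint.infty (t : OnePoint ℂ_[p]) ≤
        (p : ℝ) ^ (-((l + 1 : ℕ) : ℤ)) := by exact_mod_cast ht
    exact hg.hasSum_infty t ((projDist_infty_le_iff (Nat.succ_pos l)).mp ht')

end BoundaryExpansion

/-! ### Vanishing on polynomials. -/

section DegreeZero

variable {p : ℕ} [Fact p.Prime] {ι : Type*} {h : ℕ} {w w' : ι → ℂ_[p]} {c : ι → ℤ} {S : ℕ → Finset ι}

/-- A degree-zero system annihilates polynomials of degree at most `2 * h`. -/
theorem IsDegreeZeroSystem.sum_polynomial_eq_zero (hS : IsDegreeZeroSystem h w w' c S) (N : ℕ)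
    {Q : ℂ_[p][X]} (hQ : Q.natDegree ≤ 2 * h) :
    ∑ x ∈ S N, (c x : ℂ_[p]) * jetFun h (w x - w' x) (fun j => (taylor (w x) Q).coeff j) = 0 := by
  classical
  set f : ι → ℂ_[p] := fun x =>
    (c x : ℂ_[p]) * jetFun h (w x - w' x) (fun j => (taylor (w x) Q).coeff j)
  obtain ⟨P, hP⟩ : ∃ P : ι → Prop, ∀ x, P x := ⟨fun _ => True, fun _ => trivial⟩
  have hlevel : ∀ N : ℕ,
      ∑ x ∈ S N with treeRadius (w x) (w' x) = (p : ℝ) ^ (-(N : ℤ)) ∧ P x, f x = 0 := by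
    intro N
    rw [← norm_le_zero_iff]
    refine hS.norm_sum_level_le N P (fun _ _ x _ _ _ _ _ => hP x)
      (fun x j => (taylor (w x) Q).coeff j) le_rfl fun u _ _ _ => ⟨Q, hQ, fun x _ _ _ => ?_⟩
    rw [sub_self, norm_zero]
  induction N with
  | zero =>
    rw [← hlevel 0, Finset.filter_true_of_mem]
    intro x hx
    obtain ⟨M, hM⟩ := (hS.pair 0 x hx).exists_level
    have h1 := (hS.mem_iff 0 0 x hx).mp hx
    rw [hM, zpow_neg_le_iff] at h1
    rw [hM, Nat.le_zero.mp h1]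
    exact ⟨rfl, hP x⟩
  | succ N ih =>
    have h1 := hS.sum_succ N P f
    rw [hlevel (N + 1), add_zero, Finset.filter_true_of_mem (fun x _ => hP x),
      Finset.filter_true_of_mem (fun x _ => hP x)] at h1
    rw [h1, ih]

end DegreeZero


/-! ### Comparison of the explicit sum with the Morita pairing. -/

section MainResult

variable {p : ℕ} [Fact p.Prime]
variable {ιInf : AlgebraicClosure ℚ →+* ℂ} {ιp : AlgebraicClosure ℚ →+* ℂ_[p]}
variable {D : AlgebraicClosure ℚ →₀ ℤ} {h : ℕ}

/-- The explicit summand is minus the value of the functional attached to `w` on the boundary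
kernel. -/
theorem explicit_summand_eq (L : ℂ_[p]) {w w' z : ℂ_[p]} (hw : w - w' ≠ 0) (hwz : w - z ≠ 0) :
    ((2 * h).factorial : ℂ_[p])⁻¹ * ((z - w) ^ h * (z - w') ^ h / (w - w') ^ h *
      padicLog L (tFun w z) + correction (2 * h) w w' z) =
      -jetFun h (w - w') (boundaryJet (2 * h) L z w) := by
  have e : padicLog L (tFun w z) =
      if ‖w‖ ≤ 1 then padicLog L (w - z) else padicLog L (1 - z / w) := by
    rw [tFun]
    split_ifs
    · rw [← neg_sub, padicLog_neg]
    · rw [← neg_sub, padicLog_neg]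
  have e2 : boundaryJet (2 * h) L z w = fun j => -((2 * h).factorial : ℂ_[p])⁻¹ *
      mulPowCoeff (2 * h) (w - z) 1 (logQuotCoeff (if ‖w‖ ≤ 1 then 0 else 1)
        (padicLog L (tFun w z)) w z) j := by
    rw [e]
    funext j
    rfl
  rw [e2, jetFun_const_mul, jetFun_mulPowCoeff_logQuotCoeff hw, ← correction_eq hwz _ rfl]
  ring

theorem explicitSum_eq_neg (hRM : ∀ τ ∈ D.support, IsInertRM ιInf ιp τ) (L : ℂ_[p])
    (r s : OnePoint ℚ) (N : ℕ) {z : ℂ_[p]} (hz : z ∈ upperHalf (unramifiedQuadratic p)) :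
    explicitSum ιInf ιp (2 * h) L D r s N z =
      -∑ w ∈ divisorPoints hRM r s N, (divisorWeight p ιInf D r s w : ℂ_[p]) *
        jetFun h (ιp w - ιp (conj w)) (boundaryJet (2 * h) L z (ιp w)) := by
  rw [explicitSum_eq hRM, Finset.mul_sum, ← Finset.sum_neg_distrib]
  refine Finset.sum_congr rfl fun w hw => ?_
  have hwp := isConjPair_of_mem hRM hw
  have hwz : ιp w - z ≠ 0 := fun h0 => hz (sub_eq_zero.mp h0 ▸ hwp.mem)
  rw [mul_left_comm, explicit_summand_eq L (norm_pos_iff.mp hwp.norm_sub_pos) hwz, mul_neg]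

/-- The moments are the coefficients of J, with opposite sign at ∞. Multiplying them with the local
coefficients of l_z therefore computes minus the residue pairing and, at the same time, minus the
limit of the explicit sums. The constant does not depend on z in the affinoid. -/
theorem exists_moritaPairing_approximation (hRM : ∀ τ ∈ D.support, IsInertRM ιInf ιp τ)
    (hD : IsDegreeZero ιInf ιp (2 * h) D) {R : ℕ → Finset ℂ_[p]}
    (hR : ∀ l, IsReps (unramifiedQuadratic p) l (R l)) (L : ℂ_[p]) (r s : OnePoint ℚ) (l : ℕ) :
    ∃ B : ℝ, ∀ z ∈ affinoid (unramifiedQuadratic p) l, ∃ x : ℂ_[p],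
      IsMoritaPairing (unramifiedQuadratic p) (2 * h) (weightKSymbol ιInf ιp (2 * h) D R r s)
        (boundaryKernel (2 * h) L z) x ∧
      ∀ N, l ≤ N → ‖explicitSum ιInf ιp (2 * h) L D r s N z - x‖ ≤ B * (p : ℝ) ^ (-(N : ℤ)) := by
  have hS := isDegreeZeroSystem hRM hD r s
  obtain ⟨M, MInf, A, hM⟩ := hS.exists_approximation (hR (l + 1))
  obtain ⟨B, hB⟩ := exists_boundedExpansion_boundaryKernel h L (hR (l + 1))
  refine ⟨A * B, fun z hz => ?_⟩
  have hzu := affinoid_subset_upperHalf _ _ hz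
  have hG := natDegree_boundaryPoly_le (2 * h) z
  obtain ⟨h1, h2, h3⟩ := hM.approx _ _ _ _ (fun w j => boundaryJet (2 * h) L z (ιp w) j -
    (taylor (ιp w) (boundaryPoly (2 * h) z)).coeff j) (hB z hz) (fun N w hw => by
      have hwp := isConjPair_of_mem hRM hw
      have h0 := norm_sub_pos_of_mem_affinoid hz hwp.mem
      rw [norm_sub_rev] at h0
      -- Small enough to avoid z and to stay in one branch of the kernel, for both |w| ≤ 1 and |w| >
      -- 1.
      refine ⟨min (1 / 2) (‖ιp w - z‖ / 2), by positivity, ?_⟩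
      refine (expandsAt_boundaryKernel (2 * h) L z (ιp w) (by positivity)
        ((min_le_right _ _).trans_lt (half_lt_self h0)) (fun _ => ?_) (fun h1 => ?_)).sub
        (expandsAt_polynomial _ _ _)
      · exact (min_le_left _ _).trans (by norm_num)
      · exact (min_le_left _ _).trans_lt (by linarith))
  refine ⟨-(∑' i, MInf i * boundaryJetInfty (2 * h) z (2 * h + 1 + i) + ∑ a ∈ R (l + 1),
    ∑' i, M a i * (boundaryJet (2 * h) L z a i -
      (taylor a (boundaryPoly (2 * h) z)).coeff i)), ?_, fun N hN => ?_⟩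
  · refine ⟨weightKSymbol_isRigidAnalytic hRM hD hR r s, l, R (l + 1), _, M, _, _, _, _, _,
      hR (l + 1), hM.mittagLeffler hR, (hB z hz).localExpansion (hR (l + 1)) hG,
      hasSum_of_eq h1.hasSum.neg (fun i => neg_mul _ _) rfl, fun a ha => (h2 a ha).hasSum, ?_⟩
    rw [neg_add, sub_eq_add_neg]
  · have h4 := h3 N hN
    -- Subtracting the polynomial part of l_z at ∞ leaves the finite sums unchanged, by degree zero.
    have h5 : ∑ w ∈ divisorPoints hRM r s N, (divisorWeight p ιInf D r s w : ℂ_[p]) *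
        jetFun h (ιp w - ιp (conj w)) (fun j => boundaryJet (2 * h) L z (ιp w) j -
          (taylor (ιp w) (boundaryPoly (2 * h) z)).coeff j) =
        -explicitSum ιInf ιp (2 * h) L D r s N z := by
      rw [explicitSum_eq_neg hRM L r s N hzu, neg_neg]
      simp only [jetFun_sub, mul_sub, Finset.sum_sub_distrib]
      rw [hS.sum_polynomial_eq_zero N hG, sub_zero]
    rw [h5, neg_sub_left] at h4
    rwa [norm_sub_rev, neg_sub_left, add_comm]

theorem main_even (hRM : ∀ τ ∈ D.support, IsInertRM ιInf ιp τ)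
    (hD : IsDegreeZero ιInf ιp (2 * h) D) {R : ℕ → Finset ℂ_[p]}
    (hR : ∀ l, IsReps (unramifiedQuadratic p) l (R l)) (L : ℂ_[p]) (r s : OnePoint ℚ) :
    (∀ z ∈ upperHalf (unramifiedQuadratic p),
      Tendsto (fun l : ℕ => liftSum (unramifiedQuadratic p) (2 * h)
        (edgeFunction ιInf ιp (2 * h) D r s) (R l) l z) atTop
        (𝓝 (weightKSymbol ιInf ιp (2 * h) D R r s z))) ∧
    ∃ JL : ℂ_[p] → ℂ_[p],
      (∀ z ∈ upperHalf (unramifiedQuadratic p),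
        IsMoritaPairing (unramifiedQuadratic p) (2 * h) (weightKSymbol ιInf ιp (2 * h) D R r s)
          (boundaryKernel (2 * h) L z) (JL z)) ∧
      (∀ z ∈ upperHalf (unramifiedQuadratic p),
        Tendsto (fun l : ℕ => explicitSum ιInf ιp (2 * h) L D r s l z) atTop (𝓝 (JL z))) ∧
      (∀ m : ℕ, TendstoUniformlyOn
        (fun (l : ℕ) (z : ℂ_[p]) => explicitSum ιInf ιp (2 * h) L D r s l z) JL atTop
        (affinoid (unramifiedQuadratic p) m)) := by
  have hS := isDegreeZeroSystem hRM hD r s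
  have hlim : ∀ B : ℝ, Tendsto (fun N : ℕ => B * (p : ℝ) ^ (-(N : ℤ))) atTop (𝓝 0) := fun B => by
    simpa using (tendsto_zpow_neg (p := p)).const_mul B
  refine ⟨fun z hz => ?_, ?_⟩
  · obtain ⟨l, hl⟩ := exists_mem_affinoid hz
    obtain ⟨M, MInf, A, hM⟩ := hS.exists_approximation (hR (l + 1))
    have h1 := hM.tendsto_liftSum hR hl
    rwa [← h1.limUnder_eq] at h1
  -- The value of the pairing is named as the limit of the explicit sums. It is then one function on
  -- all of H_K, although it was found separately on each affinoid.
  have key : ∀ l, ∃ B : ℝ, ∀ z ∈ affinoid (unramifiedQuadratic p) l,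
      IsMoritaPairing (unramifiedQuadratic p) (2 * h) (weightKSymbol ιInf ιp (2 * h) D R r s)
        (boundaryKernel (2 * h) L z)
        (limUnder atTop fun N => explicitSum ιInf ιp (2 * h) L D r s N z) ∧
      ∀ N, l ≤ N → ‖explicitSum ιInf ιp (2 * h) L D r s N z -
        limUnder atTop fun N => explicitSum ιInf ιp (2 * h) L D r s N z‖ ≤
          B * (p : ℝ) ^ (-(N : ℤ)) := by
    intro l
    obtain ⟨B, hB⟩ := exists_moritaPairing_approximation hRM hD hR L r s l
    refine ⟨B, fun z hz => ?_⟩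
    obtain ⟨x, h1, h2⟩ := hB z hz
    have h3 : Tendsto (fun N => explicitSum ιInf ιp (2 * h) L D r s N z) atTop (𝓝 x) := by
      rw [tendsto_iff_norm_sub_tendsto_zero]
      refine squeeze_zero' (Eventually.of_forall fun _ => norm_nonneg _) ?_ (hlim B)
      filter_upwards [eventually_ge_atTop l] with N hN
      exact h2 N hN
    rw [h3.limUnder_eq]
    exact ⟨h1, h2⟩
  have huni : ∀ m : ℕ, TendstoUniformlyOn
      (fun (l : ℕ) (z : ℂ_[p]) => explicitSum ιInf ιp (2 * h) L D r s l z)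
      (fun z => limUnder atTop fun N => explicitSum ιInf ιp (2 * h) L D r s N z) atTop
      (affinoid (unramifiedQuadratic p) m) := by
    intro m
    obtain ⟨B, hB⟩ := key m
    rw [Metric.tendstoUniformlyOn_iff]
    intro ε hε
    filter_upwards [eventually_ge_atTop m, (hlim B).eventually_lt_const hε] with N hN hNε z hz
    rw [dist_comm, dist_eq_norm]
    exact ((hB z hz).2 N hN).trans_lt hNε
  refine ⟨fun z => limUnder atTop fun N => explicitSum ιInf ιp (2 * h) L D r s N z,
    fun z hz => ?_, fun z hz => ?_, huni⟩
  · obtain ⟨l, hl⟩ := exists_mem_affinoid hz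
    obtain ⟨B, hB⟩ := key l
    exact (hB z hl).1
  · obtain ⟨l, hl⟩ := exists_mem_affinoid hz
    exact (huni l).tendsto_at hl

end MainResult

end HigherGreen

theorem mainTheorem8 (p : ℕ) [Fact p.Prime]
    (ιInf : AlgebraicClosure ℚ →+* ℂ) (ιp : AlgebraicClosure ℚ →+* ℂ_[p])
    (k : ℕ) (hk : Even k) (hk2 : 2 < k) (L : ℂ_[p])
    (D : AlgebraicClosure ℚ →₀ ℤ)
    (hRM : ∀ τ ∈ D.support, HigherGreen.IsInertRM ιInf ιp τ)
    (hD : HigherGreen.IsDegreeZero ιInf ιp (k - 2) D)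
    (R : ℕ → Finset ℂ_[p])
    (hR : ∀ l, HigherGreen.IsReps (HigherGreen.unramifiedQuadratic p) l (R l))
    (r s : OnePoint ℚ) :
    -- the limit that defines `J = J_{k, D}{r, s}` exists at every point of `H_K`
    (∀ z ∈ HigherGreen.upperHalf (HigherGreen.unramifiedQuadratic p),
      Filter.Tendsto
        (fun l : ℕ => HigherGreen.liftSum (HigherGreen.unramifiedQuadratic p) (k - 2)
          (HigherGreen.edgeFunction ιInf ιp (k - 2) D r s) (R l) l z)
        Filter.atTop (nhds (HigherGreen.weightKSymbol ιInf ιp (k - 2) D R r s z))) ∧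
    ∃ JL : ℂ_[p] → ℂ_[p],
      -- `JL z` is the Morita pairing of `J` with `l_z`
      (∀ z ∈ HigherGreen.upperHalf (HigherGreen.unramifiedQuadratic p),
        HigherGreen.IsMoritaPairing (HigherGreen.unramifiedQuadratic p) (k - 2)
          (HigherGreen.weightKSymbol ιInf ιp (k - 2) D R r s)
          (HigherGreen.boundaryKernel (k - 2) L z) (JL z)) ∧
      -- the explicit sum converges to `JL`, pointwise and uniformly on affinoids
      (∀ z ∈ HigherGreen.upperHalf (HigherGreen.unramifiedQuadratic p),
        Filter.Tendsto (fun l : ℕ => HigherGreen.explicitSum ιInf ιp (k - 2) L D r s l z)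
          Filter.atTop (nhds (JL z))) ∧
      (∀ m : ℕ, TendstoUniformlyOn
        (fun (l : ℕ) (z : ℂ_[p]) => HigherGreen.explicitSum ιInf ιp (k - 2) L D r s l z)
        JL Filter.atTop (HigherGreen.affinoid (HigherGreen.unramifiedQuadratic p) m)) := by
  obtain ⟨q, hq⟩ := hk
  obtain ⟨h, hh⟩ : ∃ h, k - 2 = 2 * h := ⟨q - 1, by omega⟩
  rw [hh] at hD ⊢
  exact HigherGreen.main_even hRM hD hR L r s
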